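/- Throughout, "time" is the number of bit operations of a deterministic random access machine with logarithmic cost: each step is charged (at least one unit plus) the bit lengths of the numbers and addresses it handles, and multiplication and division are charged the square of the bit lengths of their operands. For integers $r\ge 2$, $e\ge 1$ and a monic $E(z)\in(\mathbb Z/r\mathbb Z)[z]$ of degree $e$, elements of $R=(\mathbb Z/r\mathbb Z)[z]/(E(z))$ are given by the $e$ coefficients in $\{0,\dots,r-1\}$ of their representative of degree less than $e$; a polynomial $f\in R[x_1,\dots,x_m]$ of degree less than $d$ in each variable is given by its vector of $d^m$ coefficients. The iterate $\log_2^{\circ c}$ is the $c$-fold composition of $\log_2$, with value $0$ from the first negative or undefined iterate onwards. **Theorem.** For every $c\in\mathbb N$ there are a single deterministic algorithm $\mathcal A$ and a constant $C$ such that, for every function $\varepsilon:\mathbb N\to\mathbb R$ with $\varepsilon(d)\to 0$ as $d\to\infty$, there are a function $\delta:\mathbb N\to\mathbb R$ with $\delta(d)\to0$ and a $d_0\in\mathbb N$ with the following property. For all $m,N\in\mathbb N$, all $d\ge d_0$, all $r\ge 2$, all monic $E(z)\in(\mathbb Z/r\mathbb Z)[z]$ of degree $e\ge1$ such that $R=(\mathbb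 Z/r\mathbb Z)[z]/(E(z))$ satisfies $$\log_2^{\circ c}|R|\le d^{\,\varepsilon(d)},$$ all $f\in R[x_1,\dots,x_m]$ of degree less than $d$ in each variable and all $\mathbf a_1,\dots,\mathbf a_N\in R^m$, the algorithm $\mathcal A$, given $m,d,N,r,e,E$, the coefficients of $f$ and the points $\mathbf a_1,\dots,\mathbf a_N$, outputs $f(\mathbf a_1),\dots,f(\mathbf a_N)$ in time at most $$(d^m+N)^{1+\delta(d)}\cdot C\,(m+d+\log_2|R|)^{C}.$$ Consequently, for every $h\in\mathbb N$ there are a deterministic algorithm, a constant $C$, a function $\delta:\mathbb N\to\mathbb R$ with $\delta(d)\to0$ and a $d_0\in\mathbb N$ such that, for all $m,N\in\mathbb N$, all $d\ge d_0$ and every finite field $\mathbb F=\mathbb F_p[z]/(E(z))$ ($p$ prime, $E$ monic irreducible) with $|\mathbb F|\le\exp^{\circ h}(d)$ (a tower of $h$ exponentials over $d$), the algorithm evaluates every $m$-variate polynomial over $\mathbb F$ of degree less than $d$ in each variable at any $N$ points of $\mathbb F^m$ in time at most $(d^m+N)^{1+\delta(d)}\cdot C\,(m+d+\log_2|\mathbb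 F|)^{C}$. -/

import Mathlib

/-! ## A random access machine with logarithmic (bit) cost

Programs are finite structured programs over natural-number registers and arrays with random access.
Registers, array names and constants are fixed in the program text, so a program uses only finitely
many registers and arrays; array indices are computed at run time.
Every step is charged at least one unit plus the bit lengths of all numbers and addresses it handles;
multiplication and division are charged the square of the operand lengths (schoolbook arithmetic). -/

namespace MME

/-- A memory configuration: registers and arrays, all holding natural numbers. -/
structure State where
  reg : ℕ → ℕ
  mem : ℕ → ℕ → ℕ

/-- Arithmetic and comparison operations of the machine. -/
inductive BinOp where
  | add | sub | mul | div | mod | lt | eq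

/-- The value of an operation: `sub` truncates at zero, and comparisons return `1` or `0`. -/
def BinOp.val : BinOp → ℕ → ℕ → ℕ
  | .add, x, y => x + y
  | .sub, x, y => x - y
  | .mul, x, y => x * y
  | .div, x, y => x / y
  | .mod, x, y => x % y
  | .lt, x, y => if x < y then 1 else 0
  | .eq, x, y => if x = y then 1 else 0

/-- The bit cost of an operation (`Nat.size` is the length of the binary expansion). -/
def BinOp.cost : BinOp → ℕ → ℕ → ℕ
  | .add, x, y => 1 + x.size + y.size
  | .sub, x, y => 1 + x.size + y.size
  | .mul, x, y => 1 + (x.size + y.size) ^ 2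
  | .div, x, y => 1 + (x.size + y.size) ^ 2
  | .mod, x, y => 1 + (x.size + y.size) ^ 2
  | .lt, x, y => 1 + x.size + y.size
  | .eq, x, y => 1 + x.size + y.size

/-- Expressions: constants, register contents, array reads at a computed index, operations. -/
inductive Exp where
  | const (n : ℕ)
  | reg (x : ℕ)
  | read (A : ℕ) (i : Exp)
  | op (o : BinOp) (u v : Exp)

/-- The value of an expression. -/
def Exp.val (σ : State) : Exp → ℕ
  | .const n => n
  | .reg x => σ.reg x
  | .read A i => σ.mem A (i.val σ)
  | .op o u v => o.val (u.val σ) (v.val σ)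

/-- The bit cost of evaluating an expression. -/
def Exp.cost (σ : State) : Exp → ℕ
  | .const n => 1 + n.size
  | .reg x => 1 + (σ.reg x).size
  | .read A i => i.cost σ + (1 + (i.val σ).size + (σ.mem A (i.val σ)).size)
  | .op o u v => u.cost σ + v.cost σ + o.cost (u.val σ) (v.val σ)

/-- Deterministic programs; a test succeeds when the expression is nonzero. -/
inductive Prog where
  | skip
  | assign (x : ℕ) (u : Exp)
  | write (A : ℕ) (i u : Exp)
  | seq (P Q : Prog)
  | cond (u : Exp) (P Q : Prog)
  | loop (u : Exp) (P : Prog)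

/-- `σ` with register `x` overwritten. -/
def State.setReg (σ : State) (x v : ℕ) : State :=
  { σ with reg := Function.update σ.reg x v }

/-- `σ` with the cell `i` of the array `A` overwritten. -/
def State.setMem (σ : State) (A i v : ℕ) : State :=
  { σ with mem := Function.update σ.mem A (Function.update (σ.mem A) i v) }

/-- `Exec P σ τ t`: started in `σ`, the program `P` halts in `τ` after time exactly `t`. -/
inductive Exec : Prog → State → State → ℕ → Prop where
  | skip (σ : State) : Exec .skip σ σ 1
  | assign (x : ℕ) (u : Exp) (σ : State) :
      Exec (.assign x u) σ (σ.setReg x (u.val σ)) (1 + u.cost σ + (u.val σ).size)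
  | write (A : ℕ) (i u : Exp) (σ : State) :
      Exec (.write A i u) σ (σ.setMem A (i.val σ) (u.val σ))
        (1 + i.cost σ + u.cost σ + (i.val σ).size + (u.val σ).size)
  | seq {P Q : Prog} {σ τ ρ : State} {s t : ℕ} :
      Exec P σ τ s → Exec Q τ ρ t → Exec (.seq P Q) σ ρ (s + t)
  | condTrue {u : Exp} {P Q : Prog} {σ τ : State} {t : ℕ} :
      u.val σ ≠ 0 → Exec P σ τ t → Exec (.cond u P Q) σ τ (1 + u.cost σ + t)
  | condFalse {u : Exp} {P Q : Prog} {σ τ : State} {t : ℕ} :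
      u.val σ = 0 → Exec Q σ τ t → Exec (.cond u P Q) σ τ (1 + u.cost σ + t)
  | loopTrue {u : Exp} {P : Prog} {σ τ ρ : State} {s t : ℕ} :
      u.val σ ≠ 0 → Exec P σ τ s → Exec (.loop u P) τ ρ t →
        Exec (.loop u P) σ ρ (1 + u.cost σ + s + t)
  | loopFalse {u : Exp} {P : Prog} {σ : State} :
      u.val σ = 0 → Exec (.loop u P) σ σ (1 + u.cost σ)

/-- The machine is deterministic: final state and running time are determined by the start. -/
theorem Exec.det {P : Prog} {σ τ τ' : State} {t t' : ℕ}
    (h : Exec P σ τ t) (h' : Exec P σ τ' t') : τ = τ' ∧ t = t' := by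
  induction h generalizing τ' t' with
  | skip => cases h'; exact ⟨rfl, rfl⟩
  | assign => cases h'; exact ⟨rfl, rfl⟩
  | write => cases h'; exact ⟨rfl, rfl⟩
  | seq _ _ ih₁ ih₂ =>
    cases h' with
    | seq k₁ k₂ =>
      obtain ⟨rfl, rfl⟩ := ih₁ k₁
      obtain ⟨rfl, rfl⟩ := ih₂ k₂
      exact ⟨rfl, rfl⟩
  | condTrue hu _ ih =>
    cases h' with
    | condTrue _ k => obtain ⟨rfl, rfl⟩ := ih k; exact ⟨rfl, rfl⟩
    | condFalse hu' _ => exact absurd hu' hu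
  | condFalse hu _ ih =>
    cases h' with
    | condTrue hu' _ => exact absurd hu hu'
    | condFalse _ k => obtain ⟨rfl, rfl⟩ := ih k; exact ⟨rfl, rfl⟩
  | loopTrue hu _ _ ih₁ ih₂ =>
    cases h' with
    | loopTrue _ k₁ k₂ =>
      obtain ⟨rfl, rfl⟩ := ih₁ k₁
      obtain ⟨rfl, rfl⟩ := ih₂ k₂
      exact ⟨rfl, rfl⟩
    | loopFalse hu' => exact absurd hu' hu
  | loopFalse hu =>
    cases h' with
    | loopTrue hu' _ _ => exact absurd hu hu'
    | loopFalse _ => exact ⟨rfl, rfl⟩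

/-! ## Multivariate multipoint evaluation over `(ℤ/rℤ)[z]/(E(z))` -/

section

open Polynomial

/-- The `k`-th coefficient, as an integer in `{0, …, r-1}`, of the unique representative of degree
less than `deg E` of the residue class `x`. -/
noncomputable def digit {r : ℕ} {E : (ZMod r)[X]} (hE : E.Monic) (x : AdjoinRoot E) (k : ℕ) : ℕ :=
  ((AdjoinRoot.modByMonicHom hE x).coeff k).val

/-- The input. Registers `0,…,4` hold `m, d, N, r, e` where `e = deg E`. Array `0` holds the
coefficients of `E` below the leading one. Array `1` holds the coefficient vector of `f`: the
coefficient of `∏ xᵢ ^ kᵢ` (each `kᵢ < d`) occupies the block of `e` cells number `∑ kᵢ dⁱ`. Array `2`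
holds the points: coordinate `j` of point `i` occupies the block of `e` cells number `i m + j`.
Everything else is zero. -/
noncomputable def inputState {r : ℕ} {E : (ZMod r)[X]} (hE : E.Monic) (m d N : ℕ)
    (f : MvPolynomial (Fin m) (AdjoinRoot E)) (a : Fin N → Fin m → AdjoinRoot E) : State where
  reg x :=
    match x with
    | 0 => m
    | 1 => d
    | 2 => N
    | 3 => r
    | 4 => E.natDegree
    | _ => 0
  mem A n :=
    match A with
    | 0 => if n < E.natDegree then (E.coeff n).val else 0
    | 1 =>
      if n / E.natDegree < d ^ m then
        digit hE
          (f.coeff (Finsupp.equivFunOnFinite.symm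
            fun i : Fin m => n / E.natDegree / d ^ (i : ℕ) % d))
          (n % E.natDegree)
      else 0
    | 2 =>
      if h : n / E.natDegree / m < N ∧ n / E.natDegree % m < m then
        digit hE (a ⟨n / E.natDegree / m, h.1⟩ ⟨n / E.natDegree % m, h.2⟩) (n % E.natDegree)
      else 0
    | _ => 0

/-- On this input the program `P` halts within time `T`, with `f(a₁), …, f(a_N)` in array `3`
(the value `f(aᵢ)` in the block of `e = deg E` cells number `i`). -/
def EvaluatesWithin (P : Prog) {r : ℕ} {E : (ZMod r)[X]} (hE : E.Monic) (m d N : ℕ)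
    (f : MvPolynomial (Fin m) (AdjoinRoot E)) (a : Fin N → Fin m → AdjoinRoot E) (T : ℝ) : Prop :=
  ∃ (τ : State) (t : ℕ), Exec P (inputState hE m d N f a) τ t ∧ (t : ℝ) ≤ T ∧
    ∀ (i : Fin N) (k : ℕ), k < E.natDegree →
      τ.mem 3 (i * E.natDegree + k) = digit hE (MvPolynomial.eval (a i) f) k

end

/-- The bound `(d^m + N)^(1+δ) · C (m + d + log₂ q)^C`. -/
noncomputable def timeBound (C : ℕ) (δ : ℝ) (m d N q : ℕ) : ℝ :=
  ((d : ℝ) ^ m + N) ^ (1 + δ) * (C * ((m : ℝ) + d + Real.logb 2 q) ^ C)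

/-- The `c`-fold iterated base-2 logarithm, with the value `0` from the first iterate that is
negative or undefined onwards. -/
noncomputable def iterLog (c : ℕ) (x : ℝ) : ℝ :=
  (fun y : ℝ => max 0 (Real.logb 2 y))^[c] x

end MME

/-!
A deterministic algorithm for multipoint evaluation, in almost linear time
`(d ^ m + N) ^ (1 + o(1))`, of `m`-variate polynomials over `R = (ℤ/rℤ)[z]/(E)`, as long as some
fixed iterate of the logarithm of `|R|` is at most `d`. A tower of `h` exponentials over `d` is
brought below `d` by `2 * h` binary logarithms, so that the statement on finite fields is a
special case.

*Grid.* For integer coordinates in `{1, …, y}` all values on the grid `{1, …, y} ^ m` are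
computed, one variable at a time, and the required ones looked up (`HT.grid`). This takes about
`D ^ m + N` steps with `D = max d y`, which is almost linear if `y ≤ d ^ (1 + o(1))`.

*Small coordinates.* For larger `y`, the exact values are found by Chinese remaindering. A modulus
is the power `q ^ (m + 2)` of a small prime `q`, which makes the primes in use have only to
satisfy `∏ q ≥ d * y ^ d`, independently of `m`; by Chebyshev's bound they are of size
`O(d log y)`. To evaluate at `A` modulo `q ^ (m + 2)`, write `A = b + h` with `b` the residues in
`{1, …, q}`, so that `q` divides `h`, and use the Taylor expansion at `b`: all terms of order at
least `m + 2` vanish. The exponent vectors of order at most `m + 1` are among those with a unary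
code of `2 * m + 1` bits, and the sum over the codes of that length, some of them of higher order,
has the same residue. A Hasse derivative at `b` is obtained from the evaluation of a polynomial of
the same shape, with coefficients reweighted by binomials and reduced modulo `q ^ (m + 2)`, by an
exact division by a monomial in `b`, which is why zero coordinates are avoided
(`polyVal_add_modEq`). So `O(d log y)` moduli and `2 ^ (2 * m + 1)` codes reduce coordinates `≤ y`
to coordinates `O(d log y)` (`HT.crtProg`), and a bounded number of such rounds takes an iterated
logarithm each time (`HT.level`, `exists_resBound_le`).

*Extension rings.* Lift coefficients and points to polynomials in `z` with small coefficients and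
substitute a large integer `M` for `z`; the coefficients of the value are the digits in base `M`,
and Horner's rule modulo `E` yields the value in `R` (`horner_ringValue`). The powers of `z` in
the coefficients of `f` are treated one by one. The integer points are huge, of bit length
polynomial in `m`, but with `S` moduli `M - i * S!`, `i < S`, where `M ≡ 1` modulo `S!`, the
moduli are pairwise coprime and `M` is congruent to the small number `i * S!`. So the coordinates
have residues whose bit length is polynomial in `d` and `log |R|`, independently of `m`, and the
same Chinese remaindering with powers of these moduli starts the recursion.

*Time.* All numbers have bit length polynomial in `m`, `d` and `log |R|`, up to a factor `log N`
(`ringBounds_of_le`), so it is enough to count steps. The factors `2 ^ (2 * m + 1)` of the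
boundedly many levels are `(d ^ m) ^ O(1 / log d)`, the final grid has side `d ^ (1 + o(1))`, and
the powers of `log N` are absorbed by `N ^ (3 / d)` and a power of `d` (`le_timeBound`).
-/

/-! ### Step counts and bounded values -/

namespace MME

/-- All registers and array cells of `σ` hold numbers `≤ V`. -/
def State.Bdd (V : ℕ) (σ : State) : Prop :=
  (∀ x, σ.reg x ≤ V) ∧ ∀ A i, σ.mem A i ≤ V

/-- `Runs V P σ τ n`: started in `σ`, the program `P` halts in `τ` after `n` unit steps (one per
assignment, write or test), and every number it stores on the way is at most `V`. -/
inductive Runs (V : ℕ) : Prog → State → State → ℕ → Prop where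
  | skip (σ : State) : Runs V .skip σ σ 1
  | assign (x : ℕ) (u : Exp) (σ : State) (h : u.val σ ≤ V) :
      Runs V (.assign x u) σ (σ.setReg x (u.val σ)) 1
  | write (A : ℕ) (i u : Exp) (σ : State) (h : u.val σ ≤ V) :
      Runs V (.write A i u) σ (σ.setMem A (i.val σ) (u.val σ)) 1
  | seq {P Q : Prog} {σ τ ρ : State} {s t : ℕ} :
      Runs V P σ τ s → Runs V Q τ ρ t → Runs V (.seq P Q) σ ρ (s + t)
  | condTrue {u : Exp} {P Q : Prog} {σ τ : State} {t : ℕ} :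
      u.val σ ≠ 0 → Runs V P σ τ t → Runs V (.cond u P Q) σ τ (1 + t)
  | condFalse {u : Exp} {P Q : Prog} {σ τ : State} {t : ℕ} :
      u.val σ = 0 → Runs V Q σ τ t → Runs V (.cond u P Q) σ τ (1 + t)
  | loopTrue {u : Exp} {P : Prog} {σ τ ρ : State} {s t : ℕ} :
      u.val σ ≠ 0 → Runs V P σ τ s → Runs V (.loop u P) τ ρ t →
        Runs V (.loop u P) σ ρ (1 + s + t)
  | loopFalse {u : Exp} {P : Prog} {σ : State} :
      u.val σ = 0 → Runs V (.loop u P) σ σ 1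

/-- A factor bounding the length of the value of an expression in terms of the lengths of the
numbers in memory. -/
def Exp.wt : Exp → ℕ
  | .const n => n.size
  | .reg _ => 1
  | .read _ _ => 1
  | .op _ u v => u.wt + v.wt + 1

/-- A factor bounding the cost of an expression by the squared length of the numbers in memory. -/
def Exp.costFactor : Exp → ℕ
  | .const n => 1 + n.size
  | .reg _ => 2
  | .read _ i => i.costFactor + (2 + i.wt)
  | .op _ u v => u.costFactor + v.costFactor + (1 + (u.wt + v.wt) ^ 2)

/-- A factor bounding the cost of a single step of a program by the squared length of the numbers
in memory. -/
def Prog.costFactor : Prog → ℕ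
  | .skip => 1
  | .assign _ u => 1 + u.costFactor + u.wt
  | .write _ i u => 1 + i.costFactor + u.costFactor + i.wt + u.wt
  | .seq P Q => P.costFactor + Q.costFactor
  | .cond u P Q => 1 + u.costFactor + P.costFactor + Q.costFactor
  | .loop u P => 1 + u.costFactor + P.costFactor

theorem BinOp.size_val_le (o : BinOp) (x y : ℕ) : (o.val x y).size ≤ x.size + y.size + 1 := by
  have hx := Nat.lt_size_self x
  have hy := Nat.lt_size_self y
  have h1 : (1 : ℕ) ≤ 2 ^ x.size := Nat.one_le_two_pow
  have h2 : (1 : ℕ) ≤ 2 ^ y.size := Nat.one_le_two_pow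
  rw [Nat.size_le, pow_succ, pow_add]
  cases o
  · simp only [BinOp.val]; nlinarith
  · simp only [BinOp.val]
    calc x - y ≤ x := Nat.sub_le _ _
      _ < 2 ^ x.size * 2 ^ y.size * 2 := by nlinarith
  · simp only [BinOp.val]; nlinarith
  · simp only [BinOp.val]
    calc x / y ≤ x := Nat.div_le_self _ _
      _ < 2 ^ x.size * 2 ^ y.size * 2 := by nlinarith
  · simp only [BinOp.val]
    calc x % y ≤ x := Nat.mod_le _ _
      _ < 2 ^ x.size * 2 ^ y.size * 2 := by nlinarith
  · simp only [BinOp.val]; split <;> nlinarith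
  · simp only [BinOp.val]; split <;> nlinarith

theorem BinOp.cost_le (o : BinOp) (x y : ℕ) : o.cost x y ≤ 1 + (x.size + y.size) ^ 2 := by
  have : x.size + y.size ≤ (x.size + y.size) ^ 2 := Nat.le_self_pow two_ne_zero _
  cases o <;> simp only [BinOp.cost] <;> omega

theorem Exp.size_val_le {V : ℕ} {σ : State} (hV : 1 ≤ V) (h : σ.Bdd V) (u : Exp) :
    (u.val σ).size ≤ u.wt * V.size := by
  have hL : 1 ≤ V.size := Nat.size_pos.2 hV
  induction u with
  | const n => simpa [Exp.val, Exp.wt] using Nat.le_mul_of_pos_right _ hL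
  | reg x => simpa [Exp.val, Exp.wt] using Nat.size_le_size (h.1 x)
  | read A i _ => simpa [Exp.val, Exp.wt] using Nat.size_le_size (h.2 A _)
  | op o u v hu hv =>
    refine (BinOp.size_val_le _ _ _).trans ?_
    simp only [Exp.wt]; nlinarith

theorem Exp.cost_le {V : ℕ} {σ : State} (hV : 1 ≤ V) (h : σ.Bdd V) (u : Exp) :
    u.cost σ ≤ u.costFactor * V.size ^ 2 := by
  have hL : 1 ≤ V.size := Nat.size_pos.2 hV
  have hL2 : V.size ≤ V.size ^ 2 := Nat.le_self_pow two_ne_zero _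
  induction u with
  | const n =>
    simp only [Exp.cost, Exp.costFactor]
    exact Nat.le_mul_of_pos_right _ (by positivity)
  | reg x =>
    have := Nat.size_le_size (h.1 x)
    simp only [Exp.cost, Exp.costFactor]; nlinarith
  | read A i hi =>
    have h1 := Nat.size_le_size (h.2 A (i.val σ))
    have h2 := Exp.size_val_le hV h i
    simp only [Exp.cost, Exp.costFactor]; nlinarith [Nat.mul_le_mul_left i.wt hL2]
  | op o u v hu hv =>
    have h1 := Exp.size_val_le hV h u
    have h2 := Exp.size_val_le hV h v
    have h3 := BinOp.cost_le o (u.val σ) (v.val σ)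
    have h4 : ((u.val σ).size + (v.val σ).size) ^ 2 ≤ (u.wt * V.size + v.wt * V.size) ^ 2 := by
      gcongr
    simp only [Exp.cost, Exp.costFactor]
    nlinarith

theorem State.Bdd.setReg {V : ℕ} {σ : State} (h : σ.Bdd V) {x v : ℕ} (hv : v ≤ V) :
    (σ.setReg x v).Bdd V := by
  refine ⟨fun y => ?_, h.2⟩
  simp only [State.setReg, Function.update_apply]
  split
  · exact hv
  · exact h.1 y

theorem State.Bdd.setMem {V : ℕ} {σ : State} (h : σ.Bdd V) {A i v : ℕ} (hv : v ≤ V) :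
    (σ.setMem A i v).Bdd V := by
  refine ⟨h.1, fun B j => ?_⟩
  simp only [State.setMem, Function.update_apply]
  split
  · rw [Function.update_apply]
    split
    · exact hv
    · exact h.2 _ _
  · exact h.2 _ _

/-- If all numbers stored have length at most that of `V`, the bit cost is at most a constant
depending on the program, times the number of steps, times the square of that length. -/
theorem Runs.exec {V : ℕ} {P : Prog} {σ τ : State} {n : ℕ} (hr : Runs V P σ τ n) (hV : 1 ≤ V)
    (hσ : σ.Bdd V) :
    τ.Bdd V ∧ ∃ t, Exec P σ τ t ∧ t ≤ n * (P.costFactor * V.size ^ 2) := by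
  have hL : 1 ≤ V.size := Nat.size_pos.2 hV
  have hL2 : V.size ≤ V.size ^ 2 := Nat.le_self_pow two_ne_zero _
  have hL3 : 1 ≤ V.size ^ 2 := hL.trans hL2
  induction hr with
  | skip σ => exact ⟨hσ, _, .skip σ, by simp [Prog.costFactor]; omega⟩
  | assign x u σ h =>
    refine ⟨hσ.setReg h, _, .assign x u σ, ?_⟩
    have h1 := Exp.cost_le hV hσ u
    have h2 := Exp.size_val_le hV hσ u
    have h3 := Nat.mul_le_mul_left u.wt hL2
    simp only [Prog.costFactor]; nlinarith
  | write A i u σ h =>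
    refine ⟨hσ.setMem h, _, .write A i u σ, ?_⟩
    have h1 := Exp.cost_le hV hσ u
    have h2 := Exp.size_val_le hV hσ u
    have h3 := Nat.mul_le_mul_left u.wt hL2
    have h1' := Exp.cost_le hV hσ i
    have h2' := Exp.size_val_le hV hσ i
    have h3' := Nat.mul_le_mul_left i.wt hL2
    simp only [Prog.costFactor]; nlinarith
  | @seq P Q σ τ ρ s t _ _ ih1 ih2 =>
    obtain ⟨h1, t1, e1, c1⟩ := ih1 hσ
    obtain ⟨h2, t2, e2, c2⟩ := ih2 h1
    refine ⟨h2, _, .seq e1 e2, ?_⟩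
    have a1 : s * (P.costFactor * V.size ^ 2) ≤
      s * ((P.costFactor + Q.costFactor) * V.size ^ 2) := by gcongr; omega
    have a2 : t * (Q.costFactor * V.size ^ 2) ≤
      t * ((P.costFactor + Q.costFactor) * V.size ^ 2) := by gcongr; omega
    simp only [Prog.costFactor]; rw [add_mul]; omega
  | @condTrue u P Q σ τ t hu _ ih =>
    obtain ⟨h1, t1, e1, c1⟩ := ih hσ
    refine ⟨h1, _, .condTrue hu e1, ?_⟩
    have a := Exp.cost_le hV hσ u
    have a1 : t * (P.costFactor * V.size ^ 2) ≤
      t * ((1 + u.costFactor + P.costFactor + Q.costFactor) * V.size ^ 2) := by gcongr; omega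
    have a2 : 1 + u.costFactor * V.size ^ 2 ≤
      (1 + u.costFactor + P.costFactor + Q.costFactor) * V.size ^ 2 := by nlinarith
    simp only [Prog.costFactor]; rw [add_mul]; omega
  | @condFalse u P Q σ τ t hu _ ih =>
    obtain ⟨h1, t1, e1, c1⟩ := ih hσ
    refine ⟨h1, _, .condFalse hu e1, ?_⟩
    have a := Exp.cost_le hV hσ u
    have a1 : t * (Q.costFactor * V.size ^ 2) ≤
      t * ((1 + u.costFactor + P.costFactor + Q.costFactor) * V.size ^ 2) := by gcongr; omega
    have a2 : 1 + u.costFactor * V.size ^ 2 ≤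
      (1 + u.costFactor + P.costFactor + Q.costFactor) * V.size ^ 2 := by nlinarith
    simp only [Prog.costFactor]; rw [add_mul]; omega
  | @loopTrue u P σ τ ρ s t hu _ _ ih1 ih2 =>
    obtain ⟨h1, t1, e1, c1⟩ := ih1 hσ
    obtain ⟨h2, t2, e2, c2⟩ := ih2 h1
    refine ⟨h2, _, .loopTrue hu e1 e2, ?_⟩
    have a := Exp.cost_le hV hσ u
    have a1 : s * (P.costFactor * V.size ^ 2) ≤
      s * ((1 + u.costFactor + P.costFactor) * V.size ^ 2) := by gcongr; omega
    have a2 : 1 + u.costFactor * V.size ^ 2 ≤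
      (1 + u.costFactor + P.costFactor) * V.size ^ 2 := by nlinarith
    simp only [Prog.costFactor] at c2 ⊢; rw [add_mul, add_mul]; omega
  | @loopFalse u P σ hu =>
    refine ⟨hσ, _, .loopFalse hu, ?_⟩
    have a := Exp.cost_le hV hσ u
    simp only [Prog.costFactor]; nlinarith

/-! ### Frames and relocation -/

/-- `P` contains an assignment to the register `x`. -/
def Prog.WR (x : ℕ) : Prog → Prop
  | .skip => False
  | .assign y _ => x = y
  | .write _ _ _ => False
  | .seq P Q => P.WR x ∨ Q.WR x
  | .cond _ P Q => P.WR x ∨ Q.WR x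
  | .loop _ P => P.WR x

/-- `P` contains a write to the array `A`. -/
def Prog.WM (A : ℕ) : Prog → Prop
  | .skip => False
  | .assign _ _ => False
  | .write B _ _ => A = B
  | .seq P Q => P.WM A ∨ Q.WM A
  | .cond _ P Q => P.WM A ∨ Q.WM A
  | .loop _ P => P.WM A

/-- `τ` agrees with `σ` on all registers and arrays that `P` never writes to. -/
structure Frame (P : Prog) (σ τ : State) : Prop where
  reg : ∀ x, ¬ P.WR x → τ.reg x = σ.reg x
  mem : ∀ A, ¬ P.WM A → τ.mem A = σ.mem A

theorem Frame.refl (P : Prog) (σ : State) : Frame P σ σ := ⟨fun _ _ => rfl, fun _ _ => rfl⟩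

theorem Frame.trans {P : Prog} {σ τ ρ : State} (h : Frame P σ τ) (h' : Frame P τ ρ) :
    Frame P σ ρ :=
  ⟨fun x hx => (h'.reg x hx).trans (h.reg x hx), fun A hA => (h'.mem A hA).trans (h.mem A hA)⟩

theorem Frame.mono {P Q : Prog} {σ τ : State} (h : Frame P σ τ) (hR : ∀ x, P.WR x → Q.WR x)
    (hM : ∀ A, P.WM A → Q.WM A) : Frame Q σ τ :=
  ⟨fun x hx => h.reg x fun hP => hx (hR x hP), fun A hA => h.mem A fun hP => hA (hM A hP)⟩

theorem Runs.frame {V : ℕ} {P : Prog} {σ τ : State} {n : ℕ} (hr : Runs V P σ τ n) :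
    Frame P σ τ := by
  induction hr with
  | skip σ => exact .refl _ _
  | assign x u σ h =>
    refine ⟨fun y hy => ?_, fun _ _ => rfl⟩
    simp only [Prog.WR] at hy
    simp [State.setReg, hy]
  | write A i u σ h =>
    refine ⟨fun _ _ => rfl, fun B hB => ?_⟩
    simp only [Prog.WM] at hB
    simp [State.setMem, hB]
  | seq _ _ ih1 ih2 =>
    exact (ih1.mono (fun _ => Or.inl) (fun _ => Or.inl)).trans
      (ih2.mono (fun _ => Or.inr) (fun _ => Or.inr))
  | condTrue _ _ ih => exact ih.mono (fun _ => Or.inl) (fun _ => Or.inl)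
  | condFalse _ _ ih => exact ih.mono (fun _ => Or.inr) (fun _ => Or.inr)
  | loopTrue _ _ _ ih1 ih2 =>
    exact Frame.trans ⟨ih1.reg, ih1.mem⟩ ih2
  | loopFalse => exact .refl _ _

/-- The expression with all registers and arrays renamed by adding `s`. -/
def Exp.shift (s : ℕ) : Exp → Exp
  | .const n => .const n
  | .reg x => .reg (x + s)
  | .read A i => .read (A + s) (i.shift s)
  | .op o u v => .op o (u.shift s) (v.shift s)

/-- The program with all registers and arrays renamed by adding `s`. -/
def Prog.shift (s : ℕ) : Prog → Prog
  | .skip => .skip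
  | .assign x u => .assign (x + s) (u.shift s)
  | .write A i u => .write (A + s) (i.shift s) (u.shift s)
  | .seq P Q => .seq (P.shift s) (Q.shift s)
  | .cond u P Q => .cond (u.shift s) (P.shift s) (Q.shift s)
  | .loop u P => .loop (u.shift s) (P.shift s)

/-- The part of the memory that a program renamed by `s` sees. -/
def State.view (s : ℕ) (σ : State) : State := ⟨fun x => σ.reg (x + s), fun A => σ.mem (A + s)⟩

@[simp] theorem State.view_reg (s : ℕ) (σ : State) (x : ℕ) : (σ.view s).reg x = σ.reg (x + s) := rfl
@[simp] theorem State.view_mem (s : ℕ) (σ : State) (A : ℕ) : (σ.view s).mem A = σ.mem (A + s) := rfl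

theorem Exp.val_shift (s : ℕ) (σ : State) (u : Exp) : (u.shift s).val σ = u.val (σ.view s) := by
  induction u with
  | const n => rfl
  | reg x => rfl
  | read A i ih => simp [Exp.shift, Exp.val, ih]
  | op o u v hu hv => simp [Exp.shift, Exp.val, hu, hv]

theorem State.view_setReg (s : ℕ) (σ : State) (x v : ℕ) :
    (σ.setReg (x + s) v).view s = (σ.view s).setReg x v := by
  simp only [State.view, State.setReg, State.mk.injEq, and_true]
  funext y
  simp [Function.update_apply]

theorem State.view_setMem (s : ℕ) (σ : State) (A i v : ℕ) :
    (σ.setMem (A + s) i v).view s = (σ.view s).setMem A i v := by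
  simp only [State.view, State.setMem, State.mk.injEq, true_and]
  funext B
  simp [Function.update_apply]

theorem Runs.shift {V s : ℕ} {P : Prog} {σ' τ' : State} {n : ℕ} (hr : Runs V P σ' τ' n) :
    ∀ σ : State, σ.view s = σ' → ∃ τ : State, Runs V (P.shift s) σ τ n ∧ τ.view s = τ' := by
  induction hr with
  | skip _ => rintro σ rfl; exact ⟨_, .skip σ, rfl⟩
  | assign x u _ h =>
    rintro σ rfl
    refine ⟨_, .assign _ _ σ (by rwa [Exp.val_shift]), ?_⟩
    rw [State.view_setReg, Exp.val_shift]
  | write A i u _ h =>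
    rintro σ rfl
    refine ⟨_, .write _ _ _ σ (by rwa [Exp.val_shift]), ?_⟩
    rw [State.view_setMem, Exp.val_shift, Exp.val_shift]
  | seq _ _ ih1 ih2 =>
    intro σ hσ
    obtain ⟨τ, h1, e1⟩ := ih1 σ hσ
    obtain ⟨ρ, h2, e2⟩ := ih2 τ e1
    exact ⟨ρ, .seq h1 h2, e2⟩
  | condTrue hu _ ih =>
    rintro σ rfl
    obtain ⟨τ, h1, e1⟩ := ih σ rfl
    exact ⟨τ, .condTrue (by rwa [Exp.val_shift]) h1, e1⟩
  | condFalse hu _ ih =>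
    rintro σ rfl
    obtain ⟨τ, h1, e1⟩ := ih σ rfl
    exact ⟨τ, .condFalse (by rwa [Exp.val_shift]) h1, e1⟩
  | loopTrue hu _ _ ih1 ih2 =>
    rintro σ rfl
    obtain ⟨τ, h1, e1⟩ := ih1 σ rfl
    obtain ⟨ρ, h2, e2⟩ := ih2 τ e1
    exact ⟨ρ, .loopTrue (by rwa [Exp.val_shift]) h1 h2, e2⟩
  | loopFalse hu =>
    rintro σ rfl
    exact ⟨σ, .loopFalse (by rwa [Exp.val_shift]), rfl⟩

theorem Prog.not_WR_shift {s x : ℕ} (h : x < s) (P : Prog) : ¬ (P.shift s).WR x := by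
  induction P with
  | skip => simp [Prog.shift, Prog.WR]
  | assign y u => simp only [Prog.shift, Prog.WR]; omega
  | write => simp [Prog.shift, Prog.WR]
  | seq P Q h1 h2 => simp [Prog.shift, Prog.WR, h1, h2]
  | cond u P Q h1 h2 => simp [Prog.shift, Prog.WR, h1, h2]
  | loop u P h1 => simp [Prog.shift, Prog.WR, h1]

theorem Prog.not_WM_shift {s x : ℕ} (h : x < s) (P : Prog) : ¬ (P.shift s).WM x := by
  induction P with
  | skip => simp [Prog.shift, Prog.WM]
  | assign y u => simp [Prog.shift, Prog.WM]
  | write => simp only [Prog.shift, Prog.WM]; omega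
  | seq P Q h1 h2 => simp [Prog.shift, Prog.WM, h1, h2]
  | cond u P Q h1 h2 => simp [Prog.shift, Prog.WM, h1, h2]
  | loop u P h1 => simp [Prog.shift, Prog.WM, h1]

/-! ### Total correctness with step counts -/

/-- Started in `σ`, the program `P` halts after at most `n` steps in a state satisfying `Q`, storing
only numbers `≤ V` on the way. -/
def HT (V : ℕ) (P : Prog) (σ : State) (n : ℕ) (Q : State → Prop) : Prop :=
  ∃ τ k, Runs V P σ τ k ∧ k ≤ n ∧ Q τ

variable {V : ℕ} {σ : State} {P Q : Prog} {n n' : ℕ} {R R' : State → Prop}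

/-- The rules give step counts in the shape of the program, a sum or a product; correctness proofs
start by weakening such an expression to a readable bound. -/
theorem HT.mono (h : HT V P σ n R) (hn : n ≤ n') (hR : ∀ τ, Frame P σ τ → R τ → R' τ) :
    HT V P σ n' R' := by
  obtain ⟨τ, k, hr, hk, hq⟩ := h
  exact ⟨τ, k, hr, hk.trans hn, hR τ hr.frame hq⟩

theorem HT.skip (h : R σ) : HT V .skip σ 1 R := ⟨σ, 1, .skip σ, le_rfl, h⟩

theorem HT.assign {x : ℕ} {u : Exp} (hv : u.val σ ≤ V) (h : R (σ.setReg x (u.val σ))) :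
    HT V (.assign x u) σ 1 R := ⟨_, 1, .assign x u σ hv, le_rfl, h⟩

theorem HT.write {A : ℕ} {i u : Exp} (hv : u.val σ ≤ V)
    (h : R (σ.setMem A (i.val σ) (u.val σ))) :
    HT V (.write A i u) σ 1 R := ⟨_, 1, .write A i u σ hv, le_rfl, h⟩

theorem HT.seq (h : HT V P σ n R) (h' : ∀ τ, Frame P σ τ → R τ → HT V Q τ n' R') :
    HT V (.seq P Q) σ (n + n') R' := by
  obtain ⟨τ, k, hr, hk, hq⟩ := h
  obtain ⟨ρ, k', hr', hk', hq'⟩ := h' τ hr.frame hq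
  exact ⟨ρ, k + k', .seq hr hr', by omega, hq'⟩

theorem HT.assign_seq {x : ℕ} {u : Exp} (hv : u.val σ ≤ V)
    (h : HT V Q (σ.setReg x (u.val σ)) n R) :
    HT V (.seq (.assign x u) Q) σ (1 + n) R := by
  obtain ⟨τ, k, hr, hk, hq⟩ := h
  exact ⟨τ, 1 + k, .seq (.assign x u σ hv) hr, by omega, hq⟩

theorem HT.write_seq {A : ℕ} {i u : Exp} (hv : u.val σ ≤ V)
    (h : HT V Q (σ.setMem A (i.val σ) (u.val σ)) n R) :
    HT V (.seq (.write A i u) Q) σ (1 + n) R := by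
  obtain ⟨τ, k, hr, hk, hq⟩ := h
  exact ⟨τ, 1 + k, .seq (.write A i u σ hv) hr, by omega, hq⟩

theorem HT.cond {u : Exp} (h1 : u.val σ ≠ 0 → HT V P σ n R) (h2 : u.val σ = 0 → HT V Q σ n R) :
    HT V (.cond u P Q) σ (1 + n) R := by
  by_cases hu : u.val σ = 0
  · obtain ⟨τ, k, hr, hk, hq⟩ := h2 hu
    exact ⟨τ, 1 + k, .condFalse hu hr, by omega, hq⟩
  · obtain ⟨τ, k, hr, hk, hq⟩ := h1 hu
    exact ⟨τ, 1 + k, .condTrue hu hr, by omega, hq⟩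

/-- A loop whose invariant is indexed by a decreasing counter. -/
theorem HT.while {u : Exp} {s : ℕ} (Inv : ℕ → State → Prop) (h0 : Inv n σ)
    (hend : ∀ j τ, Frame P σ τ → Inv j τ → u.val τ = 0 → R τ)
    (hstep : ∀ j τ, Frame P σ τ → Inv j τ → u.val τ ≠ 0 →
      ∃ j', j = j' + 1 ∧ HT V P τ s (Inv j')) :
    HT V (.loop u P) σ (n * (s + 1) + 1) R := by
  suffices H : ∀ (j : ℕ) (τ : State), Frame P σ τ → Inv j τ →
      HT V (.loop u P) τ (j * (s + 1) + 1) R from H n σ (.refl _ _) h0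
  intro j
  induction j with
  | zero =>
    intro τ hf hi
    by_cases hu : u.val τ = 0
    · exact ⟨τ, 1, .loopFalse hu, by omega, hend _ _ hf hi hu⟩
    · obtain ⟨j', hj, _⟩ := hstep _ _ hf hi hu
      omega
  | succ j ih =>
    intro τ hf hi
    by_cases hu : u.val τ = 0
    · exact ⟨τ, 1, .loopFalse hu, by omega, hend _ _ hf hi hu⟩
    · obtain ⟨j', hj, τ', k, hr, hk, hi'⟩ := hstep _ _ hf hi hu
      obtain rfl : j = j' := by omega
      obtain ⟨ρ, k', hr', hk', hq⟩ := ih τ' (hf.trans hr.frame) hi'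
      refine ⟨ρ, _, .loopTrue hu hr hr', ?_, hq⟩
      rw [add_mul]; omega

/-- `for i < u do P`; the bound `u` is re-evaluated at each turn. -/
def Prog.for (i : ℕ) (u : Exp) (P : Prog) : Prog :=
  .seq (.assign i (.const 0)) (.loop (.op .lt (.reg i) u)
    (.seq P (.assign i (.op .add (.reg i) (.const 1)))))

theorem State.setReg_reg (σ : State) (x v y : ℕ) :
    (σ.setReg x v).reg y = if y = x then v else σ.reg y := by
  simp [State.setReg, Function.update_apply]

theorem State.setReg_mem (σ : State) (x v : ℕ) : (σ.setReg x v).mem = σ.mem := rfl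

theorem State.setMem_reg (σ : State) (A i v : ℕ) : (σ.setMem A i v).reg = σ.reg := rfl

theorem State.setMem_mem (σ : State) (A i v B j : ℕ) :
    (σ.setMem A i v).mem B j = if B = A ∧ j = i then v else σ.mem B j := by
  simp only [State.setMem, Function.update_apply]
  by_cases hB : B = A
  · subst hB; simp [Function.update_apply]
  · simp [hB]

theorem State.setMem_mem_ne (σ : State) {A B : ℕ} (i v : ℕ) (h : B ≠ A) :
    (σ.setMem A i v).mem B = σ.mem B := by
  simp [State.setMem, h]

theorem Prog.WR_for (i : ℕ) (u : Exp) (P : Prog) (x : ℕ) :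
    (Prog.for i u P).WR x ↔ x = i ∨ P.WR x := by
  simp only [Prog.for, Prog.WR]; tauto

theorem Prog.WM_for (i : ℕ) (u : Exp) (P : Prog) (x : ℕ) :
    (Prog.for i u P).WM x ↔ P.WM x := by
  simp [Prog.for, Prog.WM]

/-- The rule for counted loops. The frame of the loop is available in all premises. -/
theorem HT.for {i : ℕ} {u : Exp} {s : ℕ} (Inv : ℕ → State → Prop) (hn : n ≤ V)
    (hi : ¬ P.WR i)
    (hu : ∀ j τ, Frame (.for i u P) σ τ → Inv j τ → u.val τ = n)
    (h0 : Inv 0 (σ.setReg i 0))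
    (hb : ∀ j τ, j < n → Frame (.for i u P) σ τ → τ.reg i = j → Inv j τ →
      HT V P τ s (fun τ' => Inv (j + 1) (τ'.setReg i (j + 1))))
    (hR : ∀ τ, Frame (.for i u P) σ τ → τ.reg i = n → Inv n τ → R τ) :
    HT V (.for i u P) σ (n * (s + 2) + 2) R := by
  have hF : ∀ τ, Frame (P.seq (.assign i (.op .add (.reg i) (.const 1)))) (σ.setReg i 0) τ →
      Frame (.for i u P) σ τ := by
    intro τ hτ
    refine ⟨fun x hx => ?_, fun A hA => ?_⟩
    · rw [Prog.WR_for] at hx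
      push Not at hx
      rw [hτ.reg x (by simp [Prog.WR, hx]), State.setReg_reg, if_neg hx.1]
    · rw [Prog.WM_for] at hA
      rw [hτ.mem A (by simp [Prog.WM, hA]), State.setReg_mem]
  have key : HT V (.loop (.op .lt (.reg i) u)
    (.seq P (.assign i (.op .add (.reg i) (.const 1))))) (σ.setReg i 0) (n * (s + 1 + 1) + 1) R := by
    refine HT.while (fun j τ => ∃ k, k + j = n ∧ τ.reg i = k ∧ Inv k τ) ⟨0, by omega, ?_, h0⟩ ?_ ?_
    · simp [State.setReg_reg]
    · rintro j τ hf ⟨k, hk, hr, hI⟩ hz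
      have := hu _ _ (hF τ hf) hI
      simp only [Exp.val, BinOp.val, this, hr, ite_eq_right_iff, one_ne_zero, imp_false] at hz
      obtain rfl : k = n := by omega
      exact hR τ (hF τ hf) hr hI
    · rintro j τ hf ⟨k, hk, hr, hI⟩ hz
      have := hu _ _ (hF τ hf) hI
      simp only [Exp.val, BinOp.val, this, hr, ne_eq, ite_eq_right_iff, one_ne_zero, imp_false,
        not_not] at hz
      refine ⟨j - 1, by omega, ?_⟩
      refine HT.seq (hb k τ hz (hF τ hf) hr hI) fun τ' hf' hI' => ?_
      have hr' : τ'.reg i = k := by rw [hf'.reg i hi, hr]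
      refine HT.assign ?_ ?_
      · simp [Exp.val, BinOp.val, hr']; omega
      · refine ⟨k + 1, by omega, ?_, ?_⟩
        · simp [State.setReg_reg, Exp.val, BinOp.val, hr']
        · simpa [Exp.val, BinOp.val, hr'] using hI'
  have := HT.assign_seq (V := V) (σ := σ) (x := i) (u := .const 0) (by simp [Exp.val]) key
  exact this.mono (by ring_nf; omega) (fun _ _ h => h)

theorem HT.shift {s : ℕ} (h : HT V P (σ.view s) n R) :
    HT V (P.shift s) σ n (fun τ => R (τ.view s)) := by
  obtain ⟨τ', k, hr, hk, hq⟩ := h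
  obtain ⟨τ, h1, e1⟩ := hr.shift σ rfl
  exact ⟨τ, k, h1, hk, by simpa only [e1] using hq⟩

/-! ### Notation for programs -/

instance : Add Exp := ⟨.op .add⟩
instance : Sub Exp := ⟨.op .sub⟩
instance : Mul Exp := ⟨.op .mul⟩
instance : Div Exp := ⟨.op .div⟩
instance : Mod Exp := ⟨.op .mod⟩
instance (n : ℕ) : OfNat Exp n := ⟨.const n⟩

/-- The truth value of `u < v`. -/
def Exp.lt (u v : Exp) : Exp := .op .lt u v

/-- The truth value of `u = v`. -/
def Exp.eq (u v : Exp) : Exp := .op .eq u v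

theorem Exp.val_add (u v : Exp) : (u + v).val σ = u.val σ + v.val σ := rfl
theorem Exp.val_sub (u v : Exp) : (u - v).val σ = u.val σ - v.val σ := rfl
theorem Exp.val_mul (u v : Exp) : (u * v).val σ = u.val σ * v.val σ := rfl
theorem Exp.val_div (u v : Exp) : (u / v).val σ = u.val σ / v.val σ := rfl
theorem Exp.val_mod (u v : Exp) : (u % v).val σ = u.val σ % v.val σ := rfl
theorem Exp.val_ofNat (n : ℕ) : (OfNat.ofNat n : Exp).val σ = n := rfl
theorem Exp.val_zero : (0 : Exp).val σ = 0 := rfl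
theorem Exp.val_one : (1 : Exp).val σ = 1 := rfl
theorem Exp.val_two : (2 : Exp).val σ = 2 := rfl
theorem Exp.val_reg (x : ℕ) : (Exp.reg x).val σ = σ.reg x := rfl
theorem Exp.val_read (A : ℕ) (i : Exp) : (Exp.read A i).val σ = σ.mem A (i.val σ) := rfl
theorem Exp.val_lt (u v : Exp) : (u.lt v).val σ = if u.val σ < v.val σ then 1 else 0 := rfl
theorem Exp.val_eq (u v : Exp) : (u.eq v).val σ = if u.val σ = v.val σ then 1 else 0 := rfl

attribute [simp] Exp.val_add Exp.val_sub Exp.val_mul Exp.val_div Exp.val_mod Exp.val_ofNat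
  Exp.val_zero Exp.val_one Exp.val_two Exp.val_reg Exp.val_read Exp.val_lt Exp.val_eq
  State.setReg_reg State.setReg_mem State.setMem_reg State.setMem_mem State.setMem_mem_ne
  Prog.WR Prog.WM Prog.WR_for Prog.WM_for Prog.not_WR_shift Prog.not_WM_shift

notation "ρ" x:max => Exp.reg x
infixr:35 " ;; " => Prog.seq
infix:36 " ≔ " => Prog.assign

/-- The loop `x := 1; for i < v do x := x * u` computes a power. -/
def Prog.pow (x i : ℕ) (u v : Exp) : Prog :=
  x ≔ 1 ;; .for i v (x ≔ ρ x * u)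

/-- Since the arguments may be evaluated in any intermediate state, they are assumed not to depend
on the two registers that the loop changes. -/
theorem HT.pow {x i : ℕ} {u v : Exp} (hxi : x ≠ i) {b k : ℕ}
    (hb : ∀ τ, Frame (.pow x i u v) σ τ → u.val τ = b)
    (hk : ∀ τ, Frame (.pow x i u v) σ τ → v.val τ = k) (hk' : k ≤ V) (hV : 1 ≤ V)
    (hbk : b ^ k ≤ V) :
    HT V (.pow x i u v) σ (k * 3 + 3) (fun τ => τ.reg x = b ^ k) := by
  have hF : ∀ τ, Frame (.for i v (x ≔ ρ x * u)) (σ.setReg x 1) τ →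
      Frame (.pow x i u v) σ τ := by
    intro τ hτ
    refine ⟨fun y hy => ?_, fun A hA => ?_⟩
    · simp only [Prog.pow, Prog.WR, Prog.WR_for] at hy
      push Not at hy
      rw [hτ.reg y (by simp [Prog.WR, Prog.WR_for, hy]), State.setReg_reg, if_neg hy.1]
    · rw [hτ.mem A (by simp [Prog.WM, Prog.WM_for]), State.setReg_mem]
  have key : HT V (.for i v (x ≔ ρ x * u)) (σ.setReg x 1) (k * (1 + 2) + 2)
      (fun τ => τ.reg x = b ^ k) := by
    refine HT.for (fun j τ => τ.reg x = b ^ j) hk' (by simpa [Prog.WR] using hxi.symm) ?_ ?_ ?_ ?_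
    · exact fun j τ hf _ => hk τ (hF τ hf)
    · simp [State.setReg_reg, hxi]
    · intro j τ hj hf _ hI
      have hv : (Exp.reg x * u).val τ = b ^ (j + 1) := by
        rw [Exp.val_mul, Exp.val_reg, hb τ (hF τ hf), hI, pow_succ]
      refine HT.assign ?_ ?_
      · rw [hv]
        rcases Nat.eq_zero_or_pos b with rfl | hb0
        · simp
        · exact (Nat.pow_le_pow_right hb0 (by omega)).trans hbk
      · simp [State.setReg_reg, hxi, hv]
    · exact fun τ _ _ h => h
  exact (HT.assign_seq (by simpa [Exp.val_one] using hV) key).mono (by omega) (fun _ _ h => h)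

end MME

namespace MME

/-! ### Modular inverses -/

/-- The extended Euclidean algorithm for the registers `a` and `n`, carried out modulo register `n`:
register `25` receives the greatest common divisor, and register `27` a multiplier of `a` that
yields it modulo `n`. -/
def invProg (a n : ℕ) : Prog :=
  25 ≔ ρ n ;; 26 ≔ ρ a % ρ n ;; 27 ≔ 0 ;; 28 ≔ 1 ;;
  .loop (ρ 26) (
    29 ≔ ρ 25 / ρ 26 ;; 30 ≔ ρ 25 % ρ 26 ;; 25 ≔ ρ 26 ;; 26 ≔ ρ 30 ;;
    30 ≔ (ρ 27 + (ρ n - ρ 29 % ρ n) * ρ 28) % ρ n ;; 27 ≔ ρ 28 ;; 28 ≔ ρ 30)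

theorem euclid_step_modEq {n a r₀ r₁ s₀ s₁ : ℕ} (hn : 0 < n) (h₀ : s₀ * a ≡ r₀ [MOD n])
    (h₁ : s₁ * a ≡ r₁ [MOD n]) :
    (s₀ + (n - r₀ / r₁ % n) * s₁) % n * a ≡ r₀ % r₁ [MOD n] := by
  have hlt : r₀ / r₁ % n < n := Nat.mod_lt _ hn
  have h2 : (n - r₀ / r₁ % n) + r₀ / r₁ ≡ 0 [MOD n] := by
    have h3 : (n - r₀ / r₁ % n) + r₀ / r₁ % n ≡ (n - r₀ / r₁ % n) + r₀ / r₁ [MOD n] :=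
      (Nat.mod_modEq _ _).add_left _
    rw [Nat.sub_add_cancel hlt.le] at h3
    exact h3.symm.trans (by simp [Nat.ModEq])
  have h4 : (s₀ + (n - r₀ / r₁ % n) * s₁) % n * a + r₀ / r₁ * r₁ ≡
      r₀ % r₁ + r₀ / r₁ * r₁ [MOD n] := by
    calc (s₀ + (n - r₀ / r₁ % n) * s₁) % n * a + r₀ / r₁ * r₁
        ≡ (s₀ + (n - r₀ / r₁ % n) * s₁) * a + r₀ / r₁ * (s₁ * a) [MOD n] :=
          ((Nat.mod_modEq _ _).mul_right _).add (h₁.symm.mul_left _)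
      _ = s₀ * a + ((n - r₀ / r₁ % n) + r₀ / r₁) * (s₁ * a) := by ring
      _ ≡ r₀ + 0 * (s₁ * a) [MOD n] := h₀.add (h2.mul_right _)
      _ = r₀ % r₁ + r₀ / r₁ * r₁ := by
          have := Nat.mod_add_div' r₀ r₁
          omega
  exact h4.add_right_cancel' _

/-- The product of two consecutive remainders at least halves in each round, whence the logarithmic
number of steps. -/
theorem HT.inv {V : ℕ} {σ : State} {ra rn : ℕ} (hra : ra < 25) (hrn : rn < 25) {a n : ℕ}
    (ha : σ.reg ra = a) (hn : σ.reg rn = n) (hn2 : 2 ≤ n) (hV : n ≤ V) :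
    HT V (invProg ra rn) σ (16 * n.size + 5) (fun τ => τ.reg 25 = Nat.gcd a n ∧ τ.reg 27 < n ∧
      (Nat.gcd a n = 1 → τ.reg 27 * a ≡ 1 [MOD n])) := by
  have hn0 : 0 < n := by omega
  have hmod : a % n < n := Nat.mod_lt _ hn0
  unfold invProg
  refine HT.mono (n := 1 + (1 + (1 + (1 + (2 * n.size * (7 + 1) + 1))))) ?_ (by omega)
    (fun _ _ h => h)
  refine HT.assign_seq (by simpa [hn] using hV) ?_
  refine HT.assign_seq (by simp [ha, hn, hra.ne, hrn.ne]; omega) ?_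
  refine HT.assign_seq (by simp) ?_
  refine HT.assign_seq (by simp; omega) ?_
  refine HT.while (fun j τ => τ.reg 25 * τ.reg 26 < 2 ^ j ∧ τ.reg 26 < τ.reg 25 ∧ τ.reg 25 ≤ n ∧
    τ.reg 27 < n ∧ τ.reg 28 < n ∧ τ.reg 27 * a ≡ τ.reg 25 [MOD n] ∧
    τ.reg 28 * a ≡ τ.reg 26 [MOD n] ∧ Nat.gcd (τ.reg 25) (τ.reg 26) = Nat.gcd a n) ?_ ?_ ?_
  · simp only [Exp.val_one, Exp.val_zero, Exp.val_mod, Exp.val_reg, State.setReg_reg,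
      hra.ne, hrn.ne, ha, hn]
    simp only [Nat.reduceEqDiff, if_true, if_false]
    refine ⟨?_, hmod, le_rfl, hn0, by omega, by simp [Nat.ModEq], ?_, ?_⟩
    · have h1 := Nat.lt_size_self n
      calc n * (a % n) < 2 ^ n.size * 2 ^ n.size := Nat.mul_lt_mul'' h1 (hmod.trans h1)
        _ = 2 ^ (2 * n.size) := by rw [← pow_add]; congr 1; ring
    · rw [one_mul]; exact (Nat.mod_modEq _ _).symm
    · rw [Nat.gcd_comm, ← Nat.gcd_rec, Nat.gcd_comm]
  · rintro j τ hf ⟨-, -, -, h27, -, hm, -, hg⟩ hz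
    simp only [Exp.val_reg] at hz
    rw [hz, Nat.gcd_zero_right] at hg
    exact ⟨hg, h27, fun h1 => by rwa [hg, h1] at hm⟩
  · rintro j τ hf ⟨hp, hlt, hle, h27, h28, hm0, hm1, hg⟩ hz
    simp only [Exp.val_reg] at hz
    have hrn' : τ.reg rn = n := by
      rw [hf.reg rn (by simp; omega)]
      simp [hn, hrn.ne, show rn ≠ 26 by omega, show rn ≠ 27 by omega, show rn ≠ 28 by omega]
    generalize e0 : τ.reg 25 = r₀ at *
    generalize e1 : τ.reg 26 = r₁ at *
    generalize e2 : τ.reg 27 = s₀ at *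
    generalize e3 : τ.reg 28 = s₁ at *
    have hr1 : 0 < r₁ := Nat.pos_of_ne_zero hz
    have hmlt : r₀ % r₁ < r₁ := Nat.mod_lt _ hr1
    have hdm := Nat.mod_add_div r₀ r₁
    have hd1 : 1 ≤ r₀ / r₁ := (Nat.one_le_div_iff hr1).2 hlt.le
    have hge : r₁ + r₀ % r₁ ≤ r₀ := by nlinarith
    have hj : j ≠ 0 := by
      rintro rfl
      have : 0 < r₀ * r₁ := Nat.mul_pos (by omega) hr1
      omega
    obtain ⟨j', rfl⟩ := Nat.exists_eq_succ_of_ne_zero hj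
    refine ⟨j', rfl, HT.mono (n := 1 + (1 + (1 + (1 + (1 + (1 + 1)))))) ?_ (by omega)
      (fun _ _ h => h)⟩
    have hdle : r₀ / r₁ ≤ r₀ := Nat.div_le_self _ _
    refine HT.assign_seq (by simp [e0, e1]; omega) ?_
    refine HT.assign_seq (by simp [e0, e1]; omega) ?_
    refine HT.assign_seq (by simp [e1]; omega) ?_
    refine HT.assign_seq (by simp [e0, e1]; omega) ?_
    have hml : (s₀ + (n - r₀ / r₁ % n) * s₁) % n < n := Nat.mod_lt _ hn0
    refine HT.assign_seq ?_ ?_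
    · simp [e0, e1, e2, e3, hrn', hrn.ne, show rn ≠ 26 by omega, show rn ≠ 30 by omega,
        show rn ≠ 29 by omega]
      omega
    refine HT.assign_seq (by simp [e3]; omega) ?_
    refine HT.assign ?_ ?_
    · simp [e0, e1, e2, e3, hrn', hrn.ne, show rn ≠ 26 by omega, show rn ≠ 30 by omega,
        show rn ≠ 29 by omega]
      omega
    · simp [e0, e1, e2, e3, hrn', hrn.ne, show rn ≠ 26 by omega, show rn ≠ 30 by omega,
        show rn ≠ 29 by omega]
      refine ⟨?_, hmlt, by omega, h28, hml, hm1, euclid_step_modEq hn0 hm0 hm1, ?_⟩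
      · rw [Nat.pow_succ] at hp
        nlinarith
      · rw [← hg, Nat.gcd_comm r₀ r₁, Nat.gcd_rec r₁ r₀, Nat.gcd_comm]

end MME

namespace MME

open Finset

/-! ### Taylor expansion modulo prime powers -/

/-- The value at `A` of the polynomial in `m` variables whose coefficient of `∏ xⱼ ^ kⱼ` (each
`kⱼ < d`) is `c (∑ kⱼ dʲ)`. -/
def polyVal (m d : ℕ) (c A : ℕ → ℕ) : ℕ :=
  ∑ k ∈ range (d ^ m), c k * ∏ j ∈ range m, A j ^ (k / d ^ j % d)

theorem polyVal_congr {m d : ℕ} {c c' A A' : ℕ → ℕ} (hc : ∀ k < d ^ m, c k = c' k)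
    (hA : ∀ j < m, A j = A' j) : polyVal m d c A = polyVal m d c' A' := by
  refine sum_congr rfl fun k hk => ?_
  rw [hc k (mem_range.1 hk)]
  congr 1
  exact prod_congr rfl fun j hj => by rw [hA j (mem_range.1 hj)]

/-- A natural number `I`, read as a string of `n` bits from the lowest one, encodes a vector of
exponents: a bit `1` increments the exponent of the current variable, a bit `0` moves on to the next
variable. This is the monomial in `b` so encoded, when the current variable is number `j`. -/
def codeProd (b : ℕ → ℕ) : ℕ → ℕ → ℕ → ℕ
  | 0, _, _ => 1
  | n + 1, j, I => if I % 2 = 1 then b j * codeProd b n j (I / 2) else codeProd b n (j + 1) (I / 2)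

/-- The product of the binomial coefficients `(xᵢ choose eᵢ)` for the exponent vector `e` encoded by
`I`, when the current variable is number `j` and its exponent so far is `s`. -/
def codeChoose (x : ℕ → ℕ) : ℕ → ℕ → ℕ → ℕ → ℕ
  | 0, j, s, _ => (x j).choose s
  | n + 1, j, s, I => if I % 2 = 1 then codeChoose x n j (s + 1) (I / 2)
      else (x j).choose s * codeChoose x n (j + 1) 0 (I / 2)

/-- The value at `b` of the Hasse derivative of the monomial `x`, for the code `I`. -/
def codeHasse (m : ℕ) (x b : ℕ → ℕ) : ℕ → ℕ → ℕ → ℕ → ℕ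
  | 0, j, s, _ => (x j).choose s * b j ^ (x j - s) * ∏ i ∈ Ico (j + 1) m, b i ^ x i
  | n + 1, j, s, I => if I % 2 = 1 then codeHasse m x b n j (s + 1) (I / 2)
      else (x j).choose s * b j ^ (x j - s) * codeHasse m x b n (j + 1) 0 (I / 2)

theorem prod_Ico_eq_mul {m : ℕ} {x : ℕ → ℕ} (hx : ∀ j, m ≤ j → x j = 0) (b : ℕ → ℕ) (j : ℕ) :
    ∏ i ∈ Ico j m, b i ^ x i = b j ^ x j * ∏ i ∈ Ico (j + 1) m, b i ^ x i := by
  by_cases hj : j < m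
  · exact prod_eq_prod_Ico_succ_bot hj _
  · rw [hx j (by omega), Ico_eq_empty_of_le (by omega), Ico_eq_empty_of_le (by omega)]; simp

/-- Hasse derivatives without a shift of exponents: the weighted monomial is divisible by the
encoded monomial, and the quotient is the derivative. -/
theorem codeHasse_eq {m : ℕ} {x : ℕ → ℕ} (hx : ∀ j, m ≤ j → x j = 0) (b : ℕ → ℕ) (n j s I : ℕ) :
    (codeChoose x n j s I = 0 ∧ codeHasse m x b n j s I = 0) ∨
    ∃ v, ∏ i ∈ Ico j m, b i ^ x i = b j ^ s * codeProd b n j I * v ∧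
      codeHasse m x b n j s I = codeChoose x n j s I * v := by
  induction n generalizing j s I with
  | zero =>
    simp only [codeChoose, codeHasse, codeProd]
    by_cases hs : s ≤ x j
    · refine .inr ⟨b j ^ (x j - s) * ∏ i ∈ Ico (j + 1) m, b i ^ x i, ?_, by ring⟩
      rw [prod_Ico_eq_mul hx, mul_one, ← mul_assoc, ← pow_add, Nat.add_sub_cancel' hs]
    · left; simp [Nat.choose_eq_zero_of_lt (not_le.1 hs)]
  | succ n ih =>
    simp only [codeChoose, codeHasse, codeProd]
    split
    · rcases ih j (s + 1) (I / 2) with h | ⟨v, h1, h2⟩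
      · exact .inl h
      · exact .inr ⟨v, by rw [h1]; ring, h2⟩
    · by_cases hs : s ≤ x j
      · rcases ih (j + 1) 0 (I / 2) with ⟨h1, h2⟩ | ⟨v, h1, h2⟩
        · exact .inl (by simp [h1, h2])
        · refine .inr ⟨b j ^ (x j - s) * v, ?_, by rw [h2]; ring⟩
          rw [prod_Ico_eq_mul hx, h1, ← Nat.add_sub_cancel' hs, pow_add, Nat.add_sub_cancel' hs]
          ring
      · left; simp [Nat.choose_eq_zero_of_lt (not_le.1 hs)]

/-- Splitting a sum over codes by the lowest bit. -/
theorem sum_range_two_mul (F : ℕ → ℕ) (K : ℕ) :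
    ∑ I ∈ range (2 * K), F I = ∑ I ∈ range K, F (2 * I) + ∑ I ∈ range K, F (2 * I + 1) := by
  induction K with
  | zero => simp
  | succ K ih =>
    rw [Nat.mul_succ, sum_range_succ, sum_range_succ, ih, sum_range_succ, sum_range_succ]; ring

/-- The Taylor expansion, summed over the codes of length `n`: the vectors that are not encoded have
weight at least `n + s + j + 1 - m`. -/
theorem sum_codeHasse_modEq {m q : ℕ} {x : ℕ → ℕ} (hx : ∀ j, m ≤ j → x j = 0) (b : ℕ → ℕ)
    {h : ℕ → ℕ} (hq : ∀ j, q ∣ h j) (n j s : ℕ) :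
    ∑ I ∈ range (2 ^ n), codeHasse m x b n j s I * (h j ^ s * codeProd h n j I) ≡
      (∑ i ∈ Ico s (x j + 1), (x j).choose i * b j ^ (x j - i) * h j ^ i) *
        ∏ i ∈ Ico (j + 1) m, (b i + h i) ^ x i [MOD q ^ (n + s + j + 1 - m)] := by
  induction n generalizing j s with
  | zero =>
    simp only [codeHasse, codeProd, pow_zero, range_one, sum_singleton, mul_one]
    by_cases hj : j < m
    · have hz : ∀ {a : ℕ}, q ^ s ∣ a → a ≡ 0 [MOD q ^ (0 + s + j + 1 - m)] := fun ha =>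
        (Nat.modEq_zero_iff_dvd).2 ((pow_dvd_pow q (by omega)).trans ha)
      refine (hz ?_).trans (hz ?_).symm
      · exact Dvd.dvd.mul_left (pow_dvd_pow_of_dvd (hq j) s) _
      · refine Dvd.dvd.mul_right (dvd_sum fun i hi => Dvd.dvd.mul_left ?_ _) _
        exact (pow_dvd_pow q (mem_Ico.1 hi).1).trans (pow_dvd_pow_of_dvd (hq j) i)
    · rw [hx j (by omega), Ico_eq_empty_of_le (show m ≤ j + 1 by omega)]
      rcases Nat.eq_zero_or_pos s with rfl | hs
      · simp; rfl
      · rw [Ico_eq_empty_of_le (show 0 + 1 ≤ s by omega), Nat.choose_eq_zero_of_lt hs]; simp; rfl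
  | succ n ih =>
    -- even codes turn to the next variable, odd codes raise the exponent of the current one
    rw [pow_succ', sum_range_two_mul]
    have e1 : ∀ I, (2 * I) % 2 = 1 ↔ False := fun I => by simp
    have e2 : ∀ I, (2 * I + 1) % 2 = 1 ↔ True := fun I => by simp [Nat.add_mod]
    have e3 : ∀ I, (2 * I + 1) / 2 = I := fun I => by omega
    have e4 : ∀ I, (2 * I) / 2 = I := fun I => by omega
    simp only [codeHasse, codeProd, e1, e2, e3, e4, if_true, if_false]
    have i1 := ih j (s + 1)
    have i2 := ih (j + 1) 0
    have t1 : (∑ i ∈ Ico 0 (x (j + 1) + 1), (x (j + 1)).choose i * b (j + 1) ^ (x (j + 1) - i) *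
        h (j + 1) ^ i) * ∏ i ∈ Ico (j + 1 + 1) m, (b i + h i) ^ x i =
        ∏ i ∈ Ico (j + 1) m, (b i + h i) ^ x i := by
      rw [prod_Ico_eq_mul hx (fun i => b i + h i) (j + 1)]
      congr 1
      rw [add_comm (b (j + 1)), add_pow, ← range_eq_Ico]
      exact sum_congr rfl fun i _ => by rw [Nat.cast_id]; ring
    have t2 : ∑ i ∈ Ico s (x j + 1), (x j).choose i * b j ^ (x j - i) * h j ^ i =
        (x j).choose s * b j ^ (x j - s) * h j ^ s +
        ∑ i ∈ Ico (s + 1) (x j + 1), (x j).choose i * b j ^ (x j - i) * h j ^ i := by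
      by_cases hs : s ≤ x j
      · exact sum_eq_sum_Ico_succ_bot (by omega) _
      · rw [Ico_eq_empty_of_le (by omega), Ico_eq_empty_of_le (by omega),
          Nat.choose_eq_zero_of_lt (by omega)]
        simp
    rw [t1] at i2
    rw [t2, add_mul]
    refine Nat.ModEq.add ?_ ?_
    · have i3 : q ^ (n + 1 + s + j + 1 - m) ∣ h j ^ s * q ^ (n + 0 + (j + 1) + 1 - m) := by
        have : q ^ (n + 1 + s + j + 1 - m) ∣ q ^ s * q ^ (n + 0 + (j + 1) + 1 - m) := by
          rw [← pow_add]; exact pow_dvd_pow q (by omega)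
        exact this.trans (mul_dvd_mul_right (pow_dvd_pow_of_dvd (hq j) s) _)
      have i4 := (i2.mul_left' (h j ^ s)).of_dvd i3
      have i5 := i4.mul_left ((x j).choose s * b j ^ (x j - s))
      rw [mul_sum, mul_sum] at i5
      convert i5 using 1
      · refine sum_congr rfl fun I _ => ?_
        rw [pow_zero]; ring
      · ring
    · have : n + (s + 1) + j + 1 - m = n + 1 + s + j + 1 - m := by omega
      rw [this] at i1
      convert i1 using 1
      refine sum_congr rfl fun I _ => ?_
      rw [pow_succ]; ring

theorem digit_eq_zero {m d k j : ℕ} (hd : 0 < d) (hk : k < d ^ m) (hj : m ≤ j) :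
    k / d ^ j % d = 0 := by
  rw [Nat.div_eq_of_lt (hk.trans_le (Nat.pow_le_pow_right hd hj)), Nat.zero_mod]

/-- The weights computed bit by bit: `w` is the weight so far, `rem` holds the digits not yet
treated, and `s` is the exponent of the current variable. -/
def codeWeight (d : ℕ) : ℕ → ℕ → ℕ → ℕ → ℕ → ℕ
  | 0, _, _, _, w => w
  | n + 1, I, rem, s, w => if I % 2 = 1 then codeWeight d n (I / 2) rem (s + 1)
      (w * (rem % d - s) / (s + 1)) else codeWeight d n (I / 2) (rem / d) 0 w

theorem codeWeight_eq (d k c n j s I : ℕ) :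
    codeWeight d n I (k / d ^ j) s (c * (k / d ^ j % d).choose s) =
      c * codeChoose (fun j => k / d ^ j % d) n j s I := by
  induction n generalizing c j s I with
  | zero => rfl
  | succ n ih =>
    simp only [codeWeight, codeChoose]
    split
    · rw [mul_assoc, ← Nat.choose_succ_right_eq, ← mul_assoc, Nat.mul_div_cancel _ (by omega), ih]
    · rw [Nat.div_div_eq_div_mul, ← pow_succ]
      have := ih (c * (k / d ^ j % d).choose s) (j + 1) 0 (I / 2)
      rw [Nat.choose_zero_right, mul_one] at this
      rw [this, mul_assoc]

theorem codeWeight_le (d n I rem s w : ℕ) (hd : 0 < d) : codeWeight d n I rem s w ≤ w * d ^ n := by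
  induction n generalizing I rem s w with
  | zero => simp [codeWeight]
  | succ n ih =>
    simp only [codeWeight]
    split
    · refine (ih _ _ _ _).trans ?_
      rw [pow_succ', ← mul_assoc]
      gcongr
      refine (Nat.div_le_self _ _).trans (Nat.mul_le_mul_left _ ?_)
      exact (Nat.sub_le _ _).trans (Nat.mod_lt _ hd).le
    · refine (ih _ _ _ _).trans ?_
      exact Nat.mul_le_mul_left _ (Nat.pow_le_pow_right hd (by omega))

theorem codeProd_pos {b : ℕ → ℕ} (hb : ∀ j, 0 < b j) (n j I : ℕ) : 0 < codeProd b n j I := by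
  induction n generalizing j I with
  | zero => simp [codeProd]
  | succ n ih => simp only [codeProd]; split <;> simp [ih, hb]

/-- Evaluation at `b + h` modulo `q ^ (m + 2)`, where `q` divides `h`, from exact evaluations at `b`
of polynomials with reweighted coefficients. -/
theorem polyVal_add_modEq {m d q : ℕ} (hd : 0 < d) (c : ℕ → ℕ) {b h : ℕ → ℕ}
    (hb : ∀ j, 0 < b j) (hq : ∀ j, q ∣ h j) :
    polyVal m d c (fun j => b j + h j) ≡ ∑ I ∈ range (2 ^ (2 * m + 1)),
      (polyVal m d (fun k => codeWeight d (2 * m + 1) I k 0 (c k) % q ^ (m + 2)) b /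
        codeProd b (2 * m + 1) 0 I) % q ^ (m + 2) * codeProd h (2 * m + 1) 0 I
        [MOD q ^ (m + 2)] := by
  set Q := q ^ (m + 2) with hQ
  let x : ℕ → ℕ → ℕ := fun k j => k / d ^ j % d
  have hx : ∀ k < d ^ m, ∀ j, m ≤ j → x k j = 0 := fun k hk j hj => digit_eq_zero hd hk hj
  have hw : ∀ k I, codeWeight d (2 * m + 1) I k 0 (c k) = c k * codeChoose (x k) (2 * m + 1) 0 0 I := by
    intro k I
    have := codeWeight_eq d k (c k) (2 * m + 1) 0 0 I
    simpa using this
  have h1 : polyVal m d c (fun j => b j + h j) ≡ ∑ k ∈ range (d ^ m), c k *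
      ∑ I ∈ range (2 ^ (2 * m + 1)), codeHasse m (x k) b (2 * m + 1) 0 0 I *
        codeProd h (2 * m + 1) 0 I [MOD Q] := by
    refine Nat.ModEq.sum fun k hk => Nat.ModEq.mul_left _ ?_
    have hxk := hx k (mem_range.1 hk)
    have := sum_codeHasse_modEq hxk b hq (2 * m + 1) 0 0
    have e : 2 * m + 1 + 0 + 0 + 1 - m = m + 2 := by omega
    rw [e] at this
    simp only [pow_zero, one_mul] at this
    refine Nat.ModEq.trans ?_ this.symm
    rw [range_eq_Ico, prod_Ico_eq_mul hxk (fun j => b j + h j) 0]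
    refine Nat.ModEq.mul_right _ ?_
    rw [add_comm (b 0), add_pow, ← range_eq_Ico]
    rw [sum_congr rfl fun i _ => show (x k 0).choose i * b 0 ^ (x k 0 - i) * h 0 ^ i =
      h 0 ^ i * b 0 ^ (x k 0 - i) * ((x k 0).choose i : ℕ) by ring]
    simp only [Nat.cast_id]; rfl
  refine h1.trans ?_
  simp_rw [mul_sum]
  rw [sum_comm]
  refine Nat.ModEq.sum fun I _ => ?_
  simp_rw [← mul_assoc]
  rw [← sum_mul]
  refine Nat.ModEq.mul_right _ ?_
  refine Nat.ModEq.trans ?_ (Nat.mod_modEq _ _).symm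
  have h2 : ∀ k ∈ range (d ^ m), ∃ u, codeWeight d (2 * m + 1) I k 0 (c k) % Q *
      ∏ j ∈ range m, b j ^ (k / d ^ j % d) = codeProd b (2 * m + 1) 0 I * u ∧
      c k * codeHasse m (x k) b (2 * m + 1) 0 0 I ≡ u [MOD Q] := by
    intro k hk
    rw [hw]
    rcases codeHasse_eq (hx k (mem_range.1 hk)) b (2 * m + 1) 0 0 I with ⟨e1, e2⟩ | ⟨v, e1, e2⟩
    · exact ⟨0, by simp [e1], by rw [e2, mul_zero]⟩
    · refine ⟨c k * codeChoose (x k) (2 * m + 1) 0 0 I % Q * v, ?_, ?_⟩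
      · rw [← range_eq_Ico, pow_zero, one_mul] at e1
        rw [e1]; ring
      · rw [e2, ← mul_assoc]
        exact (Nat.mod_modEq _ _).symm.mul_right _
  -- the division by the encoded monomial is exact, since every summand is divisible by it
  choose! u hu1 hu2 using h2
  have h3 : polyVal m d (fun k => codeWeight d (2 * m + 1) I k 0 (c k) % Q) b =
      codeProd b (2 * m + 1) 0 I * ∑ k ∈ range (d ^ m), u k := by
    rw [polyVal, mul_sum]
    exact sum_congr rfl hu1
  rw [h3, Nat.mul_div_cancel_left _ (codeProd_pos hb _ _ _)]
  exact Nat.ModEq.sum hu2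

/-- The size of the values of a polynomial with coefficients at most `y ^ (m + 2)` at points with
coordinates at most `y`. -/
theorem polyVal_lt {m d y : ℕ} (hd : 2 ≤ d) (hy : 1 ≤ y) {c A : ℕ → ℕ}
    (hc : ∀ k < d ^ m, c k ≤ y ^ (m + 2)) (hA : ∀ j < m, A j ≤ y) :
    polyVal m d c A < (d * y ^ d) ^ (m + 2) := by
  have h1 : polyVal m d c A ≤ ∑ k ∈ range (d ^ m), y ^ (m + 2) * (y ^ (d - 1)) ^ m := by
    refine sum_le_sum fun k hk => Nat.mul_le_mul (hc k (mem_range.1 hk)) ?_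
    refine (prod_le_pow_card (range m) _ (y ^ (d - 1)) fun j hj => ?_).trans (by simp)
    have hm : k / d ^ j % d ≤ d - 1 := by
      have := Nat.mod_lt (k / d ^ j) (show 0 < d by omega)
      omega
    exact (Nat.pow_le_pow_left (hA j (mem_range.1 hj)) _).trans (Nat.pow_le_pow_right hy hm)
  rw [sum_const, card_range, smul_eq_mul] at h1
  refine h1.trans_lt ?_
  obtain ⟨e, rfl⟩ : ∃ e, d = e + 1 := ⟨d - 1, by omega⟩
  have h2 : (y ^ e) ^ m ≤ (y ^ e) ^ (m + 2) :=
    Nat.pow_le_pow_right (Nat.pow_pos hy) (by omega)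
  have h3 : (e + 1) ^ m < (e + 1) ^ (m + 2) := Nat.pow_lt_pow_right (by omega) (by omega)
  have h4 : 0 < y ^ (m + 2) * (y ^ e) ^ (m + 2) := by positivity
  calc (e + 1) ^ m * (y ^ (m + 2) * (y ^ (e + 1 - 1)) ^ m)
      ≤ (e + 1) ^ m * (y ^ (m + 2) * (y ^ e) ^ (m + 2)) := by
        rw [Nat.add_sub_cancel]; gcongr
    _ < (e + 1) ^ (m + 2) * (y ^ (m + 2) * (y ^ e) ^ (m + 2)) := Nat.mul_lt_mul_of_pos_right h3 h4
    _ = ((e + 1) * y ^ (e + 1)) ^ (m + 2) := by rw [mul_pow, pow_succ y e, mul_pow]; ring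

end MME

namespace MME

/-! ### One modulus, one code: weights, points, and the recursive call

A program called as a subroutine has its registers and arrays relocated by `40`, and the programs here
use only those below. -/

/-- Register `16` receives the weight of the coefficient number `ρ 13` for the code `ρ 12`. -/
def weightProg : Prog :=
  14 ≔ ρ 12 ;; 15 ≔ ρ 13 ;; 16 ≔ .read 0 (ρ 13) ;; 17 ≔ 0 ;;
  .for 18 (ρ 6) (
    .cond (ρ 14 % 2)
      (16 ≔ ρ 16 * (ρ 15 % ρ 1 - ρ 17) / (ρ 17 + 1) ;; 17 ≔ ρ 17 + 1)
      (15 ≔ ρ 15 / ρ 1 ;; 17 ≔ 0) ;;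
    14 ≔ ρ 14 / 2)

theorem HT.weight {V : ℕ} {σ : State} {d n I k c : ℕ} (hd : 0 < d) (h1 : σ.reg 1 = d)
    (h6 : σ.reg 6 = n) (h12 : σ.reg 12 = I) (h13 : σ.reg 13 = k) (hc : σ.mem 0 k = c)
    (hn : n ≤ V) (hI : I ≤ V) (hk : k ≤ V) (hcV : c * d ^ n ≤ V) :
    HT V weightProg σ (6 * n + 6) (fun τ => τ.reg 16 = codeWeight d n I k 0 c) := by
  have hdn : ∀ j ≤ n, c * d ^ j ≤ V := fun j hj =>
    (Nat.mul_le_mul_left _ (Nat.pow_le_pow_right hd hj)).trans hcV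
  refine HT.mono (n := 1 + (1 + (1 + (1 + (n * (4 + 2) + 2))))) ?_ (by omega) (fun _ _ h => h)
  refine HT.assign_seq (by simpa [h12] using hI) ?_
  refine HT.assign_seq (by simpa [h13] using hk) ?_
  refine HT.assign_seq (by simpa [h13, hc] using hdn 0 (by omega)) ?_
  refine HT.assign_seq (by simp) ?_
  refine HT.for (fun j τ => codeWeight d (n - j) (τ.reg 14) (τ.reg 15) (τ.reg 17) (τ.reg 16) =
      codeWeight d n I k 0 c ∧ τ.reg 16 ≤ c * d ^ j ∧ τ.reg 17 ≤ j ∧ τ.reg 14 ≤ V ∧ τ.reg 15 ≤ V)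
    hn (by simp) ?_ ?_ ?_ ?_
  · intro j τ hf _
    simp [hf.reg, h6]
  · simp [h12, h13, hc, hI, hk]
  · rintro j τ hj hf - ⟨hw, h16, h17, h14, h15⟩
    have h1' : τ.reg 1 = d := by simp [hf.reg, h1]
    obtain ⟨r, hr⟩ : ∃ r, n - j = r + 1 := ⟨n - j - 1, by omega⟩
    have hr' : n - (j + 1) = r := by omega
    rw [hr, codeWeight] at hw
    refine HT.seq (n := 3) (n' := 1) (R := fun τ' => codeWeight d r (τ.reg 14 / 2) (τ'.reg 15)
      (τ'.reg 17) (τ'.reg 16) = codeWeight d n I k 0 c ∧ τ'.reg 16 ≤ c * d ^ (j + 1) ∧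
      τ'.reg 17 ≤ j + 1 ∧ τ'.reg 15 ≤ V) ?_ ?_
    · refine HT.cond (n := 2) (fun hz => ?_) (fun hz => ?_)
      · have hz' : τ.reg 14 % 2 = 1 := by
          simp only [Exp.val_mod, Exp.val_reg, Exp.val_two] at hz; omega
        rw [if_pos hz'] at hw
        have hle : τ.reg 16 * (τ.reg 15 % d - τ.reg 17) / (τ.reg 17 + 1) ≤ c * d ^ (j + 1) := by
          refine (Nat.div_le_self _ _).trans ?_
          rw [pow_succ, ← mul_assoc]
          exact Nat.mul_le_mul h16 ((Nat.sub_le _ _).trans (Nat.mod_lt _ hd).le)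
        refine HT.assign_seq (n := 1) ?_ (HT.assign ?_ ?_)
        · simpa [h1'] using hle.trans (hdn _ hj)
        · simp; omega
        · simpa [h1', h17, h15, hw] using hle
      · have hz' : ¬ τ.reg 14 % 2 = 1 := by
          simp only [Exp.val_mod, Exp.val_reg, Exp.val_two] at hz; omega
        rw [if_neg hz'] at hw
        refine HT.assign_seq (n := 1) ?_ (HT.assign ?_ ?_)
        · simpa [h1'] using (Nat.div_le_self _ _).trans h15
        · simp
        · have : τ.reg 15 / d ≤ V := (Nat.div_le_self _ _).trans h15
          have h16' : τ.reg 16 ≤ c * d ^ (j + 1) :=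
            h16.trans (Nat.mul_le_mul_left _ (Nat.pow_le_pow_right hd (by omega)))
          simp [h1', hw, this, h16']
    · rintro τ' hf' ⟨hw', h16', h17', h15'⟩
      have h14' : τ'.reg 14 = τ.reg 14 := by simp [hf'.reg]
      have : τ.reg 14 / 2 ≤ V := (Nat.div_le_self _ _).trans h14
      refine HT.assign ?_ ?_
      · simpa [h14'] using this
      · simp [h14', hr', hw', h16', h17', h15', this]
  · rintro τ hf - ⟨hw, -⟩
    simpa [codeWeight] using hw

/-- Registers `23` and `24` receive the monomials encoded by `ρ 12` in the residues modulo `ρ 10` in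
`{1, …, ρ 10}` of the coordinates of the point number `ρ 21`, and in the remaining parts. -/
def codeProg : Prog :=
  14 ≔ ρ 12 ;; 22 ≔ 0 ;; 23 ≔ 1 ;; 24 ≔ 1 ;;
  .for 18 (ρ 6) (
    .cond (ρ 14 % 2)
      (19 ≔ .read 1 (ρ 21 * ρ 0 + ρ 22) * (ρ 22).lt (ρ 0) ;; 31 ≔ (ρ 19 - 1) % ρ 10 + 1 ;;
        23 ≔ ρ 31 * ρ 23 ;; 24 ≔ (ρ 19 - ρ 31) * ρ 24)
      (22 ≔ ρ 22 + 1) ;;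
    14 ≔ ρ 14 / 2)

/-- The coordinates of point number `i`, extended by zero. -/
def pointCoord (m : ℕ) (p : ℕ → ℕ) (i j : ℕ) : ℕ := if j < m then p (i * m + j) else 0

/-- The representative of `a` modulo `q` in `{1, …, q}`. -/
def posRes (q a : ℕ) : ℕ := (a - 1) % q + 1

theorem HT.code {V : ℕ} {σ : State} {m n I i q y Y : ℕ} {p : ℕ → ℕ} (h0 : σ.reg 0 = m)
    (h6 : σ.reg 6 = n) (h10 : σ.reg 10 = q) (h12 : σ.reg 12 = I) (h21 : σ.reg 21 = i)
    (hp : σ.mem 1 = p) (hn0 : 1 ≤ n) (hn : n ≤ V) (hI : I ≤ V) (hy1 : 1 ≤ y) (hY1 : 1 ≤ Y)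
    (hy : y ^ n ≤ V) (hY : Y ^ n ≤ V) (hb : ∀ j, posRes q (pointCoord m p i j) ≤ y)
    (hA : ∀ j, pointCoord m p i j ≤ Y) :
    HT V codeProg σ (8 * n + 6) (fun τ =>
      τ.reg 23 = codeProd (fun j => posRes q (pointCoord m p i j)) n 0 I ∧
      τ.reg 24 = codeProd (fun j => pointCoord m p i j - posRes q (pointCoord m p i j)) n 0 I) := by
  have hyn : ∀ j ≤ n, y ^ j ≤ V := fun j hj => (Nat.pow_le_pow_right hy1 hj).trans hy
  have hYn : ∀ j ≤ n, Y ^ j ≤ V := fun j hj => (Nat.pow_le_pow_right hY1 hj).trans hY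
  set b : ℕ → ℕ := fun j => posRes q (pointCoord m p i j) with hbdef
  set h : ℕ → ℕ := fun j => pointCoord m p i j - posRes q (pointCoord m p i j) with hhdef
  refine HT.mono (n := 1 + (1 + (1 + (1 + (n * (6 + 2) + 2))))) ?_ (by omega) (fun _ _ h => h)
  refine HT.assign_seq (by simpa [h12] using hI) ?_
  refine HT.assign_seq (by simp) ?_
  refine HT.assign_seq (by simp; omega) ?_
  refine HT.assign_seq (by simp; omega) ?_
  refine HT.for (fun j τ => τ.reg 23 * codeProd b (n - j) (τ.reg 22) (τ.reg 14) = codeProd b n 0 I ∧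
      τ.reg 24 * codeProd h (n - j) (τ.reg 22) (τ.reg 14) = codeProd h n 0 I ∧
      τ.reg 23 ≤ y ^ j ∧ τ.reg 24 ≤ Y ^ j ∧ τ.reg 22 ≤ j ∧ τ.reg 14 ≤ V)
    hn (by simp) ?_ ?_ ?_ ?_
  · intro j τ hf _
    simp [hf.reg, h6]
  · simp [h12, hI]
  · rintro j τ hj hf - ⟨hB, hH, h23, h24, h22, h14⟩
    have h0' : τ.reg 0 = m := by simp [hf.reg, h0]
    have h10' : τ.reg 10 = q := by simp [hf.reg, h10]
    have h21' : τ.reg 21 = i := by simp [hf.reg, h21]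
    have hp' : τ.mem 1 = p := by simp [hf.mem, hp]
    obtain ⟨r, hr⟩ : ∃ r, n - j = r + 1 := ⟨n - j - 1, by omega⟩
    have hr' : n - (j + 1) = r := by omega
    rw [hr, codeProd] at hB hH
    refine HT.seq (n := 5) (n' := 1) (R := fun τ' =>
      τ'.reg 23 * codeProd b r (τ'.reg 22) (τ.reg 14 / 2) = codeProd b n 0 I ∧
      τ'.reg 24 * codeProd h r (τ'.reg 22) (τ.reg 14 / 2) = codeProd h n 0 I ∧
      τ'.reg 23 ≤ y ^ (j + 1) ∧ τ'.reg 24 ≤ Y ^ (j + 1) ∧ τ'.reg 22 ≤ j + 1) ?_ ?_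
    · refine HT.cond (n := 4) (fun hz => ?_) (fun hz => ?_)
      · have hz' : τ.reg 14 % 2 = 1 := by
          simp only [Exp.val_mod, Exp.val_reg, Exp.val_two] at hz; omega
        rw [if_pos hz'] at hB hH
        have e1 : p (i * m + τ.reg 22) * (if τ.reg 22 < m then 1 else 0) =
            pointCoord m p i (τ.reg 22) := by
          rw [pointCoord]; split <;> simp
        have hb' := hb (τ.reg 22)
        have hA' := hA (τ.reg 22)
        have h23' : b (τ.reg 22) * τ.reg 23 ≤ y ^ (j + 1) := by
          rw [pow_succ']; exact Nat.mul_le_mul hb' h23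
        have h24' : h (τ.reg 22) * τ.reg 24 ≤ Y ^ (j + 1) := by
          rw [pow_succ']; exact Nat.mul_le_mul ((Nat.sub_le _ _).trans hA') h24
        have a1 : y ≤ V := by simpa using hyn 1 hn0
        have a2 : Y ≤ V := by simpa using hYn 1 hn0
        have eb : (pointCoord m p i (τ.reg 22) - 1) % q + 1 = b (τ.reg 22) := rfl
        have eh : pointCoord m p i (τ.reg 22) - b (τ.reg 22) = h (τ.reg 22) := rfl
        refine HT.mono (n := 1 + (1 + (1 + 1))) ?_ (by omega) (fun _ _ h => h)
        refine HT.assign_seq ?_ (HT.assign_seq ?_ (HT.assign_seq ?_ (HT.assign ?_ ?_)))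
        · simp [h0', h21', hp', e1, hA'.trans a2]
        · simp only [Exp.val_add, Exp.val_mod, Exp.val_sub, Exp.val_mul, Exp.val_read, Exp.val_reg,
            Exp.val_lt, Exp.val_one, State.setReg_reg, h0', h21', hp', e1, h10']
          simpa [eb] using hb'.trans a1
        · simp only [Exp.val_add, Exp.val_mod, Exp.val_sub, Exp.val_mul, Exp.val_read, Exp.val_reg,
            Exp.val_lt, Exp.val_one, State.setReg_reg, h0', h21', hp', e1, h10']
          simpa [eb] using h23'.trans (hyn _ hj)
        · simp only [Exp.val_add, Exp.val_mod, Exp.val_sub, Exp.val_mul, Exp.val_read, Exp.val_reg,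
            Exp.val_lt, Exp.val_one, State.setReg_reg, h0', h21', hp', e1, h10']
          simpa [eb, eh] using h24'.trans (hYn _ hj)
        · simp only [Exp.val_add, Exp.val_mod, Exp.val_sub, Exp.val_mul, Exp.val_read, Exp.val_reg,
            Exp.val_lt, Exp.val_one, State.setReg_reg, h0', h21', hp', e1, h10']
          simp [eb, eh, h23', h24', ← hB, ← hH, mul_left_comm, mul_assoc]
          omega
      · have hz' : ¬ τ.reg 14 % 2 = 1 := by
          simp only [Exp.val_mod, Exp.val_reg, Exp.val_two] at hz; omega
        rw [if_neg hz'] at hB hH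
        refine HT.mono (n := 1) (HT.assign ?_ ?_) (by omega) (fun _ _ h => h)
        · simp; omega
        · simp [hB, hH, h22, h23.trans (Nat.pow_le_pow_right hy1 (Nat.le_succ j)),
            h24.trans (Nat.pow_le_pow_right hY1 (Nat.le_succ j))]
    · rintro τ' hf' ⟨hB', hH', h23', h24', h22'⟩
      have h14' : τ'.reg 14 = τ.reg 14 := by simp [hf'.reg]
      have : τ.reg 14 / 2 ≤ V := (Nat.div_le_self _ _).trans h14
      refine HT.assign ?_ ?_
      · simpa [h14'] using this
      · simp [h14', hr', hB', hH', h23', h24', h22', this]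
  · rintro τ hf - ⟨hB, hH, -⟩
    simp only [Nat.sub_self, codeProd, mul_one] at hB hH
    exact ⟨hB, hH⟩

end MME

namespace MME

open Finset

/-- The program `P` evaluates, within `S` steps and storing numbers `≤ V` only, every polynomial in
`m` variables of degree less than `d` in each variable at `N` points, exactly over the integers, as
long as the coefficients are at most `y ^ (m + 2)` and the coordinates lie in `{1, …, y}`. Registers
`0, …, 3` hold `m, d, N, y`; arrays `0` and `1` hold coefficients and coordinates, array `2` receives
the values. -/
def EvalSpec (V : ℕ) (P : Prog) (m d N y S : ℕ) : Prop :=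
  ∀ σ : State, σ.reg 0 = m → σ.reg 1 = d → σ.reg 2 = N → σ.reg 3 = y →
    (∀ k < d ^ m, σ.mem 0 k ≤ y ^ (m + 2)) → (∀ u < N * m, 1 ≤ σ.mem 1 u ∧ σ.mem 1 u ≤ y) →
    HT V P σ S (fun τ => ∀ i < N,
      τ.mem 2 i = polyVal m d (σ.mem 0) (fun j => σ.mem 1 (i * m + j)))

/-- The contribution of the code `I` to the evaluation at `A` modulo `q ^ (m + 2)`. -/
def taylorTerm (m d q : ℕ) (c A : ℕ → ℕ) (I : ℕ) : ℕ :=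
  (polyVal m d (fun k => codeWeight d (2 * m + 1) I k 0 (c k) % q ^ (m + 2)) (fun j => posRes q (A j)) /
    codeProd (fun j => posRes q (A j)) (2 * m + 1) 0 I) % q ^ (m + 2) *
    codeProd (fun j => A j - posRes q (A j)) (2 * m + 1) 0 I

theorem posRes_pos (q a : ℕ) : 0 < posRes q a := Nat.succ_pos _

theorem posRes_le {q a : ℕ} (ha : 1 ≤ a) : posRes q a ≤ a := by
  have := Nat.mod_le (a - 1) q
  rw [posRes]; omega

theorem posRes_le_modulus {q : ℕ} (hq : 0 < q) (a : ℕ) : posRes q a ≤ q :=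
  Nat.mod_lt _ hq

theorem dvd_sub_posRes (q a : ℕ) : q ∣ a - posRes q a := by
  have : a - posRes q a = (a - 1) - (a - 1) % q := by rw [posRes]; omega
  rw [this]; exact Nat.dvd_sub_mod _

theorem polyVal_modEq_taylor {m d q : ℕ} (hd : 0 < d) (c p : ℕ → ℕ) (i : ℕ)
    (hp : ∀ j < m, 1 ≤ p (i * m + j)) :
    polyVal m d c (fun j => p (i * m + j)) ≡
      ∑ I ∈ range (2 ^ (2 * m + 1)), taylorTerm m d q c (pointCoord m p i) I
      [MOD q ^ (m + 2)] := by
  have := polyVal_add_modEq (m := m) (q := q) hd c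
    (b := fun j => posRes q (pointCoord m p i j))
    (h := fun j => pointCoord m p i j - posRes q (pointCoord m p i j))
    (fun _ => posRes_pos _ _) (fun _ => dvd_sub_posRes _ _)
  refine Nat.ModEq.trans (congrArg (· % q ^ (m + 2)) ?_) this
  refine polyVal_congr (fun _ _ => rfl) fun j hj => ?_
  have h1 := hp j hj
  rw [pointCoord, if_pos hj, Nat.add_sub_cancel' (posRes_le h1)]

/-- The data that stay fixed while one modulus after the other is treated: `p` are the coordinates
and `c` the coefficients. -/
structure BodyCtx (m d N y : ℕ) (c p : ℕ → ℕ) (σ : State) : Prop where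
  r0 : σ.reg 0 = m
  r1 : σ.reg 1 = d
  r2 : σ.reg 2 = N
  r3 : σ.reg 3 = y
  r5 : σ.reg 5 = d ^ m
  r6 : σ.reg 6 = 2 * m + 1
  r7 : σ.reg 7 = 2 ^ (2 * m + 1)
  m0 : σ.mem 0 = c
  m1 : σ.mem 1 = p

theorem BodyCtx.of_frame {m d N y : ℕ} {c p : ℕ → ℕ} {σ τ : State} {P : Prog}
    (h : BodyCtx m d N y c p σ) (hf : Frame P σ τ) (hR : ∀ x < 8, ¬ P.WR x)
    (hM : ∀ A < 2, ¬ P.WM A) : BodyCtx m d N y c p τ where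
  r0 := by rw [hf.reg 0 (hR 0 (by omega)), h.r0]
  r1 := by rw [hf.reg 1 (hR 1 (by omega)), h.r1]
  r2 := by rw [hf.reg 2 (hR 2 (by omega)), h.r2]
  r3 := by rw [hf.reg 3 (hR 3 (by omega)), h.r3]
  r5 := by rw [hf.reg 5 (hR 5 (by omega)), h.r5]
  r6 := by rw [hf.reg 6 (hR 6 (by omega)), h.r6]
  r7 := by rw [hf.reg 7 (hR 7 (by omega)), h.r7]
  m0 := by rw [hf.mem 0 (hM 0 (by omega)), h.m0]
  m1 := by rw [hf.mem 1 (hM 1 (by omega)), h.m1]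

/-- Size conditions for the treatment of the modulus `q`: `y` bounds the residues and `Y` the
coordinates of the points, and `V` all numbers that occur. -/
structure BodyBounds (V m d N y Y q : ℕ) (c p : ℕ → ℕ) : Prop where
  hd : 2 ≤ d
  hq : 2 ≤ q
  hy : 1 ≤ y
  hY : 1 ≤ Y
  hdV : d ≤ V
  hN : N ≤ V
  hNm : N * m ≤ V
  hdm : d ^ m ≤ V
  h2 : 2 ^ (2 * m + 1) ≤ V
  hyV : y ^ (2 * m + 1) ≤ V
  hYV : Y ^ (2 * m + 1) ≤ V
  hp1 : ∀ u < N * m, 1 ≤ p u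
  hpY : ∀ u < N * m, p u ≤ Y
  hpy : ∀ u < N * m, posRes q (p u) ≤ y
  hc : ∀ k < d ^ m, c k * d ^ (2 * m + 1) ≤ V
  hQ : q ^ (m + 2) ≤ V
  hw : ∀ I, ∀ k < d ^ m, codeWeight d (2 * m + 1) I k 0 (c k) % q ^ (m + 2) ≤ y ^ (m + 2)

/-- Treats the code `ρ 12` for the modulus `ρ 10`, where `ρ 11` is its power: the contributions of
the code to the values at all points are added to array `4`. -/
def codeStep (sub : Prog) : Prog :=
  .for 20 (ρ 2 * ρ 0) (.write 41 (ρ 20) ((.read 1 (ρ 20) - 1) % ρ 10 + 1)) ;;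
  .for 13 (ρ 5) (weightProg ;; .write 40 (ρ 13) (ρ 16 % ρ 11)) ;;
  40 ≔ ρ 0 ;; 41 ≔ ρ 1 ;; 42 ≔ ρ 2 ;; 43 ≔ ρ 3 ;; sub.shift 40 ;;
  .for 21 (ρ 2) (codeProg ;;
    .write 4 (ρ 21) ((.read 4 (ρ 21) + .read 42 (ρ 21) / ρ 23 % ρ 11 * ρ 24) % ρ 11))

theorem mul_add_lt_mul {i j m N : ℕ} (hi : i < N) (hj : j < m) : i * m + j < N * m := by
  calc i * m + j < i * m + m := by omega
    _ = (i + 1) * m := by ring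
    _ ≤ N * m := Nat.mul_le_mul_right _ hi

theorem pointCoord_le {m N Y i : ℕ} {p : ℕ → ℕ} (hi : i < N) (hp : ∀ u < N * m, p u ≤ Y) (j : ℕ) :
    pointCoord m p i j ≤ Y := by
  rw [pointCoord]
  split
  · exact hp _ (mul_add_lt_mul hi ‹_›)
  · omega

theorem posRes_pointCoord_le {m N y q i : ℕ} {p : ℕ → ℕ} (hy : 1 ≤ y) (hi : i < N)
    (hp : ∀ u < N * m, posRes q (p u) ≤ y) (j : ℕ) : posRes q (pointCoord m p i j) ≤ y := by
  rw [pointCoord]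
  split
  · exact hp _ (mul_add_lt_mul hi ‹_›)
  · simpa [posRes] using hy

theorem HT.codeStep {V m d N y Y q S I : ℕ} {c p : ℕ → ℕ} {σ : State} {sub : Prog}
    (hB : BodyBounds V m d N y Y q c p) (hsub : EvalSpec V sub m d N y S)
    (hctx : BodyCtx m d N y c p σ) (h10 : σ.reg 10 = q) (h11 : σ.reg 11 = q ^ (m + 2))
    (h12 : σ.reg 12 = I) (hI : I ≤ V) :
    HT V (codeStep sub) σ (S + 20 * (m + 1) * (N + d ^ m + 1)) (fun τ => ∀ i < N,
      τ.mem 4 i = (σ.mem 4 i + taylorTerm m d q c (pointCoord m p i) I) % q ^ (m + 2)) := by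
  obtain ⟨hd, hq, hy, hY, hdV, hN, hNm, hdm, h2, hyV, hYV, hp1, hpY, hpy, hc, hQ, hw⟩ := hB
  have hnV : 2 * m + 1 ≤ V := Nat.lt_two_pow_self.le.trans h2
  have hyV' : y ≤ V := (Nat.le_self_pow (by omega) y).trans hyV
  have hmV : m ≤ V := by omega
  have hQ0 : 0 < q ^ (m + 2) := Nat.pow_pos (by omega)
  refine HT.mono (n := (N * m * (1 + 2) + 2) + ((d ^ m * (6 * (2 * m + 1) + 6 + 1 + 2) + 2) +
    (1 + (1 + (1 + (1 + (S + (N * (8 * (2 * m + 1) + 6 + 1 + 2) + 2))))))))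
    (R := fun τ => ∀ i < N, τ.mem 4 i =
      (σ.mem 4 i + taylorTerm m d q c (pointCoord m p i) I) % q ^ (m + 2))
    ?_ (by ring_nf; omega) (fun _ _ h => h)
  -- residues of the points
  refine HT.seq (R := fun τ => ∀ u < N * m, τ.mem 41 u = posRes q (p u))
    (HT.for (fun j τ => ∀ u < j, τ.mem 41 u = posRes q (p u)) hNm (by simp) ?_ (by simp) ?_
      (fun _ _ _ h => h)) ?_
  · intro j τ hf _; simp [hf.reg, hctx.r0, hctx.r2]
  · intro j τ hj hf hr hI
    have e : posRes q (p j) = (p j - 1) % q + 1 := rfl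
    refine HT.write ?_ ?_
    · simpa [hf.reg, hf.mem, hctx.m1, hr, h10, ← e] using (hpy j hj).trans hyV'
    · intro u hu
      simp only [Exp.val_add, Exp.val_mod, Exp.val_sub, Exp.val_read, Exp.val_reg, Exp.val_one,
        State.setReg_mem, State.setMem_mem, hr, true_and, hf.mem 1 (by simp), hctx.m1,
        hf.reg 10 (by simp), h10]
      split
      · next h => rw [h, e]
      · exact hI u (by omega)
  intro τ₁ hf₁ h41
  have c₁ : BodyCtx m d N y c p τ₁ := hctx.of_frame hf₁ (by simp; omega) (by simp; omega)
  have e10 : τ₁.reg 10 = q := by simp [hf₁.reg, h10]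
  have e11 : τ₁.reg 11 = q ^ (m + 2) := by simp [hf₁.reg, h11]
  have e12 : τ₁.reg 12 = I := by simp [hf₁.reg, h12]
  have e4 : τ₁.mem 4 = σ.mem 4 := by simp [hf₁.mem]
  -- reweighted coefficients
  refine HT.seq (R := fun τ => ∀ k < d ^ m, τ.mem 40 k =
      codeWeight d (2 * m + 1) I k 0 (c k) % q ^ (m + 2))
    (HT.for (fun j τ => ∀ k < j, τ.mem 40 k = codeWeight d (2 * m + 1) I k 0 (c k) % q ^ (m + 2))
      hdm (by simp [weightProg]) ?_ (by simp) ?_ (fun _ _ _ h => h)) ?_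
  · intro j τ hf _; simp [hf.reg, weightProg, c₁.r5]
  · intro k τ hk hf hr hI'
    refine HT.seq (n := 6 * (2 * m + 1) + 6) (n' := 1)
      (HT.weight (d := d) (n := 2 * m + 1) (I := I) (k := k) (c := c k) (by omega)
      ?_ ?_ ?_ hr ?_ hnV hI (by omega) (hc k hk)) ?_
    · simp [hf.reg, weightProg, c₁.r1]
    · simp [hf.reg, weightProg, c₁.r6]
    · simp [hf.reg, weightProg, e12]
    · simp [hf.mem, weightProg, c₁.m0]
    intro τ' hf' h16
    have a11 : τ'.reg 11 = q ^ (m + 2) := by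
      rw [hf'.reg 11 (by simp [weightProg]), hf.reg 11 (by simp [weightProg]), e11]
    have a13 : τ'.reg 13 = k := by rw [hf'.reg 13 (by simp [weightProg]), hr]
    have a40 : τ'.mem 40 = τ.mem 40 := hf'.mem 40 (by simp [weightProg])
    refine HT.write ?_ ?_
    · simpa [h16, a11] using (Nat.mod_lt _ hQ0).le.trans hQ
    · intro u hu
      simp only [Exp.val_mod, Exp.val_reg, State.setReg_mem, State.setMem_mem, a13, true_and, h16,
        a11, a40]
      split
      · next h => rw [h]
      · exact hI' u (by omega)
  intro τ₂ hf₂ h40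
  have c₂ : BodyCtx m d N y c p τ₂ :=
    c₁.of_frame hf₂ (by simp [weightProg]; omega) (by simp [weightProg]; omega)
  have g10 : τ₂.reg 10 = q := by simp [hf₂.reg, weightProg, e10]
  have g11 : τ₂.reg 11 = q ^ (m + 2) := by simp [hf₂.reg, weightProg, e11]
  have g12 : τ₂.reg 12 = I := by simp [hf₂.reg, weightProg, e12]
  have g4 : τ₂.mem 4 = σ.mem 4 := by simp [hf₂.mem, weightProg, e4]
  have g41 : τ₂.mem 41 = τ₁.mem 41 := by simp [hf₂.mem, weightProg]
  refine HT.assign_seq (by simp [c₂.r0, hmV]) ?_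
  refine HT.assign_seq (by simp [c₂.r1, hdV]) ?_
  refine HT.assign_seq (by simp [c₂.r2, hN]) ?_
  refine HT.assign_seq (by simp [c₂.r3, hyV']) ?_
  set τ₃ := (((τ₂.setReg 40 ((ρ 0).val τ₂)).setReg 41 _).setReg 42 _).setReg 43 _ with hτ₃
  have hr₃ : ∀ x < 40, τ₃.reg x = τ₂.reg x := by
    intro x hx
    simp [hτ₃, show x ≠ 40 by omega, show x ≠ 41 by omega, show x ≠ 42 by omega,
      show x ≠ 43 by omega]
  have hm₃ : τ₃.mem = τ₂.mem := rfl
  -- the recursive call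
  refine HT.seq (HT.shift (hsub (τ₃.view 40) ?_ ?_ ?_ ?_ ?_ ?_)) ?_
  · simp [hτ₃, c₂.r0]
  · simp [hτ₃, c₂.r1]
  · simp [hτ₃, c₂.r2]
  · simp [hτ₃, c₂.r3]
  · intro k hk
    simp only [State.view_mem, hm₃, zero_add]
    rw [h40 k hk]; exact hw I k hk
  · intro u hu
    simp only [State.view_mem, hm₃, Nat.reduceAdd]
    rw [g41, h41 u hu]
    exact ⟨posRes_pos _ _, hpy u hu⟩
  intro τ₄ hf₄ hval
  have k0 : τ₄.reg 0 = m := by rw [hf₄.reg 0 (by simp), hr₃ 0 (by omega), c₂.r0]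
  have k2 : τ₄.reg 2 = N := by rw [hf₄.reg 2 (by simp), hr₃ 2 (by omega), c₂.r2]
  have k6 : τ₄.reg 6 = 2 * m + 1 := by rw [hf₄.reg 6 (by simp), hr₃ 6 (by omega), c₂.r6]
  have k10 : τ₄.reg 10 = q := by rw [hf₄.reg 10 (by simp), hr₃ 10 (by omega), g10]
  have k11 : τ₄.reg 11 = q ^ (m + 2) := by rw [hf₄.reg 11 (by simp), hr₃ 11 (by omega), g11]
  have k12 : τ₄.reg 12 = I := by rw [hf₄.reg 12 (by simp), hr₃ 12 (by omega), g12]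
  have k1 : τ₄.mem 1 = p := by rw [hf₄.mem 1 (by simp), hm₃, c₂.m1]
  have k4 : τ₄.mem 4 = σ.mem 4 := by rw [hf₄.mem 4 (by simp), hm₃, g4]
  have k42 : ∀ i < N, τ₄.mem 42 i =
      polyVal m d (fun k => codeWeight d (2 * m + 1) I k 0 (c k) % q ^ (m + 2))
        (fun j => posRes q (pointCoord m p i j)) := by
    intro i hi
    refine (hval i hi).trans (polyVal_congr (fun k hk => ?_) fun j hj => ?_)
    · simp only [State.view_mem, hm₃, zero_add]; exact h40 k hk
    · simp only [State.view_mem, hm₃, Nat.reduceAdd]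
      rw [g41, h41 _ (mul_add_lt_mul hi hj), pointCoord, if_pos hj]
  -- accumulation
  refine HT.for (fun j τ => (∀ i < j, τ.mem 4 i =
      (σ.mem 4 i + taylorTerm m d q c (pointCoord m p i) I) % q ^ (m + 2)) ∧
      ∀ i, j ≤ i → τ.mem 4 i = σ.mem 4 i) hN (by simp [codeProg]) ?_ ?_ ?_
    (fun _ _ _ h => h.1)
  · intro j τ hf _; simp [hf.reg, codeProg, k2]
  · simp [k4]
  · intro i τ hi hf hr hI'
    refine HT.seq (n := 8 * (2 * m + 1) + 6) (n' := 1)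
      (HT.code (m := m) (n := 2 * m + 1) (I := I) (i := i) (q := q) (p := p) (y := y)
      (Y := Y) ?_ ?_ ?_ ?_ hr ?_ (by omega) hnV hI hy hY hyV hYV
      (posRes_pointCoord_le hy hi hpy) (pointCoord_le hi hpY)) ?_
    · simp [hf.reg, codeProg, k0]
    · simp [hf.reg, codeProg, k6]
    · simp [hf.reg, codeProg, k10]
    · simp [hf.reg, codeProg, k12]
    · simp [hf.mem, codeProg, k1]
    rintro τ' hf' ⟨h23, h24⟩
    have a11 : τ'.reg 11 = q ^ (m + 2) := by
      rw [hf'.reg 11 (by simp [codeProg]), hf.reg 11 (by simp [codeProg]), k11]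
    have a21 : τ'.reg 21 = i := by rw [hf'.reg 21 (by simp [codeProg]), hr]
    have a4 : τ'.mem 4 = τ.mem 4 := hf'.mem 4 (by simp [codeProg])
    have a42 : τ'.mem 42 = τ₄.mem 42 := by
      rw [hf'.mem 42 (by simp [codeProg]), hf.mem 42 (by simp [codeProg])]
    have ev : (((Exp.read 4 (ρ 21)) + (Exp.read 42 (ρ 21)) / ρ 23 % ρ 11 * ρ 24) % ρ 11).val τ' =
        (σ.mem 4 i + taylorTerm m d q c (pointCoord m p i) I) % q ^ (m + 2) := by
      simp only [Exp.val_add, Exp.val_mod, Exp.val_mul, Exp.val_div, Exp.val_read, Exp.val_reg,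
        a11, a21, a4, a42, h23, h24, k42 i hi, hI'.2 i le_rfl]
      rfl
    refine HT.write ?_ ?_
    · rw [ev]; exact (Nat.mod_lt _ hQ0).le.trans hQ
    · rw [ev]
      simp only [Exp.val_reg, State.setReg_mem, State.setMem_mem, a21, true_and, a4]
      refine ⟨fun u hu => ?_, fun u hu => ?_⟩
      · split
        · next h => rw [h]
        · exact hI'.1 u (by omega)
      · rw [if_neg (by omega)]; exact hI'.2 u (by omega)

end MME

namespace MME

open Finset

/-! ### Chinese remaindering -/

/-- Treats the modulus number `ρ 9`: array `4` receives the values modulo `ρ 11`, a power of the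
modulus, and they are combined with the values modulo `ρ 8` found so far in array `2`. -/
def modStep (sub : Prog) : Prog :=
  10 ≔ .read 3 (ρ 9) ;; .pow 11 32 (ρ 10) (ρ 0 + 2) ;; .for 21 (ρ 2) (.write 4 (ρ 21) 0) ;;
  .for 12 (ρ 7) (codeStep sub) ;; invProg 8 11 ;;
  .for 21 (ρ 2) (.write 2 (ρ 21) (.read 2 (ρ 21) +
    ρ 8 * ((.read 4 (ρ 21) + ρ 11 - .read 2 (ρ 21) % ρ 11) * ρ 27 % ρ 11))) ;;
  8 ≔ ρ 8 * ρ 11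

/-- The correction `M * x` with `x = (a - o) / M` modulo `Q` turns a solution `o` modulo `M` into one
modulo `M * Q`. -/
theorem crt_step {M Q o a u v : ℕ} (hQ : 0 < Q) (hMQ : Nat.Coprime M Q) (ho : o ≡ v [MOD M])
    (hoM : o < M) (ha : a ≡ v [MOD Q]) (hu : u * M ≡ 1 [MOD Q]) :
    o + M * ((a + Q - o % Q) * u % Q) ≡ v [MOD M * Q] ∧
      o + M * ((a + Q - o % Q) * u % Q) < M * Q := by
  have hlt : o % Q < Q := Nat.mod_lt _ hQ
  have h1 : (a + Q - o % Q) * u % Q < Q := Nat.mod_lt _ hQ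
  refine ⟨(Nat.modEq_and_modEq_iff_modEq_mul hMQ).1 ⟨?_, ?_⟩, ?_⟩
  · calc o + M * ((a + Q - o % Q) * u % Q) ≡ o + 0 [MOD M] :=
        Nat.ModEq.add_left _ ((Nat.modEq_zero_iff_dvd).2 (dvd_mul_right _ _))
      _ ≡ v [MOD M] := ho
  · calc o + M * ((a + Q - o % Q) * u % Q)
        ≡ o % Q + M * ((a + Q - o % Q) * u) [MOD Q] :=
          (Nat.mod_modEq _ _).symm.add ((Nat.mod_modEq _ _).mul_left _)
      _ = o % Q + (a + Q - o % Q) * (u * M) := by ring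
      _ ≡ o % Q + (a + Q - o % Q) * 1 [MOD Q] := (hu.mul_left _).add_left _
      _ = a + Q := by omega
      _ ≡ v [MOD Q] := by simpa [Nat.ModEq] using ha
  · calc o + M * ((a + Q - o % Q) * u % Q) < M + M * ((a + Q - o % Q) * u % Q) := by omega
      _ = M * ((a + Q - o % Q) * u % Q + 1) := by ring
      _ ≤ M * Q := Nat.mul_le_mul_left _ h1

theorem not_WR_codeStep {sub : Prog} {x : ℕ} (h : x < 13) : ¬ (codeStep sub).WR x := by
  have := Prog.not_WR_shift (show x < 40 by omega) sub
  simp [codeStep, weightProg, codeProg, this]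
  omega

theorem not_WM_codeStep {sub : Prog} {x : ℕ} (h : x < 4) : ¬ (codeStep sub).WM x := by
  have := Prog.not_WM_shift (show x < 40 by omega) sub
  simp [codeStep, weightProg, codeProg, this]
  omega

/-- Storing zeros in the first cells of an array. -/
theorem HT.zeros {V A i u N : ℕ} {σ : State} (hN : N ≤ V) (hu : σ.reg u = N) (hui : u ≠ i) :
    HT V (.for i (ρ u) (.write A (ρ i) 0)) σ (N * 3 + 2) (fun τ => ∀ k < N, τ.mem A k = 0) := by
  refine HT.for (s := 1) (fun j τ => ∀ k < j, τ.mem A k = 0) hN (by simp) ?_ (by simp) ?_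
    (fun _ _ _ h => h)
  · intro j τ hf _; rw [Exp.val_reg, hf.reg u (by simpa using hui), hu]
  · intro j τ hj hf hr hI
    refine HT.write (by simp) ?_
    intro k hk
    simp only [Exp.val_reg, Exp.val_zero, State.setReg_mem, State.setMem_mem, hr, true_and]
    split
    · rfl
    · exact hI k (by omega)

theorem HT.modStep {V m d N y Y q S M a : ℕ} {c p : ℕ → ℕ} {v : ℕ → ℕ} {σ : State} {sub : Prog}
    (hB : BodyBounds V m d N y Y q c p) (hsub : EvalSpec V sub m d N y S)
    (hctx : BodyCtx m d N y c p σ) (h8 : σ.reg 8 = M) (h9 : σ.reg 9 = a) (h3 : σ.mem 3 a = q)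
    (hMQ : Nat.Coprime M (q ^ (m + 2))) (hV : M * q ^ (m + 2) ≤ V)
    (hv : ∀ i, v i = polyVal m d c (fun j => p (i * m + j)))
    (ho : ∀ i < N, σ.mem 2 i ≡ v i [MOD M] ∧ σ.mem 2 i < M) :
    HT V (modStep sub) σ (2 ^ (2 * m + 1) * (S + 40 * (m + 1) * (N + d ^ m + 1) + 16 * V.size))
      (fun τ => τ.reg 8 = M * q ^ (m + 2) ∧ ∀ i < N, τ.mem 2 i ≡ v i [MOD M * q ^ (m + 2)] ∧
        τ.mem 2 i < M * q ^ (m + 2)) := by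
  have hq := hB.hq
  have hQV := hB.hQ
  have h2V := hB.h2
  have hnV : 2 * m + 1 ≤ V := Nat.lt_two_pow_self.le.trans h2V
  set Q := q ^ (m + 2) with hQdef
  have hQ2 : 2 ^ 2 ≤ Q := (Nat.pow_le_pow_left hq 2).trans (Nat.pow_le_pow_right (by omega) (by omega))
  have hqQ : q ≤ Q := Nat.le_self_pow (by omega) q
  have hszQ : Q.size ≤ V.size := Nat.size_le_size hQV
  have hsz1 : 1 ≤ V.size := Nat.size_pos.2 (by omega)
  refine HT.mono (n := 1 + (((m + 2) * 3 + 3) + ((N * 3 + 2) +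
    ((2 ^ (2 * m + 1) * (S + 20 * (m + 1) * (N + d ^ m + 1) + 2) + 2) +
    ((16 * Q.size + 5) + ((N * (1 + 2) + 2) + 1)))))) (R := fun τ => τ.reg 8 = M * Q ∧
      ∀ i < N, τ.mem 2 i ≡ v i [MOD M * Q] ∧ τ.mem 2 i < M * Q) ?_ ?_ (fun _ _ h => h)
  · refine HT.assign_seq (by simp [h9, h3]; omega) ?_
    set σ₁ := σ.setReg 10 ((Exp.read 3 (ρ 9)).val σ) with hσ₁
    have c₁ : BodyCtx m d N y c p σ₁ := by
      constructor <;> simp [hσ₁, hctx.r0, hctx.r1, hctx.r2, hctx.r3, hctx.r5, hctx.r6, hctx.r7,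
        hctx.m0, hctx.m1]
    have a10 : σ₁.reg 10 = q := by simp [hσ₁, h9, h3]
    have a8 : σ₁.reg 8 = M := by simp [hσ₁, h8]
    have a2 : σ₁.mem 2 = σ.mem 2 := rfl
    clear_value σ₁
    refine HT.seq (HT.pow (b := q) (k := m + 2) (by norm_num) ?_ ?_ ?_ ?_ hQV) ?_
    · intro τ hf; simp [hf.reg, Prog.pow, a10]
    · intro τ hf; simp [hf.reg, Prog.pow, c₁.r0]
    · exact (Nat.lt_pow_self (show 1 < q by omega)).le.trans hQV
    · omega
    intro τ₂ hf₂ b11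
    have c₂ : BodyCtx m d N y c p τ₂ :=
      c₁.of_frame hf₂ (by simp [Prog.pow]; omega) (by simp [Prog.pow])
    have b10 : τ₂.reg 10 = q := by simp [hf₂.reg, Prog.pow, a10]
    have b8 : τ₂.reg 8 = M := by simp [hf₂.reg, Prog.pow, a8]
    have b2 : τ₂.mem 2 = σ.mem 2 := by simp [hf₂.mem, Prog.pow, a2]
    refine HT.seq (HT.zeros hB.hN c₂.r2 (by norm_num)) ?_
    intro τ₃ hf₃ d4
    have c₃ : BodyCtx m d N y c p τ₃ := c₂.of_frame hf₃ (by simp; omega) (by simp; omega)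
    have d10 : τ₃.reg 10 = q := by simp [hf₃.reg, b10]
    have d11 : τ₃.reg 11 = Q := by simp [hf₃.reg, b11, hQdef]
    have d8 : τ₃.reg 8 = M := by simp [hf₃.reg, b8]
    have d2 : τ₃.mem 2 = σ.mem 2 := by simp [hf₃.mem, b2]
    refine HT.seq (R := fun τ => ∀ i < N, τ.mem 4 i ≡ v i [MOD Q] ∧ τ.mem 4 i < Q)
      (HT.for (s := S + 20 * (m + 1) * (N + d ^ m + 1)) (fun J τ => ∀ i < N, τ.mem 4 i ≡
          ∑ I ∈ range J, taylorTerm m d q c (pointCoord m p i) I [MOD Q] ∧ τ.mem 4 i < Q)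
        h2V (not_WR_codeStep (by norm_num)) ?_ ?_ ?_ ?_) ?_
    · intro j τ hf _
      rw [Exp.val_reg, hf.reg 7, c₃.r7]
      rw [Prog.WR_for]; push Not; exact ⟨by norm_num, not_WR_codeStep (by norm_num)⟩
    · intro i hi
      simp only [State.setReg_mem, d4 i hi, range_zero, sum_empty]
      exact ⟨rfl, by omega⟩
    · intro J τ hJ hf hr hI
      have hfr : ∀ x < 12, τ.reg x = τ₃.reg x := fun x hx => hf.reg x (by
        rw [Prog.WR_for]; push Not; exact ⟨by omega, not_WR_codeStep (by omega)⟩)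
      have cτ : BodyCtx m d N y c p τ := c₃.of_frame hf
        (fun x hx => by rw [Prog.WR_for]; push Not; exact ⟨by omega, not_WR_codeStep (by omega)⟩)
        (fun A hA => by rw [Prog.WM_for]; exact not_WM_codeStep (by omega))
      refine (HT.codeStep hB hsub cτ (by rw [hfr 10 (by norm_num), d10])
        (by rw [hfr 11 (by norm_num), d11]) hr (by omega)).mono le_rfl ?_
      intro τ' _ hτ' i hi
      rw [State.setReg_mem, hτ' i hi, sum_range_succ]
      exact ⟨(Nat.mod_modEq _ _).trans ((hI i hi).1.add_right _), Nat.mod_lt _ (by omega)⟩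
    · intro τ _ _ hI i hi
      refine ⟨(hI i hi).1.trans ?_, (hI i hi).2⟩
      rw [hv]
      exact (polyVal_modEq_taylor (by have := hB.hd; omega) c p i fun j hj =>
        hB.hp1 _ (mul_add_lt_mul hi hj)).symm
    intro τ₄ hf₄ e4
    have hR₄ : ∀ x < 12, τ₄.reg x = τ₃.reg x := fun x hx => hf₄.reg x (by
      rw [Prog.WR_for]; push Not; exact ⟨by omega, not_WR_codeStep (by omega)⟩)
    have e11 : τ₄.reg 11 = Q := by rw [hR₄ 11 (by norm_num), d11]
    have e8 : τ₄.reg 8 = M := by rw [hR₄ 8 (by norm_num), d8]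
    have er2 : τ₄.reg 2 = N := by rw [hR₄ 2 (by norm_num), c₃.r2]
    have e2 : τ₄.mem 2 = σ.mem 2 := by
      rw [hf₄.mem 2 (by rw [Prog.WM_for]; exact not_WM_codeStep (by norm_num)), d2]
    refine HT.seq (HT.inv (by norm_num) (by norm_num) e8 e11 (by omega) hQV) ?_
    rintro τ₅ hf₅ ⟨-, -, hinv⟩
    have hu := hinv hMQ
    have f11 : τ₅.reg 11 = Q := by simp [hf₅.reg, invProg, e11]
    have f8 : τ₅.reg 8 = M := by simp [hf₅.reg, invProg, e8]
    have fr2 : τ₅.reg 2 = N := by simp [hf₅.reg, invProg, er2]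
    have f2 : τ₅.mem 2 = σ.mem 2 := by simp [hf₅.mem, invProg, e2]
    have f4 : τ₅.mem 4 = τ₄.mem 4 := by simp [hf₅.mem, invProg]
    refine HT.seq (n := N * (1 + 2) + 2) (R := fun τ => ∀ i < N, τ.mem 2 i ≡ v i [MOD M * Q] ∧
        τ.mem 2 i < M * Q)
      (HT.for (s := 1) (fun J τ => (∀ i < J, τ.mem 2 i ≡ v i [MOD M * Q] ∧ τ.mem 2 i < M * Q) ∧
        ∀ i, J ≤ i → τ.mem 2 i = σ.mem 2 i) hB.hN (by simp) ?_ ?_ ?_ (fun _ _ _ h => h.1)) ?_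
    · intro j τ hf _; simp [hf.reg, fr2]
    · simp [f2]
    · intro i τ hi hf hr hI
      have g8 : τ.reg 8 = M := by simp [hf.reg, f8]
      have g11 : τ.reg 11 = Q := by simp [hf.reg, f11]
      have g27 : τ.reg 27 = τ₅.reg 27 := by simp [hf.reg]
      have g4 : τ.mem 4 = τ₄.mem 4 := by simp [hf.mem, f4]
      have g2 : τ.mem 2 i = σ.mem 2 i := hI.2 i le_rfl
      have key := crt_step (Nat.pow_pos (by omega) : 0 < Q) hMQ (ho i hi).1 (ho i hi).2
        (e4 i hi).1 hu
      refine HT.write ?_ ?_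
      · simpa [g8, g11, g27, g4, g2, hr] using key.2.le.trans hV
      · simp only [Exp.val_add, Exp.val_sub, Exp.val_mod, Exp.val_mul, Exp.val_read, Exp.val_reg,
          State.setReg_mem, State.setMem_mem, g8, g11, g27, g4, g2, hr, true_and]
        refine ⟨fun u hu => ?_, fun u hu => ?_⟩
        · split
          · next h => rw [h]; exact key
          · exact hI.1 u (by omega)
        · rw [if_neg (by omega)]; exact hI.2 u (by omega)
    intro τ₆ hf₆ h6
    refine HT.assign ?_ ?_
    · simpa [hf₆.reg, f8, f11] using hV
    · simpa [hf₆.reg, f8, f11] using h6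
  · have h3 : 2 ^ 1 ≤ 2 ^ (2 * m + 1) := Nat.pow_le_pow_right (by norm_num) (by omega)
    have h4 : 1 ≤ N + d ^ m + 1 := by omega
    have h5 : m + N + 1 ≤ (m + 1) * (N + d ^ m + 1) := by
      have := Nat.le_mul_of_pos_right m (show 0 < N + d ^ m + 1 by omega)
      rw [add_mul, one_mul]; omega
    have h6 : 2 * (18 * ((m + 1) * (N + d ^ m + 1)) + 16 * V.size) ≤
      2 ^ (2 * m + 1) * (18 * ((m + 1) * (N + d ^ m + 1)) + 16 * V.size) :=
      Nat.mul_le_mul_right _ (by simpa using h3)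
    have h7 : 2 ^ (2 * m + 1) * 1 ≤ 2 ^ (2 * m + 1) * ((m + 1) * (N + d ^ m + 1)) :=
      Nat.mul_le_mul_left _ (by omega)
    calc _ = 2 ^ (2 * m + 1) * S + 20 * (2 ^ (2 * m + 1) * ((m + 1) * (N + d ^ m + 1))) +
          2 * (2 ^ (2 * m + 1) * 1) + 16 * Q.size + 6 * N + 3 * m + 22 := by ring
      _ ≤ 2 ^ (2 * m + 1) * S + 22 * (2 ^ (2 * m + 1) * ((m + 1) * (N + d ^ m + 1))) +
          2 ^ (2 * m + 1) * (18 * ((m + 1) * (N + d ^ m + 1)) + 16 * V.size) := by omega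
      _ = _ := by ring

/-- Evaluation by Chinese remaindering with the `ρ 4` moduli in array `3`; registers `0, …, 2` and
arrays `0, …, 2` are as for `EvalSpec`, and register `3` bounds the residues. -/
def crtProg (sub : Prog) : Prog :=
  .pow 5 32 (ρ 1) (ρ 0) ;; 6 ≔ 2 * ρ 0 + 1 ;; .pow 7 32 2 (ρ 6) ;; 8 ≔ 1 ;;
  .for 21 (ρ 2) (.write 2 (ρ 21) 0) ;; .for 9 (ρ 4) (modStep sub)

theorem not_WR_modStep {sub : Prog} {x : ℕ} (h : x < 8 ∨ x = 9) : ¬ (modStep sub).WR x := by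
  have := not_WR_codeStep (sub := sub) (show x < 13 by omega)
  simp [modStep, invProg, Prog.pow, this]
  omega

theorem not_WM_modStep {sub : Prog} {x : ℕ} (h : x < 2 ∨ x = 3) : ¬ (modStep sub).WM x := by
  have := not_WM_codeStep (sub := sub) (show x < 4 by omega)
  simp [modStep, invProg, Prog.pow, this]
  omega

/-- If the moduli are pairwise coprime and the product of their powers exceeds the values, the program
finds the exact values with one call of `sub` for each modulus and each code. -/
theorem HT.crtProg {V m d N y Y S t : ℕ} {c p mo : ℕ → ℕ} {σ : State} {sub : Prog}
    (hB : ∀ a < t, BodyBounds V m d N y Y (mo a) c p) (ht : 0 < t)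
    (hsub : EvalSpec V sub m d N y S)
    (h0 : σ.reg 0 = m) (h1 : σ.reg 1 = d) (h2 : σ.reg 2 = N) (h3 : σ.reg 3 = y)
    (h4 : σ.reg 4 = t) (hc : σ.mem 0 = c) (hp : σ.mem 1 = p) (hmo : ∀ a < t, σ.mem 3 a = mo a)
    (hcop : ∀ a < t, Nat.Coprime (∏ a' ∈ range a, mo a') (mo a))
    (htV : t ≤ V) (hV : (∏ a ∈ range t, mo a) ^ (m + 2) ≤ V)
    (hval : ∀ i < N, polyVal m d c (fun j => p (i * m + j)) < (∏ a ∈ range t, mo a) ^ (m + 2)) :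
    HT V (crtProg sub) σ
      ((t + 1) * (2 ^ (2 * m + 1) * (S + 50 * (m + 1) * (N + d ^ m + 1) + 16 * V.size)))
      (fun τ => ∀ i < N, τ.mem 2 i = polyVal m d c (fun j => p (i * m + j))) := by
  have B0 := hB 0 ht
  have h2V := B0.h2
  have hnV : 2 * m + 1 < 2 ^ (2 * m + 1) := Nat.lt_two_pow_self
  set v : ℕ → ℕ := fun i => polyVal m d c (fun j => p (i * m + j)) with hvdef
  have hprod : ∀ a ≤ t, (∏ a' ∈ range a, mo a') ^ (m + 2) ≤ V := by
    intro a ha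
    refine (Nat.pow_le_pow_left ?_ _).trans hV
    refine prod_le_prod_of_subset_of_one_le' (range_mono ha) fun b hb _ => ?_
    have := (hB b (mem_range.1 hb)).hq
    omega
  refine HT.mono (n := (m * 3 + 3) + (1 + (((2 * m + 1) * 3 + 3) + (1 + ((N * 3 + 2) +
    (t * (2 ^ (2 * m + 1) * (S + 40 * (m + 1) * (N + d ^ m + 1) + 16 * V.size) + 2) + 2))))))
    (R := fun τ => ∀ i < N, τ.mem 2 i = v i) ?_ ?_ (fun _ _ h => h)
  · refine HT.seq (HT.pow (b := d) (k := m) (by norm_num) ?_ ?_ (by omega) (by omega) B0.hdm) ?_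
    · intro τ hf; simp [hf.reg, Prog.pow, h1]
    · intro τ hf; simp [hf.reg, Prog.pow, h0]
    intro τ₁ hf₁ a5
    have a0 : τ₁.reg 0 = m := by simp [hf₁.reg, Prog.pow, h0]
    refine HT.assign_seq (by simp [a0]; omega) ?_
    refine HT.seq (HT.pow (b := 2) (k := 2 * m + 1) (by norm_num) ?_ ?_ (by omega) (by omega) h2V) ?_
    · intro τ hf; simp
    · intro τ hf; simp [hf.reg, Prog.pow, a0]
    intro τ₂ hf₂ b7
    refine HT.assign_seq (by simp; omega) ?_
    refine HT.seq (HT.zeros (N := N) B0.hN ?_ (by norm_num)) ?_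
    · simp [hf₂.reg, Prog.pow, hf₁.reg, h2]
    intro τ₃ hf₃ d2
    have c₃ : BodyCtx m d N y c p τ₃ := by
      constructor
      · simp [hf₃.reg, hf₂.reg, Prog.pow, hf₁.reg, h0]
      · simp [hf₃.reg, hf₂.reg, Prog.pow, hf₁.reg, h1]
      · simp [hf₃.reg, hf₂.reg, Prog.pow, hf₁.reg, h2]
      · simp [hf₃.reg, hf₂.reg, Prog.pow, hf₁.reg, h3]
      · simp [hf₃.reg, hf₂.reg, Prog.pow, a5]
      · simp [hf₃.reg, hf₂.reg, Prog.pow, a0]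
      · simp [hf₃.reg, b7]
      · simp [hf₃.mem, hf₂.mem, Prog.pow, hf₁.mem, hc]
      · simp [hf₃.mem, hf₂.mem, Prog.pow, hf₁.mem, hp]
    have d4 : τ₃.reg 4 = t := by simp [hf₃.reg, hf₂.reg, Prog.pow, hf₁.reg, h4]
    have d8 : τ₃.reg 8 = 1 := by simp [hf₃.reg]
    have d3 : τ₃.mem 3 = σ.mem 3 := by simp [hf₃.mem, hf₂.mem, Prog.pow, hf₁.mem]
    have hF : ∀ {τ}, Frame (.for 9 (ρ 4) (MME.modStep sub)) τ₃ τ → BodyCtx m d N y c p τ ∧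
        τ.reg 4 = t ∧ ∀ a < t, τ.mem 3 a = mo a := by
      intro τ hf
      refine ⟨c₃.of_frame hf (fun x hx => ?_) (fun x hx => ?_), ?_, fun a ha => ?_⟩
      · rw [Prog.WR_for]; push Not; exact ⟨by omega, not_WR_modStep (by omega)⟩
      · rw [Prog.WM_for]; exact not_WM_modStep (by omega)
      · rw [hf.reg 4, d4]
        rw [Prog.WR_for]; push Not; exact ⟨by omega, not_WR_modStep (by omega)⟩
      · rw [hf.mem 3, d3, hmo a ha]
        rw [Prog.WM_for]; exact not_WM_modStep (by omega)
    refine HT.for (fun a τ => τ.reg 8 = (∏ a' ∈ range a, mo a') ^ (m + 2) ∧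
      ∀ i < N, τ.mem 2 i ≡ v i [MOD (∏ a' ∈ range a, mo a') ^ (m + 2)] ∧
        τ.mem 2 i < (∏ a' ∈ range a, mo a') ^ (m + 2)) htV (not_WR_modStep (by omega)) ?_ ?_ ?_ ?_
    · intro j τ hf _; simp [(hF hf).2.1]
    · refine ⟨by simp [d8], fun i hi => ?_⟩
      simp [d2 i hi, Nat.modEq_one]
    · rintro a τ ha hf hr ⟨hM, ho⟩
      obtain ⟨cτ, -, m3⟩ := hF hf
      refine (HT.modStep (v := v) (hB a ha) hsub cτ hM hr (m3 a ha)
        ((hcop a ha).pow _ _) ?_ (fun _ => rfl) ho).mono le_rfl ?_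
      · rw [← mul_pow, ← prod_range_succ]; exact hprod _ ha
      · rintro τ' - ⟨h8', ho'⟩
        rw [← mul_pow, ← prod_range_succ] at h8' ho'
        simpa using ⟨h8', ho'⟩
    · rintro τ - - ⟨-, ho⟩ i hi
      exact Nat.ModEq.eq_of_lt_of_lt (ho i hi).1 (ho i hi).2 (hval i hi)
  · have h3 : 2 ^ 1 ≤ 2 ^ (2 * m + 1) := Nat.pow_le_pow_right (by norm_num) (by omega)
    have h5 : m + N + 1 ≤ (m + 1) * (N + d ^ m + 1) := by
      have := Nat.le_mul_of_pos_right m (show 0 < N + d ^ m + 1 by omega)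
      rw [add_mul, one_mul]; omega
    have h6 : 2 * (10 * ((m + 1) * (N + d ^ m + 1))) ≤
      2 ^ (2 * m + 1) * (10 * ((m + 1) * (N + d ^ m + 1))) :=
      Nat.mul_le_mul_right _ (by simpa using h3)
    have h7 : (t + 1) * (20 * (m + N + 1)) ≤
        (t + 1) * (2 ^ (2 * m + 1) * (10 * ((m + 1) * (N + d ^ m + 1)))) :=
      Nat.mul_le_mul_left _ (by omega)
    calc _ = t * (2 ^ (2 * m + 1) * (S + 40 * (m + 1) * (N + d ^ m + 1) + 16 * V.size)) +
          (2 * t + 9 * m + 3 * N + 15) := by ring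
      _ ≤ (t + 1) * (2 ^ (2 * m + 1) * (S + 40 * (m + 1) * (N + d ^ m + 1) + 16 * V.size)) +
          (t + 1) * (20 * (m + N + 1)) := by
        refine Nat.add_le_add (Nat.mul_le_mul_right _ (by omega)) ?_
        nlinarith
      _ ≤ _ := by
        refine (Nat.add_le_add_left h7 _).trans (le_of_eq ?_)
        ring

end MME

namespace MME

open Finset

/-! ### Selecting the moduli -/

/-- Collects in array `3` the numbers `2, 3, 5, …` coprime to all previous ones (these are the
primes) until their product `ρ 8` reaches `ρ 1 * ρ 3 ^ ρ 1`. Register `4` receives their number and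
register `3` the last one. -/
def selectProg : Prog :=
  .pow 33 32 (ρ 3) (ρ 1) ;; 33 ≔ ρ 1 * ρ 33 ;; 8 ≔ 1 ;; 4 ≔ 0 ;; 10 ≔ 2 ;;
  .loop ((ρ 8).lt (ρ 33)) (invProg 8 10 ;;
    .cond ((ρ 25).eq 1) (.write 3 (ρ 4) (ρ 10) ;; 4 ≔ ρ 4 + 1 ;; 8 ≔ ρ 8 * ρ 10 ;; 3 ≔ ρ 10) .skip ;;
    10 ≔ ρ 10 + 1)

theorem primorial_le_of_dvd {q M : ℕ} (hM : 0 < M) (h : ∀ p, p.Prime → p ≤ q → p ∣ M) :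
    primorial q ≤ M := by
  refine Nat.le_of_dvd hM ?_
  refine Finset.prod_primes_dvd M (fun p hp => (mem_filter.1 hp).2.prime) fun p hp => ?_
  simp only [mem_filter, mem_range] at hp
  exact h p hp.2 (by omega)

/-- The invariant of the selection: `X` is the target and `n₀` bounds the moduli. -/
structure SelectInv (X n₀ : ℕ) (τ : State) : Prop where
  coprime : ∀ a < τ.reg 4, Nat.Coprime (∏ a' ∈ range a, τ.mem 3 a') (τ.mem 3 a)
  prod : τ.reg 8 = ∏ a ∈ range (τ.reg 4), τ.mem 3 a
  two_le : ∀ a < τ.reg 4, 2 ≤ τ.mem 3 a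
  le_last : ∀ a < τ.reg 4, τ.mem 3 a ≤ τ.reg 3
  prod_le : τ.reg 8 ≤ X * n₀
  dvd : ∀ p, p.Prime → p < τ.reg 10 → p ∣ τ.reg 8
  two_le_next : 2 ≤ τ.reg 10
  next_le : τ.reg 10 ≤ n₀ + 1
  num_lt : τ.reg 4 + 1 < τ.reg 10
  last : 0 < τ.reg 4 → τ.reg 3 ≤ n₀ ∧ 2 ≤ τ.reg 3 ∧ τ.reg 3 < τ.reg 10

/-- If the primes up to `n₀` have a product that is large enough, the search ends by then. -/
theorem HT.select {V d y n₀ : ℕ} {σ : State} (hd : 1 ≤ d) (hy : 2 ≤ y)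
    (h1 : σ.reg 1 = d) (h3 : σ.reg 3 = y) (hn₀ : d * y ^ d ≤ primorial n₀)
    (hn₂ : 2 ≤ n₀) (hV : d * y ^ d * n₀ ≤ V) :
    HT V selectProg σ (3 * d + 9 + n₀ * (16 * V.size + 12)) (fun τ => SelectInv (d * y ^ d) n₀ τ ∧
      d * y ^ d ≤ τ.reg 8) := by
  set X := d * y ^ d with hX
  have hyd : 2 ≤ y ^ d := hy.trans (Nat.le_self_pow (by omega) y)
  have hX2 : 2 ≤ X := hyd.trans (Nat.le_mul_of_pos_left _ hd)
  have hXV : X ≤ V := (Nat.le_mul_of_pos_right _ (by omega)).trans hV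
  have hnV : n₀ + n₀ ≤ V := le_trans (by nlinarith) hV
  have hdX : d ≤ X := Nat.le_mul_of_pos_right _ (by omega)
  have hydX : y ^ d ≤ X := Nat.le_mul_of_pos_left _ hd
  refine HT.mono (n := (d * 3 + 3) + (1 + (1 + (1 + (1 + (n₀ * ((16 * V.size + 5) +
    ((1 + (1 + (1 + (1 + 1)))) + 1) + 1) + 1))))))
    (R := fun τ => SelectInv X n₀ τ ∧ X ≤ τ.reg 8) ?_ (by ring_nf; omega) (fun _ _ h => h)
  refine HT.seq (HT.pow (b := y) (k := d) (by norm_num) ?_ ?_ (by omega) (by omega) (by omega)) ?_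
  · intro τ hf; simp [hf.reg, Prog.pow, h3]
  · intro τ hf; simp [hf.reg, Prog.pow, h1]
  intro τ₁ hf₁ a33
  have a1 : τ₁.reg 1 = d := by simp [hf₁.reg, Prog.pow, h1]
  refine HT.assign_seq (by simpa [a1, a33] using hXV) ?_
  refine HT.assign_seq (by simp; omega) ?_
  refine HT.assign_seq (by simp) ?_
  refine HT.assign_seq (by simp; omega) ?_
  refine HT.while (fun j τ => j + τ.reg 10 = n₀ + 2 ∧ SelectInv X n₀ τ) ⟨?_, ?_⟩ ?_ ?_
  · simp
  · constructor <;> simp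
    · nlinarith
    · intro p hp hp2; exact absurd hp.two_le (by omega)
    · omega
  · rintro j τ hf ⟨-, hI⟩ hz
    refine ⟨hI, ?_⟩
    have e33 : τ.reg 33 = X := by simp [hf.reg, invProg, a1, a33, hX]
    simpa [e33] using hz
  · rintro j τ hf ⟨hj, hI⟩ hz
    have e33 : τ.reg 33 = X := by simp [hf.reg, invProg, a1, a33, hX]
    have hlt : τ.reg 8 < X := by simpa [e33] using hz
    obtain ⟨i1, i2, i3, i3', i4, i5, i6, i7, i8, i9⟩ := hI
    have hM0 : 0 < τ.reg 8 := by
      rw [i2]; exact prod_pos fun a ha => by have := i3 a (mem_range.1 ha); omega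
    -- the primes below the candidate divide the product, which is still too small
    have hqn : τ.reg 10 ≤ n₀ := by
      by_contra hcon
      have := primorial_le_of_dvd (q := n₀) hM0 fun p hp hp' => i5 p hp (by omega)
      omega
    refine ⟨j - 1, by omega, ?_⟩
    refine HT.seq (n := 16 * V.size + 5) (n' := (1 + (1 + (1 + (1 + 1)))) + 1)
      ((HT.inv (ra := 8) (rn := 10) (by norm_num) (by norm_num) rfl rfl i6
      (by omega)).mono ?_ fun _ _ h => h) ?_
    · have := Nat.size_le_size (show τ.reg 10 ≤ V by omega)
      omega
    rintro τ' hf' ⟨hg, -, -⟩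
    have r : ∀ x < 25, τ'.reg x = τ.reg x := fun x hx => hf'.reg x (by simp [invProg]; omega)
    have m3 : τ'.mem = τ.mem := by
      funext A; exact hf'.mem A (by simp [invProg])
    refine HT.seq (n := 1 + (1 + (1 + (1 + 1)))) (n' := 1) (R := fun τ'' => τ''.reg 10 = τ.reg 10 ∧
      SelectInv X n₀ (τ''.setReg 10 (τ.reg 10 + 1))) ?_ ?_
    · refine HT.cond (n := 1 + (1 + (1 + 1))) (fun hz => ?_) (fun hz => ?_)
      · have hg1 : Nat.gcd (τ.reg 8) (τ.reg 10) = 1 := by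
          by_contra hne; simp [hg, hne] at hz
        have hprod : τ.reg 8 * τ.reg 10 ≤ X * n₀ := Nat.mul_le_mul hlt.le hqn
        refine HT.write_seq (n := 1 + (1 + 1)) ?_ (HT.assign_seq (n := 1 + 1) ?_
          (HT.assign_seq (n := 1) ?_ (HT.assign ?_ ?_)))
        · simp [r]; omega
        · simp [r]; omega
        · simp [r]; omega
        · simp [r]; omega
        have hpr : ∀ a ≤ τ.reg 4, ∏ a' ∈ range a, (if a' = τ.reg 4 then τ.reg 10 else τ.mem 3 a') =
            ∏ a' ∈ range a, τ.mem 3 a' := fun a ha => prod_congr rfl fun a' ha' => by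
          rw [if_neg]; have := mem_range.1 ha'; omega
        refine ⟨by simp [r], ?_⟩
        constructor <;> simp [r, m3]
        · intro a ha
          rw [hpr a (by omega)]
          split
          · next h => rw [h, ← i2]; exact hg1
          · exact i1 a (by omega)
        · rw [prod_range_succ, hpr _ le_rfl, if_pos rfl, ← i2]
        · intro a ha
          split
          · exact i6
          · exact i3 a (by omega)
        · intro a ha
          split
          · exact le_rfl
          · have h1 := i3' a (by omega)
            have h2 := i9 (by omega)
            omega
        · exact hprod
        · intro p hp hpq
          rcases Nat.lt_or_ge p (τ.reg 10) with h | h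
          · exact (i5 p hp h).mul_right _
          · rw [show p = τ.reg 10 by omega]; exact dvd_mul_left _ _
        · omega
        · omega
        · omega
        · exact ⟨hqn, i6⟩
      · have hg1 : Nat.gcd (τ.reg 8) (τ.reg 10) ≠ 1 := by
          intro he; simp [hg, he] at hz
        refine HT.mono (n := 1) (HT.skip ?_) (by omega) (fun _ _ h => h)
        refine ⟨r 10 (by norm_num), ?_⟩
        constructor <;> simp [r, m3]
        · exact i1
        · exact i2
        · exact i3
        · exact i3'
        · exact i4
        · intro p hp hpq
          rcases Nat.lt_or_ge p (τ.reg 10) with h | h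
          · exact i5 p hp h
          · have hpe : p = τ.reg 10 := by omega
            rw [← hpe] at hg1
            by_contra hnd
            exact hg1 (Nat.coprime_comm.1 ((Nat.Prime.coprime_iff_not_dvd hp).2 hnd))
        · omega
        · omega
        · omega
        · intro h; have := i9 h; omega
    · rintro τ'' hf'' ⟨h10, hI''⟩
      refine HT.assign ?_ ?_
      · simp [h10]; omega
      · simp only [Exp.val_add, Exp.val_reg, Exp.val_one, h10]
        refine ⟨?_, hI''⟩
        simp; omega

end MME

namespace MME

open Finset

/-! ### Evaluation on a full grid -/

/-- Evaluates on the whole grid `{1, …, y}^m`, one variable at a time, in array `0`, and looks up the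
values at the given points. Each of the `m` passes removes the lowest digit (an exponent) of the
index and puts a new highest digit (a coordinate minus one) on top. -/
def gridProg : Prog :=
  .pow 5 32 (ρ 1) (ρ 0) ;; 5 ≔ ρ 5 / ρ 1 ;;
  .for 6 (ρ 0) (
    .for 7 (ρ 5) (.for 8 (ρ 3) (
      9 ≔ 0 ;;
      .for 10 (ρ 1) (9 ≔ ρ 9 * (ρ 8 + 1) + .read 0 (ρ 1 * ρ 7 + (ρ 1 - 1 - ρ 10))) ;;
      .write 3 (ρ 7 + ρ 8 * ρ 5) (ρ 9))) ;;
    .for 7 (ρ 5 * ρ 3) (.write 0 (ρ 7) (.read 3 (ρ 7))) ;;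
    5 ≔ ρ 5 * ρ 3 / ρ 1) ;;
  .for 6 (ρ 2) (
    7 ≔ 0 ;;
    .for 8 (ρ 0) (7 ≔ ρ 7 * ρ 3 + (.read 1 (ρ 6 * ρ 0 + (ρ 0 - 1 - ρ 8)) - 1)) ;;
    .write 2 (ρ 6) (.read 0 (ρ 7)))

theorem sum_range_mul_eq (f : ℕ → ℕ) (a b : ℕ) :
    ∑ k ∈ range (a * b), f k = ∑ j ∈ range b, ∑ i ∈ range a, f (i + a * j) := by
  induction b with
  | zero => simp
  | succ b ih =>
    rw [Nat.mul_succ, sum_range_add, ih, sum_range_succ]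
    congr 1
    exact sum_congr rfl fun i _ => by rw [add_comm]

theorem low_digit {d i j a b : ℕ} (hd : 0 < d) (hij : i < j) :
    (a + d ^ j * b) / d ^ i % d = a / d ^ i % d := by
  obtain ⟨t, rfl⟩ : ∃ t, j = i + 1 + t := ⟨j - i - 1, by omega⟩
  have : a + d ^ (i + 1 + t) * b = a + d ^ i * (d * (d ^ t * b)) := by ring
  rw [this, Nat.add_mul_div_left _ _ (Nat.pow_pos hd), Nat.add_mul_mod_self_left]

theorem top_digit {d j a b : ℕ} (ha : a < d ^ j) (hb : b < d) :
    (a + d ^ j * b) / d ^ j % d = b := by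
  rw [Nat.add_mul_div_left _ _ (by omega), Nat.div_eq_of_lt ha, zero_add, Nat.mod_eq_of_lt hb]

theorem polyVal_succ {d : ℕ} (hd : 0 < d) (j : ℕ) (c A : ℕ → ℕ) :
    polyVal (j + 1) d c A =
      ∑ k ∈ range d, polyVal j d (fun i => c (i + d ^ j * k)) A * A j ^ k := by
  rw [polyVal, pow_succ, sum_range_mul_eq]
  refine sum_congr rfl fun k hk => ?_
  rw [polyVal, sum_mul]
  refine sum_congr rfl fun i hi => ?_
  rw [prod_range_succ, top_digit (mem_range.1 hi) (mem_range.1 hk), mul_assoc]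
  congr 2
  exact prod_congr rfl fun l hl => by rw [low_digit hd (mem_range.1 hl)]

theorem polyVal_le {m d y C : ℕ} (hd : 0 < d) (hy : 1 ≤ y) {c A : ℕ → ℕ} (hc : ∀ k < d ^ m, c k ≤ C)
    (hA : ∀ j < m, A j ≤ y) : polyVal m d c A ≤ C * (d * y ^ d) ^ m := by
  have h1 : polyVal m d c A ≤ ∑ k ∈ range (d ^ m), C * (y ^ d) ^ m := by
    refine sum_le_sum fun k hk => Nat.mul_le_mul (hc k (mem_range.1 hk)) ?_
    refine (prod_le_pow_card (range m) _ (y ^ d) fun j hj => ?_).trans (by simp)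
    exact (Nat.pow_le_pow_left (hA j (mem_range.1 hj)) _).trans
      (Nat.pow_le_pow_right hy (Nat.mod_lt _ hd).le)
  rw [sum_const, card_range, smul_eq_mul] at h1
  refine h1.trans (le_of_eq ?_)
  rw [mul_pow]; ring

/-- The entry of the table after `j` passes, where `v` encodes the coordinates of the first `j`
variables and `u` the exponents of the others. -/
def gridVal (d y : ℕ) (c : ℕ → ℕ) (j u v : ℕ) : ℕ :=
  polyVal j d (fun k => c (k + d ^ j * u)) (fun i => v / y ^ i % y + 1)

theorem gridVal_succ {d y : ℕ} (hd : 0 < d) {c : ℕ → ℕ} {j u v v' : ℕ}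
    (hv : v < y ^ j) (hv' : v' < y) :
    gridVal d y c (j + 1) u (v + y ^ j * v') =
      ∑ k ∈ range d, gridVal d y c j (k + d * u) v * (v' + 1) ^ k := by
  rw [gridVal, polyVal_succ hd]
  refine sum_congr rfl fun k _ => ?_
  rw [top_digit hv hv', gridVal]
  congr 1
  refine polyVal_congr (fun i _ => congrArg c (by ring)) fun i hi => ?_
  rw [low_digit (by omega) hi]

theorem add_mul_inj {W w w' v v' : ℕ} (hw : w < W) (hw' : w' < W)
    (h : w + v * W = w' + v' * W) : w = w' ∧ v = v' := by
  have h1 : (w + v * W) % W = (w' + v' * W) % W := by rw [h]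
  rw [Nat.add_mul_mod_self_right, Nat.add_mul_mod_self_right, Nat.mod_eq_of_lt hw,
    Nat.mod_eq_of_lt hw'] at h1
  subst h1
  exact ⟨rfl, Nat.eq_of_mul_eq_mul_right (by omega : 0 < W) (by omega)⟩

theorem sum_mul_pow_le {d y W G w v t s : ℕ} {g : ℕ → ℕ} (hG : ∀ x < d * W, g x ≤ G) (hw : w < W)
    (hv : v < y) (ht : t + s ≤ d) :
    ∑ i ∈ range t, g (d * w + (s + i)) * (v + 1) ^ i ≤ d * G * y ^ d := by
  calc _ ≤ ∑ i ∈ range t, G * y ^ d := by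
        refine sum_le_sum fun i hi => Nat.mul_le_mul (hG _ ?_) ?_
        · have := mem_range.1 hi
          calc d * w + (s + i) < d * w + d := by omega
            _ = d * (w + 1) := by ring
            _ ≤ d * W := Nat.mul_le_mul_left _ hw
        · refine (Nat.pow_le_pow_left (show v + 1 ≤ y by omega) i).trans
            (Nat.pow_le_pow_right (by omega) ?_)
          have := mem_range.1 hi; omega
    _ ≤ d * G * y ^ d := by
        rw [sum_const, card_range, smul_eq_mul, mul_assoc]
        exact Nat.mul_le_mul_right _ (by omega)

/-- One pass: Horner's rule in the lowest digit. -/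
theorem HT.gridPass {V d y W G : ℕ} {g : ℕ → ℕ} {σ : State}
    (h1 : σ.reg 1 = d) (h3 : σ.reg 3 = y) (h5 : σ.reg 5 = W) (hg : σ.mem 0 = g)
    (hG : ∀ x < d * W, g x ≤ G) (hV : d * G * y ^ d ≤ V) (hWV : W ≤ V) (hyV : y ≤ V)
    (hdV : d ≤ V) :
    HT V (.for 7 (ρ 5) (.for 8 (ρ 3) (
      9 ≔ 0 ;;
      .for 10 (ρ 1) (9 ≔ ρ 9 * (ρ 8 + 1) + .read 0 (ρ 1 * ρ 7 + (ρ 1 - 1 - ρ 10))) ;;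
      .write 3 (ρ 7 + ρ 8 * ρ 5) (ρ 9)))) σ (W * (y * (d * 3 + 6) + 4) + 2)
    (fun τ => ∀ w < W, ∀ v < y,
      τ.mem 3 (w + v * W) = ∑ k ∈ range d, g (d * w + k) * (v + 1) ^ k) := by
  set val : ℕ → ℕ → ℕ := fun w v => ∑ k ∈ range d, g (d * w + k) * (v + 1) ^ k with hval
  refine HT.for (s := y * (d * 3 + 6) + 2)
    (fun j τ => ∀ w < j, ∀ v < y, τ.mem 3 (w + v * W) = val w v) hWV (by simp)
    ?_ (by simp) ?_ (fun _ _ _ h => h)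
  · intro j τ hf _; simp [hf.reg, h5]
  intro w τ hw hf hr hI
  have b1 : τ.reg 1 = d := by simp [hf.reg, h1]
  have b3 : τ.reg 3 = y := by simp [hf.reg, h3]
  have b5 : τ.reg 5 = W := by simp [hf.reg, h5]
  have bg : τ.mem 0 = g := by simp [hf.mem, hg]
  refine HT.for (s := d * 3 + 4) (fun j τ => (∀ w' < w, ∀ v < y, τ.mem 3 (w' + v * W) = val w' v) ∧
    ∀ v < j, τ.mem 3 (w + v * W) = val w v) hyV (by simp) ?_ ⟨by simpa using hI, by simp⟩ ?_ ?_
  · intro j τ' hf' _; simp [hf'.reg, b3]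
  · rintro v τ₁ hv hf₁ hr₁ ⟨i1, i2⟩
    have c1 : τ₁.reg 1 = d := by simp [hf₁.reg, b1]
    have c5 : τ₁.reg 5 = W := by simp [hf₁.reg, b5]
    have c7 : τ₁.reg 7 = w := by simp [hf₁.reg, hr]
    have cg : τ₁.mem 0 = g := by simp [hf₁.mem, bg]
    refine HT.mono (n := 1 + ((d * 3 + 2) + 1)) (R := fun τ =>
      (∀ w' < w, ∀ v < y, τ.mem 3 (w' + v * W) = val w' v) ∧
      ∀ v' < v + 1, τ.mem 3 (w + v' * W) = val w v') ?_ (by omega) (fun τ _ h => by simpa using h)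
    refine HT.assign_seq (by simp) ?_
    refine HT.seq (n := d * 3 + 2) (n' := 1) (R := fun τ => τ.reg 9 = val w v)
      (HT.for (s := 1) (fun t τ => τ.reg 9 = ∑ i ∈ range t, g (d * w + (d - t + i)) * (v + 1) ^ i)
        hdV (by simp) ?_ (by simp) ?_ ?_) ?_
    · intro j τ' hf' _; simp [hf'.reg, c1]
    · intro t τ₂ ht hf₂ hr₂ h9
      have d1 : τ₂.reg 1 = d := by simp [hf₂.reg, c1]
      have d7 : τ₂.reg 7 = w := by simp [hf₂.reg, c7]
      have d8 : τ₂.reg 8 = v := by simp [hf₂.reg, hr₁]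
      have dg : τ₂.mem 0 = g := by simp [hf₂.mem, cg]
      have ev : (ρ 9 * (ρ 8 + 1) + Exp.read 0 (ρ 1 * ρ 7 + (ρ 1 - 1 - ρ 10)) : Exp).val τ₂ =
          ∑ i ∈ range (t + 1), g (d * w + (d - (t + 1) + i)) * (v + 1) ^ i := by
        simp only [Exp.val_add, Exp.val_mul, Exp.val_sub, Exp.val_read, Exp.val_reg, Exp.val_one,
          d1, d7, d8, dg, h9, hr₂]
        rw [sum_range_succ', sum_mul]
        congr 1
        · refine sum_congr rfl fun i _ => ?_
          rw [show d - (t + 1) + (i + 1) = d - t + i by omega]; ring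
        · rw [show d - 1 - t = d - (t + 1) + 0 by omega]; simp
      refine HT.assign ?_ (by simpa using ev)
      rw [ev]
      exact (sum_mul_pow_le hG hw hv (by omega)).trans hV
    · intro τ' _ _ h
      rw [h]; simp [hval]
    intro τ₃ hf₃ h9
    have e5 : τ₃.reg 5 = W := by simp [hf₃.reg, c5]
    have e7 : τ₃.reg 7 = w := by simp [hf₃.reg, c7]
    have e8 : τ₃.reg 8 = v := by simp [hf₃.reg, hr₁]
    have e3 : τ₃.mem 3 = τ₁.mem 3 := by simp [hf₃.mem]
    refine HT.write ?_ ?_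
    · rw [Exp.val_reg, h9]
      simpa using (sum_mul_pow_le (t := d) (s := 0) hG hw hv le_rfl).trans hV
    · simp only [Exp.val_add, Exp.val_mul, Exp.val_reg, State.setMem_mem, e5, e7, e8, e3, true_and, h9]
      refine ⟨fun w' hw' v' hv' => ?_, fun v' hv' => ?_⟩
      · rw [if_neg]
        · exact i1 w' hw' v' hv'
        · intro h
          have := (add_mul_inj (hw'.trans hw) hw h).1
          omega
      · split
        · next h => rw [(add_mul_inj hw hw h).2]
        · next h =>
          refine i2 v' (lt_of_le_of_ne (by omega) fun h' => h (by rw [h']))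
  · rintro τ' - - ⟨i1, i2⟩ w' hw' v hv
    simp only [State.setReg_mem]
    rcases Nat.lt_or_ge w' w with h | h
    · exact i1 w' h v hv
    · rw [show w' = w by omega]; exact i2 v hv

theorem gridVal_le {m d y C j u v : ℕ} (hd : 0 < d) (hy : 1 ≤ y) {c : ℕ → ℕ}
    (hc : ∀ k < d ^ m, c k ≤ C) (hj : j ≤ m) (hu : u < d ^ (m - j)) :
    gridVal d y c j u v ≤ C * (d * y ^ d) ^ j := by
  refine polyVal_le hd hy (fun k hk => hc _ ?_) fun i _ => Nat.mod_lt _ hy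
  calc k + d ^ j * u < d ^ j + d ^ j * u := by omega
    _ = d ^ j * (u + 1) := by ring
    _ ≤ d ^ j * d ^ (m - j) := Nat.mul_le_mul_left _ hu
    _ = d ^ m := by rw [← pow_add, Nat.add_sub_cancel' hj]

theorem sum_digits_lt {y m : ℕ} {a : ℕ → ℕ} (ha : ∀ i < m, a i < y) :
    ∑ i ∈ range m, a i * y ^ i < y ^ m := by
  induction m with
  | zero => simp
  | succ m ih =>
    have h1 := ih fun i hi => ha i (by omega)
    have h2 : (a m + 1) * y ^ m ≤ y * y ^ m := Nat.mul_le_mul_right _ (ha m (by omega))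
    rw [sum_range_succ, pow_succ']
    linarith

theorem sum_digits_div_mod {y m j : ℕ} {a : ℕ → ℕ} (ha : ∀ i < m, a i < y) (hj : j < m) :
    (∑ i ∈ range m, a i * y ^ i) / y ^ j % y = a j := by
  induction m with
  | zero => omega
  | succ m ih =>
    have hy : 0 < y := by have := ha j hj; omega
    rw [sum_range_succ, mul_comm (a m)]
    rcases Nat.lt_or_ge j m with h | h
    · rw [low_digit hy h, ih (fun i hi => ha i (by omega)) h]
    · obtain rfl : j = m := by omega
      exact top_digit (sum_digits_lt fun i hi => ha i (by omega)) (ha j (by omega))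

theorem HT.grid {V m d N y D : ℕ} (hd : 2 ≤ d) (hy : 1 ≤ y) (hdD : d ≤ D) (hyD : y ≤ D)
    (hV : D ^ (m + 2) * (d * D ^ d) ^ (m + 2) ≤ V) (hN : N ≤ V) (hmV : m ≤ V) :
    EvalSpec V gridProg m d N y (30 * (m + 1) * (d + 1) * (D ^ m + N)) := by
  intro σ h0 h1 h2 h3 hc hp
  set c := σ.mem 0 with hcdef
  set p := σ.mem 1 with hpdef
  have hD1 : 1 ≤ D := by omega
  have hdD' : 1 ≤ d * D ^ d := Nat.mul_pos (by omega) (Nat.pow_pos hD1)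
  have hVj : ∀ j ≤ m + 2, D ^ (m + 2) * (d * D ^ d) ^ j ≤ V := fun j hj =>
    (Nat.mul_le_mul_left _ (Nat.pow_le_pow_right hdD' hj)).trans hV
  have hV0 : D ^ (m + 2) ≤ V := by
    have := hVj 0 (Nat.zero_le _)
    rwa [pow_zero, mul_one] at this
  have hDV : D ^ m ≤ V := (Nat.pow_le_pow_right hD1 (by omega)).trans hV0
  have hDV' : D ≤ V := (Nat.le_self_pow (Nat.succ_ne_zero (m + 1)) D).trans hV0
  have hmix : ∀ j ≤ m, d ^ (m - j) * y ^ j ≤ D ^ m := fun j hj => by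
    calc d ^ (m - j) * y ^ j ≤ D ^ (m - j) * D ^ j :=
          Nat.mul_le_mul (Nat.pow_le_pow_left hdD _) (Nat.pow_le_pow_left hyD _)
      _ = D ^ m := by rw [← pow_add, Nat.sub_add_cancel hj]
  have hdm : d ^ m ≤ V := (Nat.pow_le_pow_left hdD m).trans hDV
  have hD0 : 0 < D ^ m := Nat.pow_pos hD1
  refine HT.mono (n := (m * 3 + 3) + (1 + ((m * ((D ^ m * (3 * d + 13) + 5) + 2) + 2) +
    (N * ((1 + ((m * 3 + 2) + 1)) + 2) + 2)))) (R := fun τ => ∀ i < N,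
      τ.mem 2 i = polyVal m d c (fun j => p (i * m + j))) ?_ ?_ (fun _ _ h => h)
  · refine HT.seq (HT.pow (b := d) (k := m) (by norm_num) ?_ ?_ hmV (by omega) hdm) ?_
    · intro τ hf; simp [hf.reg, Prog.pow, h1]
    · intro τ hf; simp [hf.reg, Prog.pow, h0]
    intro τ₁ hf₁ a5
    have a1 : τ₁.reg 1 = d := by simp [hf₁.reg, Prog.pow, h1]
    refine HT.assign_seq (by simpa [a5] using (Nat.div_le_self _ _).trans hdm) ?_
    set σ₁ := τ₁.setReg 5 ((ρ 5 / ρ 1 : Exp).val τ₁) with hσ₁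
    have b0 : σ₁.reg 0 = m := by simp [hσ₁, hf₁.reg, Prog.pow, h0]
    have b1 : σ₁.reg 1 = d := by simp [hσ₁, a1]
    have b2 : σ₁.reg 2 = N := by simp [hσ₁, hf₁.reg, Prog.pow, h2]
    have b3 : σ₁.reg 3 = y := by simp [hσ₁, hf₁.reg, Prog.pow, h3]
    have b5 : σ₁.reg 5 = d ^ m / d := by simp [hσ₁, a1, a5]
    have bc : σ₁.mem 0 = c := by simp [hσ₁, hf₁.mem, Prog.pow, hcdef]
    have bp : σ₁.mem 1 = p := by simp [hσ₁, hf₁.mem, Prog.pow, hpdef]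
    clear_value σ₁
    -- the passes
    refine HT.seq (n := m * ((D ^ m * (3 * d + 13) + 5) + 2) + 2)
      (R := fun τ => ∀ v < y ^ m, τ.mem 0 v = gridVal d y c m 0 v)
      (HT.for (s := D ^ m * (3 * d + 13) + 5) (fun j τ => (∀ u < d ^ (m - j), ∀ v < y ^ j,
        τ.mem 0 (u + d ^ (m - j) * v) = gridVal d y c j u v) ∧
        τ.reg 5 = d ^ (m - j) * y ^ j / d) hmV (by simp) ?_ ?_ ?_ ?_) ?_
    · intro j τ hf _; simp [hf.reg, b0]
    · refine ⟨fun u _ v hv => ?_, by simp [b5]⟩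
      obtain rfl : v = 0 := by simpa using hv
      simp [bc, gridVal, polyVal]
    · rintro j τ hj hf hr ⟨hI, h5⟩
      have c1 : τ.reg 1 = d := by simp [hf.reg, b1]
      have c3 : τ.reg 3 = y := by simp [hf.reg, b3]
      obtain ⟨e, he⟩ : ∃ e, m - j = e + 1 := ⟨m - j - 1, by omega⟩
      have he' : m - (j + 1) = e := by omega
      set W := d ^ e * y ^ j with hW
      have hdW : d ^ (m - j) * y ^ j = d * W := by rw [he, hW]; ring
      have c5 : τ.reg 5 = W := by rw [h5, hdW, Nat.mul_div_cancel_left _ (by omega)]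
      have hWy : W * y ≤ D ^ m := by
        have := hmix (j + 1) hj
        rwa [he', pow_succ, ← mul_assoc] at this
      have hWD : W ≤ D ^ m := (Nat.le_mul_of_pos_right _ hy).trans hWy
      refine HT.mono (n := (W * (y * (d * 3 + 6) + 4) + 2) + ((W * y * 3 + 2) + 1))
        (R := fun τ' => (∀ u < d ^ e, ∀ v < y ^ (j + 1),
          τ'.mem 0 (u + d ^ e * v) = gridVal d y c (j + 1) u v) ∧
          τ'.reg 5 = d ^ e * y ^ (j + 1) / d) ?_ ?_ (fun τ' _ h => by simpa [he'] using h)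
      · have hgG : ∀ x < d * W, τ.mem 0 x ≤ D ^ (m + 2) * (d * D ^ d) ^ j := by
          intro x hx
          rw [← hdW, mul_comm] at hx
          have hu := Nat.mod_lt x (Nat.pow_pos (n := m - j) (by omega : 0 < d))
          have hv : x / d ^ (m - j) < y ^ j := Nat.div_lt_of_lt_mul (by rwa [mul_comm])
          have := hI _ hu _ hv
          rw [Nat.mod_add_div] at this
          rw [this]
          refine (gridVal_le (by omega) hy hc hj.le hu).trans ?_
          gcongr
        have hGV : d * (D ^ (m + 2) * (d * D ^ d) ^ j) * y ^ d ≤ V := by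
          calc d * (D ^ (m + 2) * (d * D ^ d) ^ j) * y ^ d
              ≤ d * (D ^ (m + 2) * (d * D ^ d) ^ j) * D ^ d := by gcongr
            _ = D ^ (m + 2) * (d * D ^ d) ^ (j + 1) := by ring
            _ ≤ V := hVj _ (by omega)
        refine HT.seq (HT.gridPass (G := D ^ (m + 2) * (d * D ^ d) ^ j) c1 c3 c5 rfl ?_ ?_
          (hWD.trans hDV) (hyD.trans hDV') (hdD.trans hDV')) ?_
        · exact hgG
        · exact hGV
        intro τ₂ hf₂ h3'
        have d1 : τ₂.reg 1 = d := by simp [hf₂.reg, c1]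
        have d3 : τ₂.reg 3 = y := by simp [hf₂.reg, c3]
        have d5 : τ₂.reg 5 = W := by simp [hf₂.reg, c5]
        have hval : ∀ w < W, ∀ v < y, τ₂.mem 3 (w + v * W) ≤ V := by
          intro w hw v hv
          rw [h3' w hw v hv]
          simpa using (sum_mul_pow_le (t := d) (s := 0) hgG hw hv le_rfl).trans hGV
        refine HT.seq (R := fun τ' => ∀ x < W * y, τ'.mem 0 x = τ₂.mem 3 x)
          (HT.for (s := 1) (fun j τ' => ∀ x < j, τ'.mem 0 x = τ₂.mem 3 x) (hWy.trans hDV) (by simp)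
            ?_ (by simp) ?_ (fun _ _ _ h => h)) ?_
        · intro j τ' hf' _; simp [hf'.reg, d3, d5]
        · intro x τ' hx hf' hr' hI'
          have e3 : τ'.mem 3 = τ₂.mem 3 := by simp [hf'.mem]
          refine HT.write ?_ ?_
          · have hW0 : 0 < W := Nat.pos_of_ne_zero (by rintro h; simp [h] at hx)
            have := hval (x % W) (Nat.mod_lt _ hW0) (x / W) (Nat.div_lt_of_lt_mul hx)
            rw [Nat.mod_add_div'] at this
            simpa [e3, hr'] using this
          · intro x' hx'
            simp only [Exp.val_read, Exp.val_reg, State.setReg_mem, State.setMem_mem, e3, hr',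
              true_and]
            split
            · next h => rw [h]
            · exact hI' x' (by omega)
        intro τ₃ hf₃ hcopy
        have g1 : τ₃.reg 1 = d := by simp [hf₃.reg, d1]
        have g3 : τ₃.reg 3 = y := by simp [hf₃.reg, d3]
        have g5 : τ₃.reg 5 = W := by simp [hf₃.reg, d5]
        refine HT.assign ?_ ?_
        · simpa [g1, g3, g5] using (Nat.div_le_self _ _).trans (hWy.trans hDV)
        · simp only [Exp.val_div, Exp.val_mul, Exp.val_reg, g1, g3, g5, State.setReg_mem,
            State.setReg_reg, if_true]
          refine ⟨fun u hu v hv => ?_, by rw [hW, pow_succ]; ring_nf⟩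
          have hyj : 0 < y ^ j := Nat.pow_pos hy
          have hv1 : v % y ^ j < y ^ j := Nat.mod_lt _ hyj
          have hv2 : v / y ^ j < y := Nat.div_lt_of_lt_mul (by rwa [pow_succ] at hv)
          have hw : u + d ^ e * (v % y ^ j) < W := by
            calc u + d ^ e * (v % y ^ j) < d ^ e + d ^ e * (v % y ^ j) := by omega
              _ = d ^ e * (v % y ^ j + 1) := by ring
              _ ≤ W := Nat.mul_le_mul_left _ hv1
          have e1 : u + d ^ e * v = (u + d ^ e * (v % y ^ j)) + v / y ^ j * W := by
            conv_lhs => rw [← Nat.mod_add_div v (y ^ j)]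
            rw [hW]; ring
          have hx : u + d ^ e * v < W * y := by
            calc u + d ^ e * v < d ^ e + d ^ e * v := by omega
              _ = d ^ e * (v + 1) := by ring
              _ ≤ d ^ e * y ^ (j + 1) := Nat.mul_le_mul_left _ hv
              _ = W * y := by rw [hW, pow_succ, mul_assoc]
          rw [hcopy _ hx, e1, h3' _ hw _ hv2]
          conv_rhs => rw [← Nat.mod_add_div v (y ^ j)]
          rw [gridVal_succ (by omega) hv1 hv2]
          refine sum_congr rfl fun k hk => ?_
          have hk' := mem_range.1 hk
          rw [← hI (k + d * u) ?_ _ hv1]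
          · congr 2; rw [he]; ring
          · rw [he]
            calc k + d * u < d + d * u := by omega
              _ = d * (u + 1) := by ring
              _ ≤ d * d ^ e := Nat.mul_le_mul_left _ hu
              _ = d ^ (e + 1) := by ring
      · have t1 : W * y * (3 * d + 6) ≤ D ^ m * (3 * d + 6) := Nat.mul_le_mul_right _ hWy
        calc _ = W * y * (3 * d + 6) + 4 * W + 3 * (W * y) + 5 := by ring
          _ ≤ D ^ m * (3 * d + 6) + 4 * D ^ m + 3 * D ^ m + 5 := by omega
          _ = _ := by ring
    · rintro τ - - ⟨hI, -⟩ v hv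
      have := hI 0 (by simp) v hv
      simpa using this
    intro τ₂ hf₂ htab
    have c0 : τ₂.reg 0 = m := by simp [hf₂.reg, b0]
    have c2 : τ₂.reg 2 = N := by simp [hf₂.reg, b2]
    have c3 : τ₂.reg 3 = y := by simp [hf₂.reg, b3]
    have cp : τ₂.mem 1 = p := by simp [hf₂.mem, bp]
    -- the look-up
    refine HT.for (fun j τ => ∀ i < j, τ.mem 2 i = polyVal m d c (fun j => p (i * m + j))) hN
      (by simp) ?_ (by simp) ?_ (fun _ _ _ h => h)
    · intro j τ hf _; simp [hf.reg, c2]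
    intro i τ hi hf hr hI
    have d0 : τ.reg 0 = m := by simp [hf.reg, c0]
    have d3 : τ.reg 3 = y := by simp [hf.reg, c3]
    have dp : τ.mem 1 = p := by simp [hf.mem, cp]
    have d0' : τ.mem 0 = τ₂.mem 0 := by simp [hf.mem]
    have hpi : ∀ j < m, p (i * m + j) - 1 < y := fun j hj => by
      have := hp _ (mul_add_lt_mul hi hj); omega
    have hyV : ∀ t ≤ m, y ^ t ≤ V := fun t ht =>
      ((Nat.pow_le_pow_left hyD t).trans (Nat.pow_le_pow_right hD1 ht)).trans hDV
    refine HT.assign_seq (by simp) ?_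
    refine HT.seq (n := m * 3 + 2) (n' := 1)
      (R := fun τ => τ.reg 7 = ∑ l ∈ range m, (p (i * m + l) - 1) * y ^ l)
      (HT.for (s := 1) (fun t τ => τ.reg 7 = ∑ l ∈ range t, (p (i * m + (m - t + l)) - 1) * y ^ l)
        hmV (by simp) ?_ (by simp) ?_ ?_) ?_
    · intro j τ' hf' _; simp [hf'.reg, d0]
    · intro t τ' ht hf' hr' h7
      have e0 : τ'.reg 0 = m := by simp [hf'.reg, d0]
      have e3 : τ'.reg 3 = y := by simp [hf'.reg, d3]
      have e6 : τ'.reg 6 = i := by simp [hf'.reg, hr]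
      have ep : τ'.mem 1 = p := by simp [hf'.mem, dp]
      have ev : (ρ 7 * ρ 3 + (Exp.read 1 (ρ 6 * ρ 0 + (ρ 0 - 1 - ρ 8)) - 1) : Exp).val τ' =
          ∑ l ∈ range (t + 1), (p (i * m + (m - (t + 1) + l)) - 1) * y ^ l := by
        simp only [Exp.val_add, Exp.val_mul, Exp.val_sub, Exp.val_read, Exp.val_reg, Exp.val_one,
          e0, e3, e6, ep, h7, hr']
        rw [sum_range_succ', sum_mul]
        congr 1
        · refine sum_congr rfl fun l _ => ?_
          rw [show m - (t + 1) + (l + 1) = m - t + l by omega]; ring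
        · rw [show m - 1 - t = m - (t + 1) + 0 by omega]; simp
      refine HT.assign ?_ (by simpa using ev)
      rw [ev]
      refine (sum_digits_lt fun l hl => hpi _ (by omega)).le.trans (hyV _ ht)
    · intro τ' _ _ h; simpa using h
    intro τ₃ hf₃ h7
    have g0 : τ₃.mem 0 = τ₂.mem 0 := by simp [hf₃.mem, d0']
    have g2 : τ₃.mem 2 = τ.mem 2 := by simp [hf₃.mem]
    have g6 : τ₃.reg 6 = i := by simp [hf₃.reg, hr]
    have hres : τ₂.mem 0 (∑ l ∈ range m, (p (i * m + l) - 1) * y ^ l) =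
        polyVal m d c (fun j => p (i * m + j)) := by
      rw [htab _ (sum_digits_lt hpi), gridVal]
      refine polyVal_congr (fun k _ => by simp) fun j hj => ?_
      rw [sum_digits_div_mod hpi hj]
      have := (hp _ (mul_add_lt_mul hi hj)).1
      omega
    refine HT.write ?_ ?_
    · simp only [Exp.val_read, Exp.val_reg, h7, g0, hres]
      refine (polyVal_le (by omega) (show 1 ≤ D from hD1) (C := D ^ (m + 2)) (fun k hk => ?_)
        fun j hj => ?_).trans (hVj m (by omega))
      · exact (hc k hk).trans (Nat.pow_le_pow_left hyD _)
      · exact (hp _ (mul_add_lt_mul hi hj)).2.trans hyD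
    · intro i' hi'
      simp only [Exp.val_read, Exp.val_reg, State.setReg_mem, State.setMem_mem, h7, g0, g6, g2,
        true_and, hres]
      split
      · next h => rw [h]
      · exact hI i' (by omega)
  · have a1 := Nat.le_mul_of_pos_right m (show 0 < D ^ m + N by omega)
    have e1 : m * (D ^ m + N) = m * D ^ m + m * N := by ring
    have e2 : 30 * (m + 1) * (d + 1) * (D ^ m + N) = 30 * (m * d * D ^ m) + 30 * (m * D ^ m) +
      30 * (m * d * N) + 30 * (m * N) + 30 * (d * D ^ m) + 30 * (d * N) + 30 * D ^ m + 30 * N := by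
      ring
    have e3 : m * 3 + 3 + (1 + (m * (D ^ m * (3 * d + 13) + 5 + 2) + 2 +
        (N * (1 + (m * 3 + 2 + 1) + 2) + 2))) = 3 * (m * d * D ^ m) + 13 * (m * D ^ m) +
        3 * (m * N) + 6 * N + 10 * m + 8 := by ring
    rw [e2, e3]; omega

end MME

namespace MME

open Finset

/-! ### The recursion -/

/-- Integer evaluation with `ℓ` rounds of remaindering modulo small primes, down to a grid. -/
def levelProg : ℕ → Prog
  | 0 => gridProg
  | ℓ + 1 => selectProg ;; crtProg (levelProg ℓ)

/-- A bound for the number of steps of `levelProg ℓ` when all moduli are at most `Z` and the final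
grid has side `D`. -/
def levelCost (V m d N Z D ℓ : ℕ) : ℕ :=
  (2 * (Z * 2 ^ (2 * m + 1))) ^ ℓ * (30 * (m + 1) * (d + 1) * (D ^ m + N) +
    (50 * (m + 1) * (N + d ^ m + 1) + 32 * V.size + 3 * d + 30))

theorem levelCost_succ {V m d N Z D : ℕ} (hZ : 1 ≤ Z) (ℓ : ℕ) :
    Z * 2 ^ (2 * m + 1) * (levelCost V m d N Z D ℓ +
      (50 * (m + 1) * (N + d ^ m + 1) + 32 * V.size + 3 * d + 30)) ≤
      levelCost V m d N Z D (ℓ + 1) := by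
  set a := Z * 2 ^ (2 * m + 1) with ha
  set b := 50 * (m + 1) * (N + d ^ m + 1) + 32 * V.size + 3 * d + 30 with hb
  have ha1 : 1 ≤ a := Nat.mul_pos hZ (by positivity)
  have h1 : b ≤ levelCost V m d N Z D ℓ := by
    rw [levelCost, ← ha, ← hb]
    exact (Nat.le_add_left _ _).trans (Nat.le_mul_of_pos_left _ (Nat.pow_pos (by omega)))
  calc a * (levelCost V m d N Z D ℓ + b) ≤ a * (2 * levelCost V m d N Z D ℓ) :=
        Nat.mul_le_mul_left _ (by omega)
    _ = levelCost V m d N Z D (ℓ + 1) := by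
        rw [levelCost, levelCost, ← ha, ← hb, pow_succ]; ring

/-- The bounds `ys 0, …, ys ℓ` on the coordinates at the successive levels are such that the primes
up to `ys i` have a product large enough for coordinates up to `ys (i + 1)`. -/
theorem HT.level {V m d N Y Z : ℕ} {ys : ℕ → ℕ} (hd : 2 ≤ d) (hN : N ≤ V) (hNm : N * m ≤ V)
    (hV : (d ^ 2 * Y ^ (d + 2)) ^ (m + 2) ≤ V) (h0 : d ≤ ys 0) (ℓ : ℕ)
    (hys : ∀ i < ℓ, d * ys (i + 1) ^ d ≤ primorial (ys i)) (hysY : ∀ i ≤ ℓ, ys i ≤ Y)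
    (hysZ : ∀ i < ℓ, ys i ≤ Z)
    (hys2 : ∀ i ≤ ℓ, 2 ≤ ys i) :
    ∀ y, 2 ≤ y → y ≤ ys ℓ →
      EvalSpec V (levelProg ℓ) m d N y (levelCost V m d N Z (ys 0) ℓ) := by
  have hY2 : 2 ≤ Y := (hys2 0 (Nat.zero_le _)).trans (hysY 0 (Nat.zero_le _))
  have hdY : d ≤ Y := h0.trans (hysY 0 (Nat.zero_le _))
  have hY1 : 1 ≤ Y := by omega
  -- every monomial in `d` and `Y` of moderate degree is below `V`
  have hmon : ∀ {a b : ℕ}, a ≤ 2 * (m + 2) → b ≤ (d + 2) * (m + 2) → d ^ a * Y ^ b ≤ V := by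
    intro a b ha hb
    refine le_trans ?_ hV
    rw [mul_pow, ← pow_mul, ← pow_mul]
    exact Nat.mul_le_mul (Nat.pow_le_pow_right (by omega) ha) (Nat.pow_le_pow_right hY1 hb)
  have h2V : 2 ^ (2 * m + 1) ≤ V := by
    refine (Nat.pow_le_pow_left hd _).trans ?_
    simpa using hmon (a := 2 * m + 1) (b := 0) (by omega) (by omega)
  have hmV : m ≤ V := by
    have := (Nat.lt_two_pow_self (n := 2 * m + 1)).le.trans h2V
    omega
  have hdd : 4 * (m + 2) ≤ (d + 2) * (m + 2) := Nat.mul_le_mul_right _ (by omega)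
  induction ℓ with
  | zero =>
    intro y hy hyD σ e0 e1 e2 e3 hc hp
    have hG := HT.grid (V := V) (m := m) (N := N) (D := ys 0) hd (show 1 ≤ y by omega) h0 hyD ?_ hN
      hmV
    · refine (hG σ e0 e1 e2 e3 hc hp).mono ?_ (fun _ _ h => h)
      rw [levelCost, pow_zero, one_mul]
      exact Nat.le_add_right _ _
    · have hD := hysY 0 le_rfl
      calc ys 0 ^ (m + 2) * (d * ys 0 ^ d) ^ (m + 2) ≤ Y ^ (m + 2) * (d * Y ^ d) ^ (m + 2) := by
            gcongr
        _ = d ^ (m + 2) * Y ^ ((d + 1) * (m + 2)) := by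
            rw [mul_pow, ← pow_mul, add_mul, one_mul, pow_add]; ring
        _ ≤ V := hmon (by omega) (Nat.mul_le_mul_right _ (by omega))
  | succ ℓ ih =>
    intro y hy hyD σ e0 e1 e2 e3 hc hp
    have ih' := ih (fun i hi => hys i (by omega)) (fun i hi => hysY i (by omega))
      (fun i hi => hysZ i (by omega))
      (fun i hi => hys2 i (by omega))
    have hyY : y ≤ Y := hyD.trans (hysY _ le_rfl)
    set n₀ := ys ℓ with hn₀
    have hn₀Y : n₀ ≤ Y := hysY _ (by omega)
    have hn₀Z : n₀ ≤ Z := hysZ _ (by omega)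
    have hn₀2 : 2 ≤ n₀ := hys2 _ (by omega)
    have hX : d * y ^ d ≤ primorial n₀ :=
      (Nat.mul_le_mul_left _ (Nat.pow_le_pow_left hyD d)).trans (hys ℓ (by omega))
    have hXn : (d * y ^ d * n₀) ^ (m + 2) ≤ V := by
      calc (d * y ^ d * n₀) ^ (m + 2) ≤ (d * Y ^ d * Y) ^ (m + 2) := by gcongr
        _ = d ^ (m + 2) * Y ^ ((d + 1) * (m + 2)) := by
            rw [mul_assoc, ← pow_succ, mul_pow, ← pow_mul]
        _ ≤ V := hmon (by omega) (Nat.mul_le_mul_right _ (by omega))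
    have hXn1 : d * y ^ d * n₀ ≤ V := (Nat.le_self_pow (by omega) _).trans hXn
    refine HT.mono (n := (3 * d + 9 + n₀ * (16 * V.size + 12)) +
      n₀ * (2 ^ (2 * m + 1) * (levelCost V m d N Z (ys 0) ℓ + 50 * (m + 1) * (N + d ^ m + 1) +
        16 * V.size))) (R := fun τ => ∀ i < N,
      τ.mem 2 i = polyVal m d (σ.mem 0) (fun j => σ.mem 1 (i * m + j))) ?_ ?_ (fun _ _ h => h)
    · refine HT.seq (HT.select (by omega) hy e1 e3 hX hn₀2 hXn1) ?_
      rintro τ hf ⟨hI, hX8⟩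
      have hX2 : 2 ≤ d * y ^ d :=
        hd.trans (Nat.le_mul_of_pos_right _ (Nat.pow_pos (by omega)))
      have ht : 0 < τ.reg 4 := by
        rcases Nat.eq_zero_or_pos (τ.reg 4) with h | h
        · have := hI.prod
          rw [h, prod_range_zero] at this
          omega
        · exact h
      obtain ⟨l1, l2, l3⟩ := hI.last ht
      have htn : τ.reg 4 + 1 ≤ n₀ := by have := hI.num_lt; have := hI.next_le; omega
      have f0 : τ.reg 0 = m := by simp [hf.reg, selectProg, Prog.pow, invProg, e0]
      have f1 : τ.reg 1 = d := by simp [hf.reg, selectProg, Prog.pow, invProg, e1]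
      have f2 : τ.reg 2 = N := by simp [hf.reg, selectProg, Prog.pow, invProg, e2]
      have fc : τ.mem 0 = σ.mem 0 := by simp [hf.mem, selectProg, Prog.pow, invProg]
      have fp : τ.mem 1 = σ.mem 1 := by simp [hf.mem, selectProg, Prog.pow, invProg]
      have hprod : (∏ a ∈ range (τ.reg 4), τ.mem 3 a) ^ (m + 2) ≤ V := by
        rw [← hI.prod]
        exact (Nat.pow_le_pow_left hI.prod_le _).trans hXn
      -- all moduli are at most the last one, which bounds the residues in the recursive call
      refine (HT.crtProg (Y := y) (mo := τ.mem 3) ?_ ht (ih' (τ.reg 3) l2 l1) f0 f1 f2 rfl rfl fc fp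
        (fun _ _ => rfl) hI.coprime ?_ hprod ?_).mono (Nat.mul_le_mul_right _ htn |>.trans ?_)
        (fun _ _ h => h)
      · intro a ha
        have hq2 := hI.two_le a ha
        have hq := hI.le_last a ha
        have hqY : τ.mem 3 a ≤ Y := by omega
        have hpow : ∀ {x b : ℕ}, x ≤ Y → b ≤ (d + 2) * (m + 2) → x ^ b ≤ V := by
          intro x b hx hb
          refine (Nat.pow_le_pow_left hx _).trans ?_
          simpa using hmon (a := 0) (by omega) hb
        exact {
          hd := hd, hq := hq2, hy := by omega, hY := by omega
          hdV := by simpa using hmon (a := 1) (b := 0) (by omega) (by omega)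
          hN := hN, hNm := hNm
          hdm := by simpa using hmon (a := m) (b := 0) (by omega) (by omega)
          h2 := h2V
          hyV := hpow (by omega) (by omega)
          hYV := hpow hyY (by omega)
          hp1 := fun u hu => (hp u hu).1
          hpY := fun u hu => (hp u hu).2
          hpy := fun u _ => (posRes_le_modulus (by omega) _).trans hq
          hc := fun k hk => by
            rw [mul_comm]
            refine (Nat.mul_le_mul_left _ ((hc k hk).trans (Nat.pow_le_pow_left hyY _))).trans ?_
            exact hmon (by omega) (by omega)
          hQ := hpow hqY (by omega)
          hw := fun I k _ => (Nat.mod_lt _ (Nat.pow_pos (by omega))).le.trans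
            (Nat.pow_le_pow_left hq _) }
      · have : Y ≤ V := by simpa using hmon (a := 0) (b := 1) (by omega) (by omega)
        omega
      · intro i hi
        rw [← hI.prod]
        refine (polyVal_lt hd (by omega) hc fun j hj => ?_).trans_le (Nat.pow_le_pow_left hX8 _)
        exact (hp _ (mul_add_lt_mul hi hj)).2
      · exact le_of_eq (by ring)
    · refine le_trans ?_ (levelCost_succ (by omega) ℓ)
      have h2 : 1 ≤ 2 ^ (2 * m + 1) := Nat.one_le_two_pow
      have h3 : n₀ * (2 ^ (2 * m + 1) * (levelCost V m d N Z (ys 0) ℓ +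
          50 * (m + 1) * (N + d ^ m + 1) + 16 * V.size)) ≤
          Z * (2 ^ (2 * m + 1) * (levelCost V m d N Z (ys 0) ℓ +
          50 * (m + 1) * (N + d ^ m + 1) + 16 * V.size)) := Nat.mul_le_mul_right _ hn₀Z
      have h4 : 3 * d + 9 + n₀ * (16 * V.size + 12) ≤ Z * (16 * V.size + 3 * d + 30) := by nlinarith
      have h5 : Z * (16 * V.size + 3 * d + 30) ≤ Z * (2 ^ (2 * m + 1) * (16 * V.size + 3 * d + 30)) :=
        Nat.mul_le_mul_left _ (Nat.le_mul_of_pos_left _ h2)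
      calc _ ≤ Z * (2 ^ (2 * m + 1) * (16 * V.size + 3 * d + 30)) +
          Z * (2 ^ (2 * m + 1) * (levelCost V m d N Z (ys 0) ℓ +
          50 * (m + 1) * (N + d ^ m + 1) + 16 * V.size)) := by omega
        _ = _ := by ring

end MME

namespace MME

open Finset

/-! ### From extension rings to integers: choice of the substitution -/

/-- The number of moduli for the passage from the ring to the integers. -/
def ringNum (d e : ℕ) : ℕ := 2 * e * d + 2

/-- A bound for the coefficients of the evaluated polynomials with integer coefficients. -/
def ringBound (m d r e : ℕ) : ℕ := (d * (e + 1) * r) ^ (d * (m + 1))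

/-- The integer substituted for the variable `z`. It is `1` modulo the factorial of the number of
moduli. -/
def ringBase (m d r e : ℕ) : ℕ :=
  1 + (ringNum d e).factorial * (2 * ringNum d e * ringBound m d r e)

/-- The moduli: subtracting multiples of the factorial makes them pairwise coprime, and `z` becomes
a small number modulo each of them. -/
def ringMod (m d r e i : ℕ) : ℕ := ringBase m d r e - i * (ringNum d e).factorial

/-- A bound for the residues of the coordinates, the logarithm of which does not depend on `m`. -/
def ringRes (d r e : ℕ) : ℕ :=
  r * (e + 1) * d * d * (ringNum d e * (ringNum d e).factorial) ^ e

variable {m d r e i : ℕ}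

theorem one_le_ringBound (hd : 2 ≤ d) (hr : 2 ≤ r) : 1 ≤ ringBound m d r e :=
  Nat.pow_pos (by positivity)

theorem ringMod_eq (hd : 2 ≤ d) (hr : 2 ≤ r) (hi : i < ringNum d e) :
    ringMod m d r e i = 1 + (ringNum d e).factorial * (2 * ringNum d e * ringBound m d r e - i) := by
  have := one_le_ringBound (m := m) (e := e) hd hr
  have h : i ≤ 2 * ringNum d e * ringBound m d r e := by nlinarith
  rw [ringMod, ringBase, Nat.mul_sub, mul_comm i, Nat.add_sub_assoc (Nat.mul_le_mul_left _ h)]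

theorem ringBase_eq (hd : 2 ≤ d) (hr : 2 ≤ r) (hi : i < ringNum d e) :
    ringBase m d r e = ringMod m d r e i + i * (ringNum d e).factorial := by
  have := one_le_ringBound (m := m) (e := e) hd hr
  have h : i ≤ 2 * ringNum d e * ringBound m d r e := by nlinarith
  rw [ringMod, Nat.sub_add_cancel]
  rw [ringBase, mul_comm i]
  exact (Nat.mul_le_mul_left _ h).trans (Nat.le_add_left _ _)

/-- The square root of `ringBase` is a lower bound for the moduli, which governs the size of their
product. -/
theorem ringBase_le_sq (hd : 2 ≤ d) (hr : 2 ≤ r) (hi : i < ringNum d e) :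
    ringBase m d r e ≤ ringMod m d r e i ^ 2 := by
  have := one_le_ringBound (m := m) (e := e) hd hr
  have h : 2 * ringNum d e * ringBound m d r e ≤ 2 * (2 * ringNum d e * ringBound m d r e - i) := by
    have : ringNum d e ≤ ringNum d e * ringBound m d r e := Nat.le_mul_of_pos_right _ this
    rw [mul_assoc]; omega
  rw [ringMod_eq hd hr hi, ringBase]
  nlinarith [Nat.mul_le_mul_left (ringNum d e).factorial h]

theorem two_le_ringMod (hd : 2 ≤ d) (hr : 2 ≤ r) (hi : i < ringNum d e) :
    2 ≤ ringMod m d r e i := by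
  have := one_le_ringBound (m := m) (e := e) hd hr
  have h0 := Nat.factorial_pos (ringNum d e)
  have h : i < 2 * ringNum d e * ringBound m d r e := by nlinarith
  rw [ringMod_eq hd hr hi]
  have : 0 < (ringNum d e).factorial * (2 * ringNum d e * ringBound m d r e - i) :=
    Nat.mul_pos h0 (by omega)
  omega

/-- A common divisor of two moduli is coprime to the factorial, as both are `1` modulo it, and divides
their difference, a small multiple of the factorial. -/
theorem ringMod_coprime_aux (hd : 2 ≤ d) (hr : 2 ≤ r) {j : ℕ} (hj : j < i) (hi : i < ringNum d e) :
    Nat.Coprime (ringMod m d r e j) (ringMod m d r e i) := by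
  set W := (ringNum d e).factorial with hW
  have h1 := ringBase_eq (m := m) hd hr hi
  have h2 := ringBase_eq (m := m) (e := e) hd hr (hj.trans hi)
  rw [← hW] at h1 h2
  have h3 := Nat.mul_le_mul_right W hj.le
  set g := Nat.gcd (ringMod m d r e j) (ringMod m d r e i) with hg
  have g1 : g ∣ ringMod m d r e j := Nat.gcd_dvd_left _ _
  have g2 : g ∣ ringMod m d r e i := Nat.gcd_dvd_right _ _
  have g3 : g ∣ (i - j) * W := by
    have : (i - j) * W = ringMod m d r e j - ringMod m d r e i := by
      rw [Nat.sub_mul]; omega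
    rw [this]; exact Nat.dvd_sub g1 g2
  have g4 : Nat.Coprime g W := by
    refine Nat.Coprime.coprime_dvd_left g2 ?_
    rw [ringMod_eq hd hr hi, ← hW, Nat.coprime_add_mul_left_left]
    exact Nat.coprime_one_left W
  have g5 : g ∣ i - j := g4.dvd_of_dvd_mul_right g3
  have g6 : g ∣ W := g5.trans (Nat.dvd_factorial (by omega) (by omega))
  have : g ∣ Nat.gcd g W := Nat.dvd_gcd dvd_rfl g6
  rw [g4] at this
  exact Nat.dvd_one.1 this

theorem ringMod_coprime (hd : 2 ≤ d) (hr : 2 ≤ r) (hi : i < ringNum d e) :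
    Nat.Coprime (∏ j ∈ range i, ringMod m d r e j) (ringMod m d r e i) :=
  Nat.Coprime.prod_left fun _ hj => ringMod_coprime_aux hd hr (mem_range.1 hj) hi

theorem ringBound_lt_ringBase : ringBound m d r e < ringBase m d r e := by
  have h0 := Nat.factorial_pos (ringNum d e)
  have h1 : 1 ≤ ringNum d e := by simp [ringNum]
  have h2 : 1 ≤ (ringNum d e).factorial * (2 * ringNum d e) := Nat.mul_pos h0 (by omega)
  have h3 := Nat.mul_le_mul_right (ringBound m d r e) h2
  rw [ringBase, ← mul_assoc]; omega

theorem le_ringBase (hd : 2 ≤ d) : d * (e + 1) * r < ringBase m d r e :=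
  (Nat.le_self_pow (by positivity) _).trans_lt (ringBound_lt_ringBase (m := m))

theorem ringBase_pow_le_prod (hd : 2 ≤ d) (hr : 2 ≤ r) :
    ringBase m d r e ^ (e * d + 1) ≤ ∏ i ∈ range (ringNum d e), ringMod m d r e i := by
  refine (Nat.pow_le_pow_iff_left (n := 2) two_ne_zero).1 ?_
  rw [← pow_mul, ← prod_pow]
  calc ringBase m d r e ^ ((e * d + 1) * 2) = ∏ i ∈ range (ringNum d e), ringBase m d r e := by
        rw [prod_const, card_range, ringNum]; congr 1; ring
    _ ≤ _ := prod_le_prod' fun i hi => ringBase_le_sq hd hr (mem_range.1 hi)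

theorem prod_ringMod_le :
    ∏ i ∈ range (ringNum d e), ringMod m d r e i ≤ ringBase m d r e ^ ringNum d e := by
  refine (prod_le_pow_card _ _ _ fun i _ => Nat.sub_le _ _).trans (by simp)

/-- The integer representing the element of the ring with digits `a 0, …, a (e - 1)`. Adding `r` to
the constant term makes all residues positive. -/
def ringPoint (e r M : ℕ) (a : ℕ → ℕ) : ℕ := r + ∑ l ∈ range e, a l * M ^ l

/-- Modulo `ringMod m d r e i` the integer `ringBase m d r e` is congruent to `i` times the factorial,
so the residues of the points are small. -/
theorem posRes_ringPoint_le (hd : 2 ≤ d) (hr : 2 ≤ r) {a : ℕ → ℕ} (ha : ∀ l < e, a l < r)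
    (hi : i < ringNum d e) :
    posRes (ringMod m d r e i) (ringPoint e r (ringBase m d r e) a) ≤ ringRes d r e := by
  set W := (ringNum d e).factorial with hW
  set q := ringMod m d r e i with hq
  have hmod : ringPoint e r (ringBase m d r e) a ≡ ringPoint e r (i * W) a [MOD q] := by
    refine Nat.ModEq.add_left _ (Nat.ModEq.sum fun l _ => Nat.ModEq.mul_left _ (Nat.ModEq.pow _ ?_))
    rw [ringBase_eq (m := m) hd hr hi, ← hW, ← hq]
    simp [Nat.ModEq]
  have h1 : posRes q (ringPoint e r (ringBase m d r e) a) ≤ ringPoint e r (i * W) a := by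
    have h2 : r - 1 + ∑ l ∈ range e, a l * ringBase m d r e ^ l ≡
        r - 1 + ∑ l ∈ range e, a l * (i * W) ^ l [MOD q] := by
      have := Nat.ModEq.add_left_cancel' r hmod
      exact this.add_left _
    have e1 : ∀ x, r + x - 1 = r - 1 + x := fun x => by omega
    rw [posRes, ringPoint, e1, h2]
    have := Nat.mod_le (r - 1 + ∑ l ∈ range e, a l * (i * W) ^ l) q
    rw [ringPoint]; omega
  refine h1.trans ?_
  have hS : 1 ≤ ringNum d e * W := Nat.mul_pos (by simp [ringNum]) (Nat.factorial_pos _)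
  have h3 : ∑ l ∈ range e, a l * (i * W) ^ l ≤ ∑ l ∈ range e, r * (ringNum d e * W) ^ e := by
    refine sum_le_sum fun l hl => ?_
    have hl' := mem_range.1 hl
    refine Nat.mul_le_mul (ha l hl').le ?_
    exact (Nat.pow_le_pow_left (Nat.mul_le_mul_right _ hi.le) _).trans
      (Nat.pow_le_pow_right hS hl'.le)
  rw [sum_const, card_range, smul_eq_mul] at h3
  have h4 : 1 ≤ (ringNum d e * W) ^ e := Nat.pow_pos hS
  calc ringPoint e r (i * W) a ≤ r * (ringNum d e * W) ^ e + e * (r * (ringNum d e * W) ^ e) :=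
        Nat.add_le_add (Nat.le_mul_of_pos_right _ h4) h3
    _ = r * (e + 1) * 1 * 1 * (ringNum d e * W) ^ e := by ring
    _ ≤ ringRes d r e := by rw [ringRes, ← hW]; gcongr <;> omega

theorem ringPoint_le (hd : 2 ≤ d) (hr : 2 ≤ r) (he : 1 ≤ e) {a : ℕ → ℕ} (ha : ∀ l < e, a l < r) :
    ringPoint e r (ringBase m d r e) a ≤ ringBase m d r e ^ e := by
  set M := ringBase m d r e with hM
  have hM1 : (e + 1) * r ≤ M := by
    have := le_ringBase (m := m) (r := r) (e := e) hd
    rw [mul_assoc] at this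
    exact (Nat.le_mul_of_pos_left _ (by omega : 0 < d)).trans this.le
  have hM0 : 1 ≤ M := by nlinarith
  have h1 : ∑ l ∈ range e, a l * M ^ l ≤ ∑ l ∈ range e, r * M ^ (e - 1) := by
    refine sum_le_sum fun l hl => ?_
    have hl' := mem_range.1 hl
    exact Nat.mul_le_mul (ha l hl').le (Nat.pow_le_pow_right hM0 (by omega))
  rw [sum_const, card_range, smul_eq_mul] at h1
  have h2 : 1 ≤ M ^ (e - 1) := Nat.pow_pos hM0
  calc ringPoint e r M a ≤ r * M ^ (e - 1) + e * (r * M ^ (e - 1)) :=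
        Nat.add_le_add (Nat.le_mul_of_pos_right _ h2) h1
    _ = (e + 1) * r * M ^ (e - 1) := by ring
    _ ≤ M * M ^ (e - 1) := Nat.mul_le_mul_right _ hM1
    _ = M ^ e := by rw [← pow_succ']; congr 1; omega

theorem le_ringRes (hd : 2 ≤ d) (hr : 2 ≤ r) : r * d ^ 2 ≤ ringRes d r e ∧ 2 ≤ ringRes d r e := by
  have h1 : 1 ≤ (ringNum d e * (ringNum d e).factorial) ^ e :=
    Nat.pow_pos (Nat.mul_pos (by simp [ringNum]) (Nat.factorial_pos _))
  have h2 : r * d ^ 2 ≤ ringRes d r e := by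
    calc r * d ^ 2 = r * 1 * d * d * 1 := by ring
      _ ≤ ringRes d r e := by rw [ringRes]; gcongr; omega
  refine ⟨h2, le_trans ?_ h2⟩
  exact hr.trans (Nat.le_mul_of_pos_right _ (by positivity))

end MME

namespace MME

open Finset

/-! ### The program for extension rings -/

theorem Prog.not_WM_shift_add {A s : ℕ} {P : Prog} (h : ¬ P.WM A) : ¬ (P.shift s).WM (A + s) := by
  induction P with
  | skip => simp [Prog.shift]
  | assign x u => simp [Prog.shift]
  | write B i u => simpa [Prog.shift] using h
  | seq P Q h1 h2 => simp only [Prog.WM, not_or] at h; simp [Prog.shift, h1 h.1, h2 h.2]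
  | cond u P Q h1 h2 => simp only [Prog.WM, not_or] at h; simp [Prog.shift, h1 h.1, h2 h.2]
  | loop u P h1 => simpa [Prog.shift] using h1 h

/-- The constants: register `6` receives the number of moduli, `7` its factorial, `11` the integer
substituted for `z`, and `12` the bound for the residues. -/
def ringSetup : Prog :=
  .pow 5 32 (ρ 1) (ρ 0) ;; 6 ≔ 2 * ρ 4 * ρ 1 + 2 ;; 7 ≔ 1 ;;
  .for 32 (ρ 6) (7 ≔ ρ 7 * (ρ 32 + 1)) ;;
  8 ≔ ρ 1 * (ρ 4 + 1) * ρ 3 ;; 9 ≔ ρ 1 * (ρ 0 + 1) ;; .pow 10 32 (ρ 8) (ρ 9) ;;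
  11 ≔ 1 + ρ 7 * (2 * ρ 6 * ρ 10) ;; .pow 12 32 (ρ 6 * ρ 7) (ρ 4) ;;
  12 ≔ ρ 3 * (ρ 4 + 1) * ρ 1 * ρ 1 * ρ 12

/-- The moduli go to array `43` and the integer points to array `41`. -/
def ringArrays : Prog :=
  .for 32 (ρ 6) (.write 43 (ρ 32) (ρ 11 - ρ 32 * ρ 7)) ;;
  .for 32 (ρ 2 * ρ 0) (13 ≔ 0 ;;
    .for 33 (ρ 4) (13 ≔ ρ 13 * ρ 11 + .read 2 (ρ 32 * ρ 4 + (ρ 4 - 1 - ρ 33))) ;;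
    .write 41 (ρ 32) (ρ 13 + ρ 3))

/-- One evaluation over the integers for each power of `z` in the coefficients; array `4` receives
the values at the points of the polynomial with `z` replaced by an integer. -/
def ringMain (sub : Prog) : Prog :=
  .for 32 (ρ 2) (.write 4 (ρ 32) 0) ;; 14 ≔ 1 ;;
  .for 15 (ρ 4) (.for 32 (ρ 5) (.write 40 (ρ 32) (.read 1 (ρ 32 * ρ 4 + ρ 15))) ;;
    40 ≔ ρ 0 ;; 41 ≔ ρ 1 ;; 42 ≔ ρ 2 ;; 43 ≔ ρ 12 ;; 44 ≔ ρ 6 ;; (crtProg sub).shift 40 ;;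
    .for 32 (ρ 2) (.write 4 (ρ 32) (.read 4 (ρ 32) + ρ 14 * .read 42 (ρ 32))) ;;
    14 ≔ ρ 14 * ρ 11)

/-- The digits of the numbers in array `4` are reduced modulo `E` by Horner's rule, and the results
are written to array `3`. -/
def ringFinish : Prog :=
  16 ≔ ρ 4 * ρ 9 ;; .pow 17 32 (ρ 11) (ρ 16) ;;
  .for 18 (ρ 2) (.for 33 (ρ 4) (.write 3 (ρ 18 * ρ 4 + ρ 33) 0) ;; 19 ≔ ρ 17 ;;
    .for 20 (ρ 16) (19 ≔ ρ 19 / ρ 11 ;; 21 ≔ .read 4 (ρ 18) / ρ 19 % ρ 11 ;;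
      22 ≔ .read 3 (ρ 18 * ρ 4 + (ρ 4 - 1)) ;;
      .for 33 (ρ 4) (23 ≔ ρ 4 - 1 - ρ 33 ;;
        .write 3 (ρ 18 * ρ 4 + ρ 23)
          (((ρ 23).eq 0 * ρ 21 + Exp.lt 0 (ρ 23) * .read 3 (ρ 18 * ρ 4 + (ρ 23 - 1)) +
            (ρ 3 - ρ 22) * .read 0 (ρ 23)) % ρ 3))))

/-- The program: evaluation of polynomials over `(ℤ/rℤ)[z]/(E)` with `ℓ` levels of reduction modulo
primes. -/
def ringProg (ℓ : ℕ) : Prog :=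
  ringSetup ;; ringArrays ;; ringMain (levelProg ℓ) ;; ringFinish

/-- Multiplication by `z` modulo `E` followed by addition of `b`, on coefficient vectors modulo `r`;
`E` is given by its coefficients below the leading one. -/
def hornerStep (e r : ℕ) (E : ℕ → ℕ) (g : ℕ → ℕ) (b k : ℕ) : ℕ :=
  ((if k = 0 then b else g (k - 1)) + (r - g (e - 1)) * E k) % r

/-- The leading `t` of the `D` base-`M` digits of `v`, combined by Horner's rule modulo `E`. -/
def horner (e r : ℕ) (E : ℕ → ℕ) (M D v : ℕ) : ℕ → ℕ → ℕ
  | 0 => fun _ => 0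
  | t + 1 => hornerStep e r E (horner e r E M D v t) (v / M ^ (D - 1 - t) % M)

/-- The value at a point of the polynomial with `z` replaced by the integer `M`. The arrays `c` and
`p` consist of blocks of `e` cells. -/
def ringValue (e r M m d : ℕ) (c p : ℕ → ℕ) (i n : ℕ) : ℕ :=
  ∑ l ∈ range n, M ^ l * polyVal m d (fun k => c (k * e + l))
    (fun j => ringPoint e r M (fun l => p ((i * m + j) * e + l)))

/-- Size conditions for `ringProg`. -/
structure RingBounds (V m d N r e : ℕ) : Prop where
  hd : 2 ≤ d
  hr : 2 ≤ r
  he : 1 ≤ e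
  hM : ringBase m d r e ^ (ringNum d e * (m + 2) + e) ≤ V
  hy : ringRes d r e ^ (2 * m + 1) ≤ V
  hN : N ≤ V
  hNm : N * m ≤ V

theorem RingBounds.pow_le {V m d N r e k : ℕ} (h : RingBounds V m d N r e)
    (hk : k ≤ ringNum d e * (m + 2) + e) : ringBase m d r e ^ k ≤ V :=
  (Nat.pow_le_pow_right (Nat.le_add_right _ _) hk).trans h.hM

/-- The data available after the computation of the constants. -/
structure RingCtx (m d N r e : ℕ) (c₀ c₁ c₂ : ℕ → ℕ) (σ : State) : Prop where
  r0 : σ.reg 0 = m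
  r1 : σ.reg 1 = d
  r2 : σ.reg 2 = N
  r3 : σ.reg 3 = r
  r4 : σ.reg 4 = e
  r5 : σ.reg 5 = d ^ m
  r6 : σ.reg 6 = ringNum d e
  r7 : σ.reg 7 = (ringNum d e).factorial
  r9 : σ.reg 9 = d * (m + 1)
  r11 : σ.reg 11 = ringBase m d r e
  r12 : σ.reg 12 = ringRes d r e
  m0 : σ.mem 0 = c₀
  m1 : σ.mem 1 = c₁
  m2 : σ.mem 2 = c₂

theorem RingCtx.of_frame {m d N r e : ℕ} {c₀ c₁ c₂ : ℕ → ℕ} {σ τ : State} {P : Prog}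
    (h : RingCtx m d N r e c₀ c₁ c₂ σ) (hf : Frame P σ τ) (hR : ∀ x < 13, ¬ P.WR x)
    (hM : ∀ A < 3, ¬ P.WM A) : RingCtx m d N r e c₀ c₁ c₂ τ where
  r0 := by rw [hf.reg 0 (hR 0 (by omega)), h.r0]
  r1 := by rw [hf.reg 1 (hR 1 (by omega)), h.r1]
  r2 := by rw [hf.reg 2 (hR 2 (by omega)), h.r2]
  r3 := by rw [hf.reg 3 (hR 3 (by omega)), h.r3]
  r4 := by rw [hf.reg 4 (hR 4 (by omega)), h.r4]
  r5 := by rw [hf.reg 5 (hR 5 (by omega)), h.r5]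
  r6 := by rw [hf.reg 6 (hR 6 (by omega)), h.r6]
  r7 := by rw [hf.reg 7 (hR 7 (by omega)), h.r7]
  r9 := by rw [hf.reg 9 (hR 9 (by omega)), h.r9]
  r11 := by rw [hf.reg 11 (hR 11 (by omega)), h.r11]
  r12 := by rw [hf.reg 12 (hR 12 (by omega)), h.r12]
  m0 := by rw [hf.mem 0 (hM 0 (by omega)), h.m0]
  m1 := by rw [hf.mem 1 (hM 1 (by omega)), h.m1]
  m2 := by rw [hf.mem 2 (hM 2 (by omega)), h.m2]

theorem ringNum_factorial_lt_ringBase {m d r e : ℕ} (hd : 2 ≤ d) (hr : 2 ≤ r) :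
    2 * ringNum d e * (ringNum d e).factorial < ringBase m d r e := by
  have h1 := one_le_ringBound (m := m) (e := e) hd hr
  have h2 := Nat.mul_le_mul_left ((ringNum d e).factorial * (2 * ringNum d e)) h1
  rw [ringBase]
  calc 2 * ringNum d e * (ringNum d e).factorial
      = (ringNum d e).factorial * (2 * ringNum d e) * 1 := by ring
    _ ≤ (ringNum d e).factorial * (2 * ringNum d e) * ringBound m d r e := h2
    _ < 1 + (ringNum d e).factorial * (2 * ringNum d e * ringBound m d r e) := by
        rw [mul_assoc]; omega

theorem HT.ringSetup {V m d N r e : ℕ} {σ : State} (hB : RingBounds V m d N r e)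
    (h0 : σ.reg 0 = m) (h1 : σ.reg 1 = d) (h2 : σ.reg 2 = N) (h3 : σ.reg 3 = r)
    (h4 : σ.reg 4 = e) :
    HT V ringSetup σ (3 * m + 3 * ringNum d e + 3 * (d * (m + 1)) + 3 * e + 18)
      (RingCtx m d N r e (σ.mem 0) (σ.mem 1) (σ.mem 2)) := by
  have hd := hB.hd
  have hr := hB.hr
  have he := hB.he
  have hZM := ringBound_lt_ringBase (m := m) (d := d) (r := r) (e := e)
  have hWM := ringNum_factorial_lt_ringBase (m := m) (e := e) hd hr
  have hM := le_ringBase (m := m) (r := r) (e := e) hd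
  have hMV : ringBase m d r e ≤ V := by
    simpa using hB.pow_le (k := 1) (by have : 1 ≤ e := he; omega)
  have hS : 1 ≤ ringNum d e := by simp [ringNum]
  have hW := Nat.factorial_pos (ringNum d e)
  have hWV : (ringNum d e).factorial ≤ 2 * ringNum d e * (ringNum d e).factorial :=
    Nat.le_mul_of_pos_left _ (by omega)
  have hSV : ringNum d e ≤ 2 * ringNum d e * (ringNum d e).factorial :=
    (Nat.le_mul_of_pos_left _ two_pos).trans (Nat.le_mul_of_pos_right _ hW)
  replace hWV : (ringNum d e).factorial ≤ V := by omega
  replace hSV : ringNum d e ≤ V := by omega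
  have hZV : ringBound m d r e ≤ V := by omega
  have hder : d * (e + 1) ≤ d * (e + 1) * r := Nat.le_mul_of_pos_right _ (by omega)
  have hde1 : d * (e + 1) = d * e + d := by ring
  have hde2 : e ≤ d * e := Nat.le_mul_of_pos_left _ (by omega)
  have hdm1 : m + 1 ≤ d * (m + 1) := Nat.le_mul_of_pos_left _ (by omega)
  have hdm2 : d * (m + 1) = d * m + d := by ring
  have hx : 2 ≤ d * (e + 1) * r := by omega
  have hDV : d * (m + 1) < ringBound m d r e := by
    rw [ringBound]; exact Nat.lt_pow_self (by omega)
  have hyV : ringRes d r e ≤ V := (Nat.le_self_pow (by omega) _).trans hB.hy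
  have hSWe : (ringNum d e * (ringNum d e).factorial) ^ e ≤ ringRes d r e := by
    rw [ringRes]; exact Nat.le_mul_of_pos_left _ (by positivity)
  have hde : d * (e + 1) * r ≤ V := by omega
  have heV : e ≤ V := by omega
  have hdm : d ^ m ≤ V := by
    refine le_trans ?_ hZV
    rw [ringBound]
    calc d ^ m ≤ (d * (e + 1) * r) ^ m := Nat.pow_le_pow_left (by omega) _
      _ ≤ _ := Nat.pow_le_pow_right (by omega) (by omega)
  have hm : m ≤ V := by omega
  refine HT.mono (n := (m * 3 + 3) + (1 + (1 + ((ringNum d e * (1 + 2) + 2) + (1 + (1 +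
    ((d * (m + 1) * 3 + 3) + (1 + ((e * 3 + 3) + 1))))))))) (R := RingCtx m d N r e (σ.mem 0)
      (σ.mem 1) (σ.mem 2)) ?_ (by omega) (fun _ _ h => h)
  refine HT.seq (HT.pow (b := d) (k := m) (by norm_num) ?_ ?_ hm (by omega) hdm) ?_
  · intro τ hf; simp [hf.reg, Prog.pow, h1]
  · intro τ hf; simp [hf.reg, Prog.pow, h0]
  intro τ hf a5
  have a0 : τ.reg 0 = m := by simp [hf.reg, Prog.pow, h0]
  have a1 : τ.reg 1 = d := by simp [hf.reg, Prog.pow, h1]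
  have a2 : τ.reg 2 = N := by simp [hf.reg, Prog.pow, h2]
  have a3 : τ.reg 3 = r := by simp [hf.reg, Prog.pow, h3]
  have a4 : τ.reg 4 = e := by simp [hf.reg, Prog.pow, h4]
  have am : ∀ A, τ.mem A = σ.mem A := fun A => by simp [hf.mem, Prog.pow]
  refine HT.assign_seq (by simpa [a1, a4, ringNum] using hSV) ?_
  refine HT.assign_seq (by simp; omega) ?_
  set τ₁ := (τ.setReg 6 ((2 * ρ 4 * ρ 1 + 2 : Exp).val τ)).setReg 7
    ((1 : Exp).val (τ.setReg 6 ((2 * ρ 4 * ρ 1 + 2 : Exp).val τ))) with hτ₁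
  have b6 : τ₁.reg 6 = ringNum d e := by simp [hτ₁, a1, a4, ringNum]
  have b7 : τ₁.reg 7 = 1 := by simp [hτ₁]
  have bx : ∀ x < 6, τ₁.reg x = τ.reg x := fun x hx => by
    rw [hτ₁]; simp [show x ≠ 7 by omega, show x ≠ 6 by omega]
  have bm : ∀ A, τ₁.mem A = τ.mem A := fun A => rfl
  clear_value τ₁
  refine HT.seq (HT.for (s := 1) (fun j τ => τ.reg 7 = j.factorial) hSV (by simp) ?_ (by simp [b7])
    ?_ (fun _ _ _ h => h)) ?_
  · intro j τ' hf _; simp [hf.reg, b6]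
  · intro j τ' hj hf hr hI
    have hv : (ρ 7 * (ρ 32 + 1) : Exp).val τ' = (j + 1).factorial := by
      simp [hI, hr, Nat.factorial_succ, mul_comm]
    refine HT.assign ?_ (by rw [hv]; simp)
    rw [hv]
    exact (Nat.factorial_le hj).trans hWV
  intro τ₂ hf₂ c7
  have cx : ∀ x < 6, τ₂.reg x = τ.reg x := fun x hx => by
    rw [hf₂.reg x (by simp; omega), bx x hx]
  have c6 : τ₂.reg 6 = ringNum d e := by simp [hf₂.reg, b6]
  have cm : ∀ A, τ₂.mem A = τ.mem A := fun A => by simp [hf₂.mem, bm]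
  have c0 : τ₂.reg 0 = m := by rw [cx 0 (by norm_num), a0]
  have c1 : τ₂.reg 1 = d := by rw [cx 1 (by norm_num), a1]
  have c3 : τ₂.reg 3 = r := by rw [cx 3 (by norm_num), a3]
  have c4 : τ₂.reg 4 = e := by rw [cx 4 (by norm_num), a4]
  refine HT.assign_seq (by simpa [c1, c3, c4] using hde) ?_
  refine HT.assign_seq (by simp [c0, c1]; omega) ?_
  set τ₃ := (τ₂.setReg 8 ((ρ 1 * (ρ 4 + 1) * ρ 3 : Exp).val τ₂)).setReg 9
    ((ρ 1 * (ρ 0 + 1) : Exp).val (τ₂.setReg 8 ((ρ 1 * (ρ 4 + 1) * ρ 3 : Exp).val τ₂))) with hτ₃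
  have d8 : τ₃.reg 8 = d * (e + 1) * r := by simp [hτ₃, c1, c3, c4]
  have d9 : τ₃.reg 9 = d * (m + 1) := by simp [hτ₃, c1, c0]
  have dx : ∀ x < 8, τ₃.reg x = τ₂.reg x := fun x hx => by
    rw [hτ₃]; simp [show x ≠ 8 by omega, show x ≠ 9 by omega]
  have dm : ∀ A, τ₃.mem A = τ.mem A := fun A => by rw [← cm]; rfl
  clear_value τ₃
  refine HT.seq (HT.pow (b := d * (e + 1) * r) (k := d * (m + 1)) (by norm_num) ?_ ?_ (by omega)
    (by omega) hZV) ?_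
  · intro τ hf; simp [hf.reg, Prog.pow, d8]
  · intro τ hf; simp [hf.reg, Prog.pow, d9]
  intro τ₄ hf₄ e10
  have ex : ∀ x < 8, τ₄.reg x = τ₂.reg x := fun x hx => by
    rw [hf₄.reg x (by simp [Prog.pow]; omega), dx x hx]
  have e6 := (ex 6 (by norm_num)).trans c6
  have e7 := (ex 7 (by norm_num)).trans c7
  have e9 : τ₄.reg 9 = d * (m + 1) := by simp [hf₄.reg, Prog.pow, d9]
  have em : ∀ A, τ₄.mem A = τ.mem A := fun A => by simp [hf₄.mem, Prog.pow, dm]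
  have ev : (1 + ρ 7 * (2 * ρ 6 * ρ 10) : Exp).val τ₄ = ringBase m d r e := by
    simp [e6, e7, e10, ringBase, ringBound]
  refine HT.assign_seq (by rw [ev]; exact hMV) ?_
  rw [ev]
  set τ₅ := τ₄.setReg 11 (ringBase m d r e) with hτ₅
  have f6 : τ₅.reg 6 = ringNum d e := by simp [hτ₅, e6]
  have f7 : τ₅.reg 7 = (ringNum d e).factorial := by simp [hτ₅, e7]
  have f4 : τ₅.reg 4 = e := by simp [hτ₅, ex, c4]
  refine HT.seq (HT.pow (b := ringNum d e * (ringNum d e).factorial) (k := e) (by norm_num) ?_ ?_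
    heV (by omega) (by omega)) ?_
  · intro τ hf; simp [hf.reg, Prog.pow, f6, f7]
  · intro τ hf; simp [hf.reg, Prog.pow, f4]
  intro τ₆ hf₆ g12
  have gx : ∀ x < 6, τ₆.reg x = τ.reg x := fun x hx => by
    rw [hf₆.reg x (by simp [Prog.pow]; omega), hτ₅, State.setReg_reg, if_neg (by omega),
      ex x (by omega), cx x hx]
  have gm : ∀ A, τ₆.mem A = τ.mem A := fun A => by simp [hf₆.mem, Prog.pow, hτ₅, em]
  have g1 := (gx 1 (by norm_num)).trans a1
  have g3 := (gx 3 (by norm_num)).trans a3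
  have g4 := (gx 4 (by norm_num)).trans a4
  have gv : (ρ 3 * (ρ 4 + 1) * ρ 1 * ρ 1 * ρ 12 : Exp).val τ₆ = ringRes d r e := by
    simp [g1, g3, g4, g12, ringRes]
  refine HT.assign (by rw [gv]; exact hyV) ?_
  rw [gv]
  constructor
  · simp [gx, a0]
  · simp [gx, a1]
  · simp [gx, a2]
  · simp [gx, a3]
  · simp [gx, a4]
  · simp [gx, a5]
  · simp [hf₆.reg, Prog.pow, f6]
  · simp [hf₆.reg, Prog.pow, f7]
  · simp [hf₆.reg, Prog.pow, hτ₅, e9]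
  · simp [hf₆.reg, Prog.pow, hτ₅]
  · simp
  · simp [gm, am]
  · simp [gm, am]
  · simp [gm, am]

end MME

namespace MME

open Finset

/-! ### Integer points and sizes of the values -/

theorem two_le_ringBase {m d r e : ℕ} (hd : 2 ≤ d) (hr : 2 ≤ r) : 2 ≤ ringBase m d r e := by
  have h := le_ringBase (m := m) (r := r) (e := e) hd
  have h1 : d * (e + 1) ≤ d * (e + 1) * r := Nat.le_mul_of_pos_right _ (by omega)
  have h2 : d ≤ d * (e + 1) := Nat.le_mul_of_pos_right _ (by omega)
  omega

theorem lt_ringBase {m d r e : ℕ} (hd : 2 ≤ d) (hr : 2 ≤ r) :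
    d < ringBase m d r e ∧ r < ringBase m d r e ∧ e < ringBase m d r e := by
  have h := le_ringBase (m := m) (r := r) (e := e) hd
  have h1 : d * (e + 1) ≤ d * (e + 1) * r := Nat.le_mul_of_pos_right _ (by omega)
  have h2 : d ≤ d * (e + 1) := Nat.le_mul_of_pos_right _ (by omega)
  have h3 : e + 1 ≤ d * (e + 1) := Nat.le_mul_of_pos_left _ (by omega)
  have h4 : r ≤ d * (e + 1) * r := Nat.le_mul_of_pos_left _ (by positivity)
  omega

theorem RingBounds.base_le {V m d N r e : ℕ} (h : RingBounds V m d N r e) :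
    ringBase m d r e ≤ V := by
  have := h.he
  simpa using h.pow_le (k := 1) (by omega)

theorem RingBounds.num_le {V m d N r e : ℕ} (h : RingBounds V m d N r e) : ringNum d e ≤ V := by
  have h1 := ringNum_factorial_lt_ringBase (m := m) (e := e) h.hd h.hr
  have h2 := (Nat.le_mul_of_pos_left (ringNum d e) two_pos).trans
    (Nat.le_mul_of_pos_right _ (Nat.factorial_pos (ringNum d e)))
  have := h.base_le
  omega

theorem HT.ringArrays {V m d N r e : ℕ} {c₀ c₁ c₂ : ℕ → ℕ} {σ : State}
    (hB : RingBounds V m d N r e) (hc : RingCtx m d N r e c₀ c₁ c₂ σ)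
    (h2 : ∀ u < N * m, ∀ l < e, c₂ (u * e + l) < r) :
    HT V ringArrays σ (3 * ringNum d e + N * m * (3 * e + 6) + 4)
      (fun τ => (∀ a < ringNum d e, τ.mem 43 a = ringMod m d r e a) ∧
        ∀ u < N * m, τ.mem 41 u = ringPoint e r (ringBase m d r e) fun l => c₂ (u * e + l)) := by
  have hd := hB.hd
  have hr := hB.hr
  have he := hB.he
  have hMV := hB.base_le
  obtain ⟨-, hrM, heM⟩ := lt_ringBase (m := m) (e := e) hd hr
  refine HT.mono (n := (ringNum d e * (1 + 2) + 2) + (N * m * ((1 + ((e * (1 + 2) + 2) + 1)) + 2) + 2))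
    (R := fun τ => (∀ a < ringNum d e, τ.mem 43 a = ringMod m d r e a) ∧
        ∀ u < N * m, τ.mem 41 u = ringPoint e r (ringBase m d r e) fun l => c₂ (u * e + l))
    ?_ (by ring_nf; omega) (fun _ _ h => h)
  refine HT.seq (HT.for (s := 1) (fun j τ => ∀ a < j, τ.mem 43 a = ringMod m d r e a)
    hB.num_le (by simp) ?_ (by simp) ?_ (fun _ _ _ h => h)) ?_
  · intro j τ hf _; simp [hf.reg, hc.r6]
  · intro j τ hj hf h32 hI
    have a11 : τ.reg 11 = ringBase m d r e := by simp [hf.reg, hc.r11]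
    have a7 : τ.reg 7 = (ringNum d e).factorial := by simp [hf.reg, hc.r7]
    refine HT.write ?_ ?_
    · simp only [Exp.val_sub, Exp.val_reg, Exp.val_mul, a11]; omega
    · intro a ha
      simp only [State.setReg_mem, State.setMem_mem, Exp.val_sub, Exp.val_reg, Exp.val_mul, a11, a7,
        h32, true_and]
      split
      · next h => rw [h, ringMod]
      · exact hI a (by omega)
  intro τ hf hmo
  have c' : RingCtx m d N r e c₀ c₁ c₂ τ :=
    hc.of_frame hf (fun x hx => by simp; omega) (fun x hx => by simp; omega)
  refine HT.for (fun j τ => ∀ u < j, τ.mem 41 u =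
    ringPoint e r (ringBase m d r e) fun l => c₂ (u * e + l)) hB.hNm (by simp) ?_ (by simp) ?_ ?_
  · intro j τ' hf' _; simp [hf'.reg, c'.r0, c'.r2]
  · intro u τ₁ hu hf₁ h32 hI
    have c₁ : RingCtx m d N r e c₀ c₁ c₂ τ₁ :=
      c'.of_frame hf₁ (fun x hx => by simp; omega) (fun x hx => by simp; omega)
    refine HT.assign_seq (by simp) ?_
    set τ₂ := τ₁.setReg 13 ((0 : Exp).val τ₁) with hτ₂
    have b13 : τ₂.reg 13 = 0 := by simp [hτ₂]
    have b32 : τ₂.reg 32 = u := by simp [hτ₂, h32]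
    have bx : ∀ x < 13, τ₂.reg x = τ₁.reg x := fun x hx => by
      rw [hτ₂, State.setReg_reg, if_neg (by omega)]
    have bm : τ₂.mem = τ₁.mem := rfl
    clear_value τ₂
    refine HT.seq (HT.for (s := 1) (fun j τ => τ.reg 13 = ∑ l ∈ range j,
        c₂ (u * e + (e - j + l)) * ringBase m d r e ^ l ∧ τ.reg 13 < ringBase m d r e ^ j)
        (by omega) (by simp) ?_ (by simp [b13]) ?_ (fun _ _ _ h => h.1)) ?_
    · intro j τ hf _; simp [hf.reg, bx, c₁.r4]
    · intro j τ hj hf h33 hI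
      have d4 : τ.reg 4 = e := by simp [hf.reg, bx, c₁.r4]
      have d11 : τ.reg 11 = ringBase m d r e := by simp [hf.reg, bx, c₁.r11]
      have d32 : τ.reg 32 = u := by simp [hf.reg, b32]
      have dm : τ.mem 2 = c₂ := by simp [hf.mem, bm, c₁.m2]
      have hv : (ρ 13 * ρ 11 + .read 2 (ρ 32 * ρ 4 + (ρ 4 - 1 - ρ 33)) : Exp).val τ =
          τ.reg 13 * ringBase m d r e + c₂ (u * e + (e - (j + 1) + 0)) := by
        simp only [Exp.val_sub, Exp.val_reg, Exp.val_mul, Exp.val_add, Exp.val_read, Exp.val_one,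
          d4, d11, d32, dm, h33]
        rw [Nat.sub_sub, Nat.add_comm 1 j]; rfl
      have hlt : τ.reg 13 * ringBase m d r e + c₂ (u * e + (e - (j + 1) + 0)) <
          ringBase m d r e ^ (j + 1) := by
        have h3 := h2 u hu (e - (j + 1) + 0) (by omega)
        have h4 := Nat.mul_le_mul_right (ringBase m d r e) (Nat.succ_le_of_lt hI.2)
        rw [Nat.succ_mul] at h4
        rw [pow_succ]; omega
      refine HT.assign ?_ ?_
      · rw [hv]; exact hlt.le.trans (hB.pow_le (by omega))
      · rw [hv]
        simp only [State.setReg_reg, if_true, show (13 : ℕ) ≠ 33 by norm_num, if_false]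
        refine ⟨?_, hlt⟩
        rw [sum_range_succ', hI.1, sum_mul, pow_zero, mul_one]
        congr 1
        refine sum_congr rfl fun l hl => ?_
        rw [show e - (j + 1) + (l + 1) = e - j + l by omega, pow_succ, mul_assoc]
    · intro τ₃ hf₃ e13
      have hv : (ρ 13 + ρ 3 : Exp).val τ₃ =
          ringPoint e r (ringBase m d r e) fun l => c₂ (u * e + l) := by
        have d3 : τ₃.reg 3 = r := by simp [hf₃.reg, bx, c₁.r3]
        rw [ringPoint, Exp.val_add, Exp.val_reg, Exp.val_reg, e13, d3, add_comm]
        simp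
      have d32 : τ₃.reg 32 = u := by simp [hf₃.reg, b32]
      have d41 : τ₃.mem 41 = τ₁.mem 41 := by simp [hf₃.mem, bm]
      refine HT.write ?_ ?_
      · rw [hv]
        exact (ringPoint_le hd hr he (h2 u hu)).trans (hB.pow_le (Nat.le_add_left _ _))
      · intro v hv'
        rw [hv]
        simp only [State.setReg_mem, State.setMem_mem, Exp.val_reg, d32, d41, true_and]
        split
        · next h => rw [h]
        · exact hI v (by omega)
  · intro τ₁ hf₁ _ h41
    refine ⟨fun a ha => ?_, h41⟩
    rw [hf₁.mem 43 (by simp), hmo a ha]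

theorem not_WM_crtProg {sub : Prog} {x : ℕ} (h : x < 2 ∨ x = 3) : ¬ (crtProg sub).WM x := by
  have := not_WM_modStep (sub := sub) h
  simp [crtProg, Prog.pow, this]
  omega

/-- The size conditions for Chinese remaindering with the moduli `ringMod`. -/
theorem RingBounds.bodyBounds {V m d N r e a : ℕ} {c p : ℕ → ℕ} {p' : ℕ → ℕ → ℕ}
    (hB : RingBounds V m d N r e) (ha : a < ringNum d e) (hc : ∀ k < d ^ m, c k < r)
    (hp : ∀ u < N * m, p u = ringPoint e r (ringBase m d r e) (p' u))
    (hp' : ∀ u < N * m, ∀ l < e, p' u l < r) :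
    BodyBounds V m d N (ringRes d r e) (ringBase m d r e ^ e) (ringMod m d r e a) c p := by
  have hd := hB.hd
  have hr := hB.hr
  have he := hB.he
  have hMV := hB.base_le
  obtain ⟨hdM, hrM, heM⟩ := lt_ringBase (m := m) (e := e) hd hr
  have hM1 : 1 ≤ ringBase m d r e := by omega
  have hS : ringNum d e = 2 * (e * d) + 2 := by rw [ringNum]; ring
  have hSm : 2 * m + 4 ≤ ringNum d e * (m + 2) := by
    have := Nat.mul_le_mul_right (m + 2) (show 2 ≤ ringNum d e by omega)
    omega
  have hSe : e * (2 * m + 1) ≤ ringNum d e * (m + 2) := by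
    rw [hS]
    have : e * 1 ≤ e * d := Nat.mul_le_mul_left _ (by omega)
    nlinarith
  have hqM : ringMod m d r e a ≤ ringBase m d r e := Nat.sub_le _ _
  exact {
    hd := hd
    hq := two_le_ringMod hd hr ha
    hy := by have := (le_ringRes (e := e) hd hr).2; omega
    hY := Nat.pow_pos hM1
    hdV := by omega
    hN := hB.hN
    hNm := hB.hNm
    hdm := (Nat.pow_le_pow_left hdM.le _).trans (hB.pow_le (by omega))
    h2 := (Nat.pow_le_pow_left (by omega : 2 ≤ ringBase m d r e) _).trans (hB.pow_le (by omega))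
    hyV := hB.hy
    hYV := by rw [← pow_mul]; exact hB.pow_le (by omega)
    hp1 := fun u hu => by rw [hp u hu, ringPoint]; omega
    hpY := fun u hu => by rw [hp u hu]; exact ringPoint_le hd hr he (hp' u hu)
    hpy := fun u hu => by rw [hp u hu]; exact posRes_ringPoint_le hd hr (hp' u hu) ha
    hc := fun k hk => by
      calc c k * d ^ (2 * m + 1) ≤ ringBase m d r e * ringBase m d r e ^ (2 * m + 1) :=
            Nat.mul_le_mul ((hc k hk).le.trans hrM.le) (Nat.pow_le_pow_left hdM.le _)
        _ = ringBase m d r e ^ (2 * m + 2) := by rw [← pow_succ']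
        _ ≤ V := hB.pow_le (by omega)
    hQ := (Nat.pow_le_pow_left hqM _).trans (hB.pow_le (by omega))
    hw := fun I k hk => by
      refine (Nat.mod_le _ _).trans ((codeWeight_le d _ I k 0 _ (by omega)).trans ?_)
      calc c k * d ^ (2 * m + 1) ≤ r ^ (m + 2) * d ^ (2 * (m + 2)) :=
            Nat.mul_le_mul ((hc k hk).le.trans (Nat.le_self_pow (by omega) _))
              (Nat.pow_le_pow_right (by omega) (by omega))
        _ = (r * d ^ 2) ^ (m + 2) := by rw [mul_pow, ← pow_mul]
        _ ≤ _ := Nat.pow_le_pow_left (le_ringRes hd hr).1 _ }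

theorem polyVal_ringPoint_lt {m d r e : ℕ} (hd : 2 ≤ d) (hr : 2 ≤ r) (he : 1 ≤ e) {c : ℕ → ℕ}
    {p : ℕ → ℕ → ℕ} (hc : ∀ k < d ^ m, c k < r) (hp : ∀ j < m, ∀ l < e, p j l < r) :
    polyVal m d c (fun j => ringPoint e r (ringBase m d r e) (p j)) <
      (∏ a ∈ range (ringNum d e), ringMod m d r e a) ^ (m + 2) := by
  obtain ⟨hdM, hrM, heM⟩ := lt_ringBase (m := m) (e := e) hd hr
  have hM1 : 1 ≤ ringBase m d r e := by omega
  have hY : ringBase m d r e ≤ ringBase m d r e ^ e := Nat.le_self_pow (by omega) _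
  refine (polyVal_lt (y := ringBase m d r e ^ e) hd (by omega) (fun k hk => ?_)
    (fun j hj => ringPoint_le hd hr he (hp j hj))).trans_le (Nat.pow_le_pow_left ?_ _)
  · exact ((hc k hk).le.trans (hrM.le.trans hY)).trans (Nat.le_self_pow (by omega) _)
  · refine le_trans ?_ (ringBase_pow_le_prod hd hr)
    rw [← pow_mul, pow_succ']
    exact Nat.mul_le_mul_right _ hdM.le

theorem ringValue_lt {m d r e i N : ℕ} (hd : 2 ≤ d) (hr : 2 ≤ r) (he : 1 ≤ e) {c p : ℕ → ℕ}
    (hc : ∀ k < d ^ m, ∀ l < e, c (k * e + l) < r)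
    (hp : ∀ u < N * m, ∀ l < e, p (u * e + l) < r) (hi : i < N) (n : ℕ) (hn : n ≤ e) :
    ringValue e r (ringBase m d r e) m d c p i n <
      ringBase m d r e ^ (ringNum d e * (m + 2) + n) := by
  have hM2 := two_le_ringBase (m := m) (e := e) hd hr
  induction n with
  | zero => simpa [ringValue] using Nat.pow_pos (by omega)
  | succ n ih =>
    have h1 := ih (by omega)
    have h2 := polyVal_ringPoint_lt hd hr he (c := fun k => c (k * e + n))
      (p := fun j l => p ((i * m + j) * e + l)) (fun k hk => hc k hk n (by omega))
      (fun j hj l hl => hp _ (mul_add_lt_mul hi hj) l hl)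
    have h3 := h2.trans_le ((Nat.pow_le_pow_left prod_ringMod_le _).trans_eq (pow_mul _ _ _).symm)
    have h4 := Nat.mul_le_mul_left (ringBase m d r e ^ n) h3.le
    rw [← pow_add] at h4
    rw [ringValue, sum_range_succ, ← ringValue, ← add_assoc, pow_succ]
    rw [add_comm n] at h4
    have h5 := Nat.mul_le_mul_left (ringBase m d r e ^ (ringNum d e * (m + 2) + n)) hM2
    omega

end MME

namespace MME

open Finset

variable {V m d N r e : ℕ} {c₀ c₁ c₂ : ℕ → ℕ} {σ : State} {sub : Prog}

/-- The moduli `ringMod` have a product exceeding the values over the integers, so that `ringMain`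
finds these exactly. -/
theorem HT.ringMain {S : ℕ} (hB : RingBounds V m d N r e) (hctx : RingCtx m d N r e c₀ c₁ c₂ σ)
    (h1 : ∀ k < d ^ m, ∀ l < e, c₁ (k * e + l) < r)
    (h2 : ∀ u < N * m, ∀ l < e, c₂ (u * e + l) < r)
    (hmo : ∀ a < ringNum d e, σ.mem 43 a = ringMod m d r e a)
    (hpt : ∀ u < N * m, σ.mem 41 u = ringPoint e r (ringBase m d r e) fun l => c₂ (u * e + l))
    (hsub : EvalSpec V sub m d N (ringRes d r e) S) :
    HT V (ringMain sub) σ (3 * N + 5 + e * (3 * d ^ m + 3 * N + 12 + (ringNum d e + 1) *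
      (2 ^ (2 * m + 1) * (S + 50 * (m + 1) * (N + d ^ m + 1) + 16 * V.size))))
      (fun τ => ∀ i < N, τ.mem 4 i = ringValue e r (ringBase m d r e) m d c₁ c₂ i e) := by
  have hd := hB.hd
  have hr := hB.hr
  have he := hB.he
  have hMV := hB.base_le
  obtain ⟨hdM, hrM, heM⟩ := lt_ringBase (m := m) (e := e) hd hr
  have hM1 : 1 ≤ ringBase m d r e := by omega
  have hS0 : 0 < ringNum d e := by simp [ringNum]
  have hSV := hB.num_le
  have B0 := hB.bodyBounds hS0 (c := fun _ => 0) (fun _ _ => by omega) hpt h2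
  have hdV := B0.hdV
  have hmV : m ≤ V := by
    have := (Nat.lt_two_pow_self (n := 2 * m + 1)).le.trans B0.h2
    omega
  have hyV : ringRes d r e ≤ V := (Nat.le_self_pow (by omega) _).trans hB.hy
  have hsmall := fun {x : ℕ} (hx : x < 2 ∨ x = 3) =>
    Prog.not_WM_shift_add (s := 40) (not_WM_crtProg (sub := sub) hx)
  have w1 : ¬ ((MME.crtProg sub).shift 40).WM 41 := hsmall (x := 1) (by norm_num)
  have w3 : ¬ ((MME.crtProg sub).shift 40).WM 43 := hsmall (x := 3) (by norm_num)
  set T := (ringNum d e + 1) *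
      (2 ^ (2 * m + 1) * (S + 50 * (m + 1) * (N + d ^ m + 1) + 16 * V.size)) with hT
  refine HT.mono (n := (N * 3 + 2) + (1 + (e * (((d ^ m * (1 + 2) + 2) + (1 + (1 + (1 + (1 + (1 +
    (T + ((N * (1 + 2) + 2) + 1)))))))) + 2) + 2)))
    (R := fun τ => ∀ i < N, τ.mem 4 i = ringValue e r (ringBase m d r e) m d c₁ c₂ i e)
    ?_ (by ring_nf; omega) (fun _ _ h => h)
  refine HT.seq (HT.zeros hB.hN hctx.r2 (by norm_num)) ?_
  intro τ hf hz
  have c' : RingCtx m d N r e c₀ c₁ c₂ τ :=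
    hctx.of_frame hf (fun x hx => by simp; omega) (fun x hx => by simp; omega)
  have a41 : τ.mem 41 = σ.mem 41 := by simp [hf.mem]
  have a43 : τ.mem 43 = σ.mem 43 := by simp [hf.mem]
  refine HT.assign_seq (by simp; omega) ?_
  set τ₁ := τ.setReg 14 ((1 : Exp).val τ) with hτ₁
  have b14 : τ₁.reg 14 = 1 := by simp [hτ₁]
  have bx : ∀ x < 13, τ₁.reg x = τ.reg x := fun x hx => by
    rw [hτ₁, State.setReg_reg, if_neg (by omega)]
  have bm : τ₁.mem = τ.mem := rfl
  clear_value τ₁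
  refine HT.for (fun l τ => τ.reg 14 = ringBase m d r e ^ l ∧ ∀ i < N, τ.mem 4 i =
    ringValue e r (ringBase m d r e) m d c₁ c₂ i l) (by omega) (by simp) ?_ ?_ ?_
    (fun _ _ _ h => h.2)
  · intro j τ' hf' _; simp [hf'.reg, bx, c'.r4]
  · refine ⟨by simp [b14], fun i hi => ?_⟩
    simp [bm, hz i hi, ringValue]
  intro l τ₂ hl hf₂ h15 hI
  have d0 : τ₂.reg 0 = m := by simp [hf₂.reg, bx, c'.r0]
  have d1 : τ₂.reg 1 = d := by simp [hf₂.reg, bx, c'.r1]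
  have d2 : τ₂.reg 2 = N := by simp [hf₂.reg, bx, c'.r2]
  have d4 : τ₂.reg 4 = e := by simp [hf₂.reg, bx, c'.r4]
  have d5 : τ₂.reg 5 = d ^ m := by simp [hf₂.reg, bx, c'.r5]
  have d6 : τ₂.reg 6 = ringNum d e := by simp [hf₂.reg, bx, c'.r6]
  have d11 : τ₂.reg 11 = ringBase m d r e := by simp [hf₂.reg, bx, c'.r11]
  have d12 : τ₂.reg 12 = ringRes d r e := by simp [hf₂.reg, bx, c'.r12]
  have dm1 : τ₂.mem 1 = c₁ := by simp [hf₂.mem, bm, c'.m1]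
  have dm41 : τ₂.mem 41 = σ.mem 41 := by
    rw [hf₂.mem 41 (by simp [w1]), bm, a41]
  have dm43 : τ₂.mem 43 = σ.mem 43 := by
    rw [hf₂.mem 43 (by simp [w3]), bm, a43]
  -- the coefficients of `z ^ l` are copied to the memory of the subprogram, then its registers are set
  refine HT.seq (HT.for (s := 1) (fun j τ => ∀ k < j, τ.mem 40 k = c₁ (k * e + l)) B0.hdm (by simp)
    ?_ (by simp) ?_ (fun _ _ _ h => h)) ?_
  · intro j τ hf _; simp [hf.reg, d5]
  · intro j τ hj hf hr' hI
    have x4 : τ.reg 4 = e := by simp [hf.reg, d4]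
    have x15 : τ.reg 15 = l := by simp [hf.reg, h15]
    have xm : τ.mem 1 = c₁ := by simp [hf.mem, dm1]
    have hv : (.read 1 (ρ 32 * ρ 4 + ρ 15) : Exp).val τ = c₁ (j * e + l) := by
      simp [x4, x15, xm, hr']
    refine HT.write (by rw [hv]; exact (h1 j hj l hl).le.trans (by omega)) ?_
    intro k hk
    rw [hv]
    simp only [State.setReg_mem, State.setMem_mem, Exp.val_reg, hr', true_and]
    split
    · next h => rw [h]
    · exact hI k (by omega)
  intro τ₃ hf₃ e40
  have ex : ∀ x < 32, τ₃.reg x = τ₂.reg x := fun x hx => hf₃.reg x (by simp; omega)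
  have em : ∀ A, A ≠ 40 → τ₃.mem A = τ₂.mem A := fun A hA => hf₃.mem A (by simpa using hA)
  refine HT.assign_seq (by simp [ex, d0, hmV]) ?_
  refine HT.assign_seq (by simp [ex, d1, hdV]) ?_
  refine HT.assign_seq (by simp [ex, d2, hB.hN]) ?_
  refine HT.assign_seq (by simp [ex, d12, hyV]) ?_
  refine HT.assign_seq (by simp [ex, d6, hSV]) ?_
  set τ₄ := ((((τ₃.setReg 40 _).setReg 41 _).setReg 42 _).setReg 43 _).setReg 44 _ with hτ₄
  have f40 : τ₄.reg 40 = m := by simp [hτ₄, ex, d0]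
  have f41 : τ₄.reg 41 = d := by simp [hτ₄, ex, d1]
  have f42 : τ₄.reg 42 = N := by simp [hτ₄, ex, d2]
  have f43 : τ₄.reg 43 = ringRes d r e := by simp [hτ₄, ex, d12]
  have f44 : τ₄.reg 44 = ringNum d e := by simp [hτ₄, ex, d6]
  have fx : ∀ x < 32, τ₄.reg x = τ₂.reg x := fun x hx => by
    rw [← ex x hx, hτ₄]
    simp [show x ≠ 40 by omega, show x ≠ 41 by omega, show x ≠ 42 by omega, show x ≠ 43 by omega,
      show x ≠ 44 by omega]
  have fm : τ₄.mem = τ₃.mem := rfl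
  clear_value τ₄
  have g40 : ∀ k < d ^ m, τ₄.mem 40 k < r := fun k hk => by rw [fm, e40 k hk]; exact h1 k hk l hl
  have g41 : ∀ u < N * m, τ₄.mem 41 u =
      ringPoint e r (ringBase m d r e) fun l => c₂ (u * e + l) := fun u hu => by
    rw [fm, em 41 (by norm_num), dm41, hpt u hu]
  have hval : ∀ i < N, polyVal m d (τ₄.mem 40) (fun j => τ₄.mem 41 (i * m + j)) =
      polyVal m d (fun k => c₁ (k * e + l)) fun j =>
        ringPoint e r (ringBase m d r e) fun l => c₂ ((i * m + j) * e + l) := fun i hi =>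
    polyVal_congr (fun k hk => by rw [fm, e40 k hk]) fun j hj => g41 _ (mul_add_lt_mul hi hj)
  have hcrt := HT.crtProg (V := V) (m := m) (d := d) (N := N) (y := ringRes d r e)
    (Y := ringBase m d r e ^ e) (S := S) (t := ringNum d e) (c := τ₄.mem 40) (p := τ₄.mem 41)
    (mo := ringMod m d r e) (σ := τ₄.view 40) (sub := sub)
    (fun a ha => hB.bodyBounds ha g40 g41 h2) hS0 hsub (by simp [f40]) (by simp [f41])
    (by simp [f42]) (by simp [f43]) (by simp [f44]) rfl rfl
    (fun a ha => by simp [fm, em, dm43, hmo a ha]) (fun a ha => ringMod_coprime hd hr ha) hSV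
    ?_ ?_
  rotate_left
  · refine (Nat.pow_le_pow_left prod_ringMod_le _).trans ?_
    rw [← pow_mul]; exact hB.pow_le (Nat.le_add_right _ _)
  · intro i hi
    rw [hval i hi]
    exact polyVal_ringPoint_lt hd hr he (fun k hk => h1 k hk l hl)
      fun j hj l hl => h2 _ (mul_add_lt_mul hi hj) l hl
  refine HT.seq hcrt.shift ?_
  intro τ₅ hf₅ h42
  have gx : ∀ x < 32, τ₅.reg x = τ₂.reg x := fun x hx => by
    rw [hf₅.reg x (Prog.not_WR_shift (by omega) _), fx x hx]
  have gm4 : τ₅.mem 4 = τ₂.mem 4 := by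
    rw [hf₅.mem 4 (Prog.not_WM_shift (by norm_num) _), fm, em 4 (by norm_num)]
  have hsucc : ∀ i < N, ringValue e r (ringBase m d r e) m d c₁ c₂ i l +
      ringBase m d r e ^ l * τ₅.mem 42 i = ringValue e r (ringBase m d r e) m d c₁ c₂ i (l + 1) := by
    intro i hi
    have := h42 i hi
    rw [hval i hi] at this
    rw [ringValue, ringValue, sum_range_succ, ← this]
    simp
  refine HT.seq (HT.for (s := 1) (fun j τ => (∀ i < j, τ.mem 4 i =
      ringValue e r (ringBase m d r e) m d c₁ c₂ i (l + 1)) ∧ ∀ i, j ≤ i → τ.mem 4 i = τ₂.mem 4 i)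
    hB.hN (by simp) ?_ (by simp [gm4]) ?_ (fun _ _ _ h => h.1)) ?_
  · intro j τ hf _; simp [hf.reg, gx, d2]
  · intro i τ hi hf hr' hJ
    have x14 : τ.reg 14 = ringBase m d r e ^ l := by simp [hf.reg, gx, hI.1]
    have xm : τ.mem 42 = τ₅.mem 42 := by simp [hf.mem]
    have hv : (.read 4 (ρ 32) + ρ 14 * .read 42 (ρ 32) : Exp).val τ =
        ringValue e r (ringBase m d r e) m d c₁ c₂ i (l + 1) := by
      simp only [Exp.val_add, Exp.val_mul, Exp.val_read, Exp.val_reg, hr', x14, xm,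
        hJ.2 i le_rfl, hI.2 i hi]
      exact hsucc i hi
    refine HT.write ?_ ?_
    · rw [hv]
      exact (ringValue_lt hd hr he h1 h2 hi (l + 1) hl).le.trans (hB.pow_le (by omega))
    · rw [hv]
      simp only [State.setReg_mem, State.setMem_mem, Exp.val_reg, hr', true_and]
      refine ⟨fun u hu => ?_, fun u hu => ?_⟩
      · split
        · next h => rw [h]
        · exact hJ.1 u (by omega)
      · rw [if_neg (by omega)]; exact hJ.2 u (by omega)
  intro τ₆ hf₆ h4
  have hv : (ρ 14 * ρ 11 : Exp).val τ₆ = ringBase m d r e ^ (l + 1) := by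
    have x14 : τ₆.reg 14 = ringBase m d r e ^ l := by simp [hf₆.reg, gx, hI.1]
    have x11 : τ₆.reg 11 = ringBase m d r e := by simp [hf₆.reg, gx, d11]
    rw [Exp.val_mul, Exp.val_reg, Exp.val_reg, x14, x11, pow_succ]
  refine HT.assign ?_ ?_
  · rw [hv]; exact hB.pow_le (by omega)
  · rw [hv]
    exact ⟨by simp, fun i hi => by simpa using h4 i hi⟩

theorem hornerStep_lt {E g : ℕ → ℕ} {b k : ℕ} (hr : 0 < r) : hornerStep e r E g b k < r :=
  Nat.mod_lt _ hr

theorem horner_lt {E : ℕ → ℕ} {M D v t k : ℕ} (hr : 0 < r) : horner e r E M D v t k < r := by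
  cases t with
  | zero => exact hr
  | succ t => exact hornerStep_lt hr

theorem HT.ringFinish (hB : RingBounds V m d N r e) (hctx : RingCtx m d N r e c₀ c₁ c₂ σ) :
    HT V ringFinish σ (3 * (e * (d * (m + 1))) + 7 +
      N * (3 * e + 9 + e * (d * (m + 1)) * (4 * e + 7)))
      (fun τ => ∀ i < N, ∀ k < e, τ.mem 3 (i * e + k) = horner e r c₀ (ringBase m d r e)
        (e * (d * (m + 1))) (σ.mem 4 i) (e * (d * (m + 1))) k) := by
  have hd := hB.hd
  have hr := hB.hr
  have he := hB.he
  have hMV := hB.base_le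
  have hM2 := two_le_ringBase (m := m) (e := e) hd hr
  obtain ⟨hdM, hrM, heM⟩ := lt_ringBase (m := m) (e := e) hd hr
  set D := e * (d * (m + 1)) with hD
  set M := ringBase m d r e with hM
  have hMD : M ^ D ≤ V := hB.pow_le (by rw [hD, ringNum]; ring_nf; omega)
  have hDV : D ≤ V := (Nat.lt_pow_self (by omega)).le.trans hMD
  refine HT.mono (n := 1 + ((D * 3 + 3) + (N * (((e * (1 + 2) + 2) + (1 + (D * ((1 + (1 + (1 +
    (e * ((1 + 1) + 2) + 2)))) + 2) + 2))) + 2) + 2)))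
    (R := fun τ => ∀ i < N, ∀ k < e, τ.mem 3 (i * e + k) = horner e r c₀ M D (σ.mem 4 i) D k)
    ?_ (by ring_nf; omega) (fun _ _ h => h)
  have hv16 : (ρ 4 * ρ 9 : Exp).val σ = D := by simp [hctx.r4, hctx.r9, hD]
  refine HT.assign_seq (by rw [hv16]; exact hDV) ?_
  rw [hv16]
  refine HT.seq (HT.pow (b := M) (k := D) (by norm_num) ?_ ?_ hDV (by omega) hMD) ?_
  · intro τ hf; simp [hf.reg, Prog.pow, hctx.r11, hM]
  · intro τ hf; simp [hf.reg, Prog.pow]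
  intro τ₁ hf₁ a17
  have ax : ∀ x < 16, τ₁.reg x = σ.reg x := fun x hx => by
    rw [hf₁.reg x (by simp [Prog.pow]; omega), State.setReg_reg, if_neg (by omega)]
  have a16 : τ₁.reg 16 = D := by simp [hf₁.reg, Prog.pow]
  have am : ∀ A, τ₁.mem A = σ.mem A := fun A => by simp [hf₁.mem, Prog.pow]
  refine HT.for (fun j τ => ∀ i < j, ∀ k < e, τ.mem 3 (i * e + k) =
    horner e r c₀ M D (σ.mem 4 i) D k) hB.hN (by simp) ?_ (by simp) ?_ (fun _ _ _ h => h)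
  · intro j τ hf _; simp [hf.reg, ax, hctx.r2]
  intro i τ₂ hi hf₂ h18 hI
  have d3 : τ₂.reg 3 = r := by simp [hf₂.reg, ax, hctx.r3]
  have d4 : τ₂.reg 4 = e := by simp [hf₂.reg, ax, hctx.r4]
  have d11 : τ₂.reg 11 = M := by simp [hf₂.reg, ax, hctx.r11, hM]
  have d16 : τ₂.reg 16 = D := by simp [hf₂.reg, a16]
  have d17 : τ₂.reg 17 = M ^ D := by simp [hf₂.reg, a17]
  have dm0 : τ₂.mem 0 = c₀ := by simp [hf₂.mem, am, hctx.m0]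
  have dm4 : τ₂.mem 4 = σ.mem 4 := by simp [hf₂.mem, am]
  -- the blocks written before are kept
  have hkeep : ∀ {i' k' k : ℕ}, i' < i → k' < e → i' * e + k' ≠ i * e + k := by
    intro i' k' k hi' hk'
    have := Nat.mul_le_mul_right e (Nat.succ_le_of_lt hi')
    rw [Nat.succ_mul] at this
    omega
  refine HT.seq (HT.for (s := 1) (fun j τ => (∀ k < j, τ.mem 3 (i * e + k) = 0) ∧
    ∀ i' < i, ∀ k < e, τ.mem 3 (i' * e + k) = τ₂.mem 3 (i' * e + k))
    (by omega) (by simp) ?_ (by simp) ?_ (fun _ _ _ h => h)) ?_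
  · intro j τ hf _; simp [hf.reg, d4]
  · intro j τ hj hf h33 hJ
    have x4 : τ.reg 4 = e := by simp [hf.reg, d4]
    have x18 : τ.reg 18 = i := by simp [hf.reg, h18]
    refine HT.write (by simp) ?_
    simp only [State.setReg_mem, State.setMem_mem, Exp.val_reg, Exp.val_add, Exp.val_mul,
      Exp.val_zero, x4, x18, h33, true_and]
    refine ⟨fun k hk => ?_, fun i' hi' k hk => ?_⟩
    · split
      · rfl
      · exact hJ.1 k (by omega)
    · rw [if_neg (hkeep hi' hk)]; exact hJ.2 i' hi' k hk
  intro τ₃ hf₃ h3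
  refine HT.assign_seq ?_ ?_
  · rw [Exp.val_reg, hf₃.reg 17 (by simp), d17]; exact hMD
  set τ₄ := τ₃.setReg 19 ((ρ 17).val τ₃) with hτ₄
  have e19 : τ₄.reg 19 = M ^ D := by simp [hτ₄, hf₃.reg, d17]
  have ex : ∀ x < 19, τ₄.reg x = τ₂.reg x := fun x hx => by
    rw [hτ₄, State.setReg_reg, if_neg (by omega), hf₃.reg x (by simp; omega)]
  have em : ∀ A, A ≠ 3 → τ₄.mem A = τ₂.mem A := fun A hA => hf₃.mem A (by simpa using hA)
  have em3 : τ₄.mem 3 = τ₃.mem 3 := rfl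
  clear_value τ₄
  refine HT.for (fun t τ => τ.reg 19 = M ^ (D - t) ∧
    (∀ k < e, τ.mem 3 (i * e + k) = horner e r c₀ M D (σ.mem 4 i) t k) ∧
    ∀ i' < i, ∀ k < e, τ.mem 3 (i' * e + k) = τ₂.mem 3 (i' * e + k)) hDV (by simp) ?_ ?_ ?_ ?_
  · intro j τ hf _; simp [hf.reg, ex, d16]
  · refine ⟨by simp [e19], fun k hk => ?_, fun i' hi' k hk => ?_⟩
    · simpa [em3, horner] using h3.1 k hk
    · simpa [em3] using h3.2 i' hi' k hk
  · intro t τ₅ ht hf₅ h20 hJ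
    have y3 : τ₅.reg 3 = r := by simp [hf₅.reg, ex, d3]
    have y4 : τ₅.reg 4 = e := by simp [hf₅.reg, ex, d4]
    have y11 : τ₅.reg 11 = M := by simp [hf₅.reg, ex, d11]
    have y18 : τ₅.reg 18 = i := by simp [hf₅.reg, ex, h18]
    have ym0 : τ₅.mem 0 = c₀ := by simp [hf₅.mem, em, dm0]
    have ym4 : τ₅.mem 4 = σ.mem 4 := by simp [hf₅.mem, em, dm4]
    have hdiv : M ^ (D - t) / M = M ^ (D - 1 - t) := by
      rw [show D - t = D - 1 - t + 1 by omega, pow_succ, Nat.mul_div_cancel _ (by omega)]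
    have hle : M ^ (D - 1 - t) ≤ V := (Nat.pow_le_pow_right (by omega) (by omega)).trans hMD
    have hv19 : (ρ 19 / ρ 11 : Exp).val τ₅ = M ^ (D - 1 - t) := by simp [hJ.1, y11, hdiv]
    refine HT.assign_seq (by rw [hv19]; exact hle) ?_
    rw [hv19]
    set b := σ.mem 4 i / M ^ (D - 1 - t) % M with hb
    have hbM : b < M := Nat.mod_lt _ (by omega)
    have hv21 : (.read 4 (ρ 18) / ρ 19 % ρ 11 : Exp).val (τ₅.setReg 19 (M ^ (D - 1 - t))) = b := by
      simp [y11, y18, ym4, hb]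
    refine HT.assign_seq (by rw [hv21]; omega) ?_
    rw [hv21]
    set g := horner e r c₀ M D (σ.mem 4 i) t with hg
    have hv22 : (.read 3 (ρ 18 * ρ 4 + (ρ 4 - 1)) : Exp).val
        ((τ₅.setReg 19 (M ^ (D - 1 - t))).setReg 21 b) = g (e - 1) := by
      simp [y4, y18, hJ.2.1 (e - 1) (by omega)]
    have hgr : g (e - 1) < r := horner_lt (by omega)
    refine HT.assign_seq (by rw [hv22]; omega) ?_
    rw [hv22]
    set τ₆ := ((τ₅.setReg 19 (M ^ (D - 1 - t))).setReg 21 b).setReg 22 (g (e - 1)) with hτ₆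
    have z19 : τ₆.reg 19 = M ^ (D - 1 - t) := by simp [hτ₆]
    have z21 : τ₆.reg 21 = b := by simp [hτ₆]
    have z22 : τ₆.reg 22 = g (e - 1) := by simp [hτ₆]
    have zx : ∀ x < 19, τ₆.reg x = τ₅.reg x := fun x hx => by
      rw [hτ₆]; simp [show x ≠ 19 by omega, show x ≠ 21 by omega, show x ≠ 22 by omega]
    have zm : τ₆.mem = τ₅.mem := rfl
    clear_value τ₆
    refine HT.for (fun j τ =>
      (∀ k < e, e - j ≤ k → τ.mem 3 (i * e + k) = hornerStep e r c₀ g b k) ∧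
      (∀ k < e - j, τ.mem 3 (i * e + k) = g k) ∧
      ∀ i' < i, ∀ k < e, τ.mem 3 (i' * e + k) = τ₂.mem 3 (i' * e + k))
      (by omega) (by simp) ?_ ?_ ?_ ?_
    · intro j τ hf _; simp [hf.reg, zx, y4]
    · refine ⟨fun k hk hk' => by omega, fun k hk => ?_, fun i' hi' k hk => ?_⟩
      · simpa [zm] using hJ.2.1 k (by omega)
      · simpa [zm] using hJ.2.2 i' hi' k hk
    · intro j τ₇ hj hf₇ h33 hK
      have u3 : τ₇.reg 3 = r := by simp [hf₇.reg, zx, y3]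
      have u4 : τ₇.reg 4 = e := by simp [hf₇.reg, zx, y4]
      have u18 : τ₇.reg 18 = i := by simp [hf₇.reg, zx, y18]
      have u21 : τ₇.reg 21 = b := by simp [hf₇.reg, z21]
      have u22 : τ₇.reg 22 = g (e - 1) := by simp [hf₇.reg, z22]
      have um0 : τ₇.mem 0 = c₀ := by simp [hf₇.mem, zm, ym0]
      obtain ⟨k, hk⟩ : ∃ k, k = e - 1 - j := ⟨_, rfl⟩
      have hv23 : (ρ 4 - 1 - ρ 33 : Exp).val τ₇ = k := by simp [u4, h33, hk]
      refine HT.assign_seq (by rw [hv23]; omega) ?_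
      rw [hv23]
      have hv : (((ρ 23).eq 0 * ρ 21 + Exp.lt 0 (ρ 23) * .read 3 (ρ 18 * ρ 4 + (ρ 23 - 1)) +
          (ρ 3 - ρ 22) * .read 0 (ρ 23)) % ρ 3 : Exp).val (τ₇.setReg 23 k) =
          hornerStep e r c₀ g b k := by
        rcases Nat.eq_zero_or_pos k with h0 | h0
        · simp [u3, u21, u22, um0, h0, hornerStep]
        · have := hK.2.1 (k - 1) (by omega)
          simp [u3, u4, u18, u21, u22, um0, h0, h0.ne', hornerStep, this]
      have hlt : hornerStep e r c₀ g b k < r := hornerStep_lt (by omega)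
      have hvi : (ρ 18 * ρ 4 + ρ 23 : Exp).val (τ₇.setReg 23 k) = i * e + k := by simp [u4, u18]
      refine HT.write (by rw [hv]; omega) ?_
      rw [hv, hvi]
      simp only [State.setReg_mem, State.setMem_mem, true_and]
      refine ⟨fun k' hk' hjk => ?_, fun k' hk' => ?_, fun i' hi' k' hk' => ?_⟩
      · rcases eq_or_ne k' k with rfl | hne
        · simp
        · rw [if_neg (by omega)]; exact hK.1 k' hk' (by omega)
      · rw [if_neg (by omega)]; exact hK.2.1 k' (by omega)
      · rw [if_neg (hkeep hi' hk')]; exact hK.2.2 i' hi' k' hk'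
    · intro τ₇ hf₇ _ hK
      refine ⟨?_, fun k hk => ?_, fun i' hi' k hk => ?_⟩
      · simp [hf₇.reg, z19, show D - 1 - t = D - (t + 1) by omega]
      · simpa [horner, hornerStep] using hK.1 k hk (by omega)
      · simpa using hK.2.2 i' hi' k hk
  · intro τ₅ hf₅ _ hJ i' hi' k hk
    simp only [State.setReg_mem]
    rcases Nat.lt_succ_iff_lt_or_eq.1 hi' with h | rfl
    · rw [hJ.2.2 i' h k hk, hI i' h k hk]
    · exact hJ.2.1 k hk

end MME

namespace MME

open Finset

variable {V m d N r e : ℕ} {σ : State}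

theorem HT.ringProg {S ℓ : ℕ} (hB : RingBounds V m d N r e)
    (h0 : σ.reg 0 = m) (h1 : σ.reg 1 = d) (h2 : σ.reg 2 = N) (h3 : σ.reg 3 = r) (h4 : σ.reg 4 = e)
    (hc : ∀ k < d ^ m, ∀ l < e, σ.mem 1 (k * e + l) < r)
    (hp : ∀ u < N * m, ∀ l < e, σ.mem 2 (u * e + l) < r)
    (hsub : EvalSpec V (levelProg ℓ) m d N (ringRes d r e) S) :
    HT V (ringProg ℓ) σ (3 * m + 3 * ringNum d e + 3 * (d * (m + 1)) + 3 * e + 18 +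
      (3 * ringNum d e + N * m * (3 * e + 6) + 4 + (3 * N + 5 + e * (3 * d ^ m + 3 * N + 12 +
      (ringNum d e + 1) *
        (2 ^ (2 * m + 1) * (S + 50 * (m + 1) * (N + d ^ m + 1) + 16 * V.size))) +
      (3 * (e * (d * (m + 1))) + 7 + N * (3 * e + 9 + e * (d * (m + 1)) * (4 * e + 7))))))
      (fun τ => ∀ i < N, ∀ k < e, τ.mem 3 (i * e + k) =
        horner e r (σ.mem 0) (ringBase m d r e) (e * (d * (m + 1)))
          (ringValue e r (ringBase m d r e) m d (σ.mem 1) (σ.mem 2) i e) (e * (d * (m + 1))) k) := by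
  refine HT.seq (HT.ringSetup hB h0 h1 h2 h3 h4) ?_
  intro τ _ c
  refine HT.seq (HT.ringArrays hB c hp) ?_
  intro τ₁ hf₁ ⟨hmo, hpt⟩
  have c' := c.of_frame hf₁ (fun x hx => by simp [MME.ringArrays]; omega)
    (fun x hx => by simp [MME.ringArrays]; omega)
  refine HT.seq (HT.ringMain hB c' hc hp hmo hpt hsub) ?_
  intro τ₂ hf₂ h4
  have c'' := c'.of_frame hf₂
    (fun x hx => by simp [MME.ringMain, Prog.not_WR_shift (show x < 40 by omega)]; omega)
    (fun x hx => by simp [MME.ringMain, Prog.not_WM_shift (show x < 40 by omega)]; omega)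
  refine (HT.ringFinish hB c'').mono le_rfl ?_
  intro τ₃ _ h i hi k hk
  rw [h i hi k hk, h4 i hi]

/-! ### Arithmetic in the extension ring -/

section Algebra

open Polynomial

/-- The polynomial with natural number coefficients whose value at an integer is computed: the
coefficients and the coordinates, given in blocks of `e` cells, are read as polynomials in `z`. -/
noncomputable def ringPoly (e r m d : ℕ) (c p : ℕ → ℕ) (i : ℕ) : ℕ[X] :=
  ∑ k ∈ range (d ^ m), (∑ l ∈ range e, C (c (k * e + l)) * X ^ l) *
    ∏ j ∈ range m, (C r + ∑ l ∈ range e, C (p ((i * m + j) * e + l)) * X ^ l) ^ (k / d ^ j % d)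

theorem eval_ringPoly (e r m d : ℕ) (c p : ℕ → ℕ) (i M : ℕ) :
    (ringPoly e r m d c p i).eval M = ringValue e r M m d c p i e := by
  simp only [ringPoly, ringValue, polyVal, ringPoint, eval_finsetSum, eval_mul, eval_prod, eval_pow,
    eval_add, eval_C, eval_X, mul_sum, sum_mul]
  rw [sum_comm]
  exact sum_congr rfl fun l _ => sum_congr rfl fun k _ => by ring

theorem natDegree_ringPoly_lt {e r m d : ℕ} (he : 1 ≤ e) (hd : 2 ≤ d) (c p : ℕ → ℕ) (i : ℕ) :
    (ringPoly e r m d c p i).natDegree < e * (d * (m + 1)) := by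
  have h1 : ∀ g : ℕ → ℕ, (∑ l ∈ range e, C (g l) * X ^ l : ℕ[X]).natDegree ≤ e - 1 := fun g =>
    natDegree_sum_le_of_forall_le _ _ fun l hl =>
      (natDegree_C_mul_X_pow_le _ _).trans (by have := mem_range.1 hl; omega)
  have h2 : (ringPoly e r m d c p i).natDegree ≤ (e - 1) + m * (d * (e - 1)) := by
    refine natDegree_sum_le_of_forall_le _ _ fun k _ => ?_
    refine natDegree_mul_le.trans (Nat.add_le_add (h1 _) ?_)
    refine (natDegree_prod_le _ _).trans ((sum_le_card_nsmul _ _ (d * (e - 1)) fun j _ => ?_).trans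
      (by simp))
    refine natDegree_pow_le.trans (Nat.mul_le_mul (Nat.mod_lt _ (by omega)).le ?_)
    exact natDegree_add_le_of_degree_le (by simp) (h1 _)
  obtain ⟨e, rfl⟩ : ∃ e', e = e' + 1 := ⟨e - 1, by omega⟩
  have h3 : 1 * (m + 1) ≤ d * (m + 1) := Nat.mul_le_mul_right _ (by omega)
  have h4 : e * 1 ≤ e * d := Nat.mul_le_mul_left _ (by omega)
  calc _ ≤ e + m * (d * e) := by simpa using h2
    _ < (e + 1) * (d * (m + 1)) := by nlinarith

theorem coeff_le_eval_one (F : ℕ[X]) (l : ℕ) : F.coeff l ≤ F.eval 1 := by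
  rw [eval_eq_sum_range]
  simp only [one_pow, mul_one]
  by_cases hl : l ∈ range (F.natDegree + 1)
  · exact single_le_sum (f := F.coeff) (fun _ _ => Nat.zero_le _) hl
  · rw [coeff_eq_zero_of_natDegree_lt (by simpa using hl)]; exact Nat.zero_le _

theorem coeff_ringPoly_lt {e r m d : ℕ} (hd : 2 ≤ d) (hr : 2 ≤ r) {c p : ℕ → ℕ} {i N : ℕ}
    (hi : i < N) (hc : ∀ k < d ^ m, ∀ l < e, c (k * e + l) < r)
    (hp : ∀ u < N * m, ∀ l < e, p (u * e + l) < r) (l : ℕ) :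
    (ringPoly e r m d c p i).coeff l < ringBase m d r e := by
  refine (coeff_le_eval_one _ l).trans_lt (lt_of_le_of_lt ?_ ringBound_lt_ringBase)
  rw [show (1 : ℕ) = ((1 : ℕ) : ℕ) from rfl, eval_ringPoly]
  have hy : 1 ≤ (e + 1) * r := Nat.mul_pos (by omega) (by omega)
  have h1 : ringValue e r 1 m d c p i e ≤
      ∑ l ∈ range e, r * (d * ((e + 1) * r) ^ d) ^ m := by
    refine sum_le_sum fun l hl => ?_
    rw [one_pow, one_mul]
    refine polyVal_le (by omega) hy (fun k hk => (hc k hk l (mem_range.1 hl)).le) fun j hj => ?_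
    have : ∑ l ∈ range e, p ((i * m + j) * e + l) * 1 ^ l ≤ ∑ l ∈ range e, r :=
      sum_le_sum fun l hl => by
        rw [one_pow, mul_one]
        exact (hp _ (mul_add_lt_mul hi hj) l (mem_range.1 hl)).le
    rw [sum_const, card_range, smul_eq_mul] at this
    have h2 : (e + 1) * r = e * r + r := by ring
    rw [ringPoint]
    omega
  refine h1.trans ?_
  rw [sum_const, card_range, smul_eq_mul, ← mul_assoc, ringBound, pow_mul, pow_succ' _ m]
  refine Nat.mul_le_mul ?_ (Nat.pow_le_pow_left ?_ _)
  · calc e * r ≤ d * (e + 1) * r := Nat.mul_le_mul_right _ (by nlinarith)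
      _ ≤ (d * (e + 1) * r) ^ d := Nat.le_self_pow (by omega) _
  · rw [mul_assoc, mul_pow d]
    exact Nat.mul_le_mul_right _ (Nat.le_self_pow (by omega : d ≠ 0) _)

/-- Kronecker substitution: the coefficients are the digits of the value in a large base. -/
theorem eval_div_pow_mod {M : ℕ} (F : ℕ[X]) (hF : ∀ l, F.coeff l < M) (l : ℕ) :
    F.eval M / M ^ l % M = F.coeff l := by
  have hM : 0 < M := (Nat.zero_le _).trans_lt (hF 0)
  have key : ∀ F : ℕ[X], (∀ l, F.coeff l < M) → F.eval M = F.divX.eval M * M + F.coeff 0 := by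
    intro F _
    conv_lhs => rw [← divX_mul_X_add F]
    simp
  induction l generalizing F with
  | zero =>
    rw [key F hF, pow_zero, Nat.div_one, Nat.mul_add_mod', Nat.mod_eq_of_lt (hF 0)]
  | succ l ih =>
    rw [pow_succ', ← Nat.div_div_eq_div_mul, key F hF, Nat.mul_comm, Nat.mul_add_div hM,
      Nat.div_eq_of_lt (hF 0), add_zero, ih _ fun l => by simpa using hF (l + 1)]
    simp

variable {E : (ZMod r)[X]}

/-- The element of the extension ring with the given coefficients. -/
noncomputable def ringElem (E : (ZMod r)[X]) (g : ℕ → ℕ) : AdjoinRoot E :=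
  ∑ k ∈ range E.natDegree, (g k : AdjoinRoot E) * AdjoinRoot.root E ^ k

theorem ringElem_eq_mk (g : ℕ → ℕ) : ringElem E g =
    AdjoinRoot.mk E (∑ k ∈ range E.natDegree, C (g k : ZMod r) * X ^ k) := by
  simp [ringElem, map_sum]

theorem ringElem_digit (hE : E.Monic) (hr : 2 ≤ r) (x : AdjoinRoot E) :
    ringElem E (digit hE x) = x := by
  have : NeZero r := ⟨by omega⟩
  have : Fact (1 < r) := ⟨by omega⟩
  rw [ringElem_eq_mk]
  conv_rhs => rw [← AdjoinRoot.mk_leftInverse hE x]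
  congr 1
  simp only [digit, ZMod.natCast_val, ZMod.cast_id', id_eq]
  set p := AdjoinRoot.modByMonicHom hE x with hp
  have hdeg : p.degree < E.degree := by
    obtain ⟨q, rfl⟩ := AdjoinRoot.mk_surjective x
    rw [hp, AdjoinRoot.modByMonicHom_mk]
    exact degree_modByMonic_lt q hE
  have hdeg' : p.degree < E.natDegree := by rwa [← degree_eq_natDegree hE.ne_zero]
  ext k
  simp only [finsetSum_coeff, coeff_C_mul, coeff_X_pow, mul_ite, mul_one, mul_zero, sum_ite_eq,
    mem_range]
  split
  · rfl
  · next h => exact (coeff_eq_zero_of_degree_lt (hdeg'.trans_le (by exact_mod_cast not_lt.1 h))).symm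

theorem digit_ringElem (hE : E.Monic) (hr : 2 ≤ r) {g : ℕ → ℕ} (hg : ∀ k < E.natDegree, g k < r)
    {k : ℕ} (hk : k < E.natDegree) : digit hE (ringElem E g) k = g k := by
  have : NeZero r := ⟨by omega⟩
  have : Fact (1 < r) := ⟨by omega⟩
  rw [digit, ringElem_eq_mk, AdjoinRoot.modByMonicHom_mk, (modByMonic_eq_self_iff hE).2]
  · simp [coeff_X_pow, hk, ZMod.val_natCast, Nat.mod_eq_of_lt (hg k hk)]
  · rw [degree_eq_natDegree hE.ne_zero, degree_lt_iff_coeff_zero]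
    intro j hj
    simp [coeff_X_pow, hj]

theorem digit_lt (hE : E.Monic) (hr : 2 ≤ r) (x : AdjoinRoot E) (k : ℕ) : digit hE x k < r := by
  have : NeZero r := ⟨by omega⟩
  exact ZMod.val_lt _

theorem natCast_self_eq_zero : ((r : ℕ) : AdjoinRoot E) = 0 := by
  rw [← map_natCast (AdjoinRoot.of E), ZMod.natCast_self, map_zero]

theorem root_pow_natDegree (hE : E.Monic) (hr : 2 ≤ r) : AdjoinRoot.root E ^ E.natDegree =
    - ringElem E (fun k => (E.coeff k).val) := by
  have : NeZero r := ⟨by omega⟩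
  have h := congrArg (AdjoinRoot.mk E) hE.as_sum
  rw [AdjoinRoot.mk_self, map_add, eq_comm, ← eq_neg_iff_add_eq_zero] at h
  rw [ringElem_eq_mk]
  simpa using h

theorem ringElem_hornerStep (hE : E.Monic) (hr : 2 ≤ r) (he : 1 ≤ E.natDegree) {c₀ g : ℕ → ℕ}
    (hc : ∀ k < E.natDegree, c₀ k = (E.coeff k).val) (hg : g (E.natDegree - 1) ≤ r) (b : ℕ) :
    ringElem E (hornerStep E.natDegree r c₀ g b) = AdjoinRoot.root E * ringElem E g + b := by
  have hmod : ∀ x : ℕ, ((x % r : ℕ) : AdjoinRoot E) = x := fun x => by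
    conv_rhs => rw [← Nat.div_add_mod x r]
    rw [Nat.cast_add, Nat.cast_mul, natCast_self_eq_zero, zero_mul, zero_add]
  have h1 : ringElem E (hornerStep E.natDegree r c₀ g b) =
      ∑ k ∈ range E.natDegree, ((if k = 0 then b else g (k - 1) : ℕ) : AdjoinRoot E) *
        AdjoinRoot.root E ^ k - g (E.natDegree - 1) * ringElem E (fun k => (E.coeff k).val) := by
    simp only [ringElem]
    rw [mul_sum, ← sum_sub_distrib]
    refine sum_congr rfl fun k hk => ?_
    rw [hornerStep, hmod, Nat.cast_add, Nat.cast_mul, Nat.cast_sub hg, natCast_self_eq_zero,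
      hc k (mem_range.1 hk)]
    ring
  have h2 := root_pow_natDegree hE hr
  rw [h1, ← neg_eq_iff_eq_neg.2 h2]
  obtain ⟨n, hn⟩ : ∃ n, E.natDegree = n + 1 := ⟨E.natDegree - 1, by omega⟩
  simp only [ringElem, hn]
  rw [sum_range_succ', sum_range_succ]
  simp only [Nat.add_sub_cancel, if_true, if_neg (Nat.succ_ne_zero _), pow_zero, mul_one, mul_add,
    mul_sum]
  rw [sum_congr rfl fun k _ => show (g k : AdjoinRoot E) * AdjoinRoot.root E ^ (k + 1) =
    AdjoinRoot.root E * (g k * AdjoinRoot.root E ^ k) by ring]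
  ring

/-- After `t` steps Horner's rule has combined the leading `t` digits, from the top one downwards. -/
theorem ringElem_horner (hE : E.Monic) (hr : 2 ≤ r) (he : 1 ≤ E.natDegree) {c₀ : ℕ → ℕ}
    (hc : ∀ k < E.natDegree, c₀ k = (E.coeff k).val) (M D v t : ℕ) (ht : t ≤ D) :
    ringElem E (horner E.natDegree r c₀ M D v t) =
      ∑ l ∈ range t, ((v / M ^ (D - t + l) % M : ℕ) : AdjoinRoot E) * AdjoinRoot.root E ^ l := by
  induction t with
  | zero => simp [horner, ringElem]
  | succ t ih =>
    rw [horner, ringElem_hornerStep hE hr he hc (horner_lt (by omega)).le, ih (by omega),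
      sum_range_succ', mul_sum, pow_zero, mul_one, add_zero, Nat.sub_sub, Nat.add_comm 1 t]
    congr 1
    refine sum_congr rfl fun l _ => ?_
    rw [show D - (t + 1) + (l + 1) = D - t + l by omega]
    ring

/-- The exponent vector with index `k`. -/
noncomputable def expVec (m d k : ℕ) : Fin m →₀ ℕ :=
  Finsupp.equivFunOnFinite.symm fun i : Fin m => k / d ^ (i : ℕ) % d

theorem eval_eq_sum_expVec {R : Type*} [CommRing R] {m d : ℕ} (f : MvPolynomial (Fin m) R)
    (hf : ∀ j, f.degreeOf j < d) (x : Fin m → R) :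
    MvPolynomial.eval x f = ∑ k ∈ range (d ^ m), f.coeff (expVec m d k) *
      ∏ j : Fin m, x j ^ (k / d ^ (j : ℕ) % d) := by
  have hsurj : ∀ s : Fin m →₀ ℕ, (∀ j, s j < d) → ∃ k ∈ range (d ^ m), expVec m d k = s := by
    intro s hs
    refine ⟨finFunctionFinEquiv fun j => ⟨s j, hs j⟩, mem_range.2 (Fin.is_lt _), ?_⟩
    ext j
    have := congrArg Fin.val (congrFun (finFunctionFinEquiv.symm_apply_apply
      fun j => (⟨s j, hs j⟩ : Fin d)) j)
    rw [finFunctionFinEquiv_symm_apply_val] at this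
    exact this
  have hinj : Set.InjOn (expVec m d) (range (d ^ m)) := by
    intro k hk k' hk' h
    have hk := mem_range.1 hk
    have hk' := mem_range.1 hk'
    have : (⟨k, hk⟩ : Fin (d ^ m)) = ⟨k', hk'⟩ := by
      refine finFunctionFinEquiv.symm.injective (funext fun j => Fin.ext ?_)
      simpa [expVec] using DFunLike.congr_fun h j
    exact congrArg Fin.val this
  rw [MvPolynomial.eval_eq']
  rw [sum_subset (s₂ := (range (d ^ m)).image (expVec m d))]
  · rw [sum_image hinj]
    exact sum_congr rfl fun k _ => by simp [expVec]
  · intro s hs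
    rw [mem_image]
    refine hsurj s fun j => ?_
    exact (MvPolynomial.monomial_le_degreeOf j hs).trans_lt (hf j)
  · intro s _ hs
    rw [MvPolynomial.notMem_support_iff.1 hs, zero_mul]

theorem aeval_ringPoly {m d : ℕ} {c p : ℕ → ℕ} {i : ℕ} (f : MvPolynomial (Fin m) (AdjoinRoot E))
    (hf : ∀ j, f.degreeOf j < d) (a : Fin m → AdjoinRoot E)
    (hc : ∀ k < d ^ m, ringElem E (fun l => c (k * E.natDegree + l)) = f.coeff (expVec m d k))
    (hp : ∀ j : Fin m, ringElem E (fun l => p ((i * m + j) * E.natDegree + l)) = a j) :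
    aeval (AdjoinRoot.root E) (ringPoly E.natDegree r m d c p i) = MvPolynomial.eval a f := by
  rw [eval_eq_sum_expVec f hf, ringPoly, map_sum]
  refine sum_congr rfl fun k hk => ?_
  rw [← hc k (mem_range.1 hk), map_mul, map_prod, prod_range]
  congr 1
  · simp [ringElem, map_sum]
  · refine prod_congr rfl fun j _ => ?_
    rw [← hp j]
    simp [ringElem, map_sum, natCast_self_eq_zero]

/-- The digits in base `M` of the integer value, combined modulo `E`, give the value of the polynomial
over the extension ring: the integer `M` is so large that the digits are the coefficients of
`ringPoly`, which maps to the value when `z` is specialized. -/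
theorem horner_ringValue (hE : E.Monic) (hr : 2 ≤ r) (he : 1 ≤ E.natDegree) {m d N : ℕ} (hd : 2 ≤ d)
    {c₀ c p : ℕ → ℕ} (hc₀ : ∀ k < E.natDegree, c₀ k = (E.coeff k).val)
    (f : MvPolynomial (Fin m) (AdjoinRoot E)) (hf : ∀ j, f.degreeOf j < d)
    (a : Fin N → Fin m → AdjoinRoot E)
    (hc : ∀ k < d ^ m, ∀ l < E.natDegree,
      c (k * E.natDegree + l) = digit hE (f.coeff (expVec m d k)) l)
    (hp : ∀ (i : Fin N) (j : Fin m), ∀ l < E.natDegree,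
      p ((i * m + j) * E.natDegree + l) = digit hE (a i j) l) (i : Fin N) {k : ℕ}
    (hk : k < E.natDegree) :
    horner E.natDegree r c₀ (ringBase m d r E.natDegree) (E.natDegree * (d * (m + 1)))
      (ringValue E.natDegree r (ringBase m d r E.natDegree) m d c p i E.natDegree)
      (E.natDegree * (d * (m + 1))) k = digit hE (MvPolynomial.eval (a i) f) k := by
  have hcongr : ∀ {g g' : ℕ → ℕ}, (∀ l < E.natDegree, g l = g' l) → ringElem E g = ringElem E g' :=
    fun h => sum_congr rfl fun l hl => by rw [h l (mem_range.1 hl)]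
  have hcr : ∀ k < d ^ m, ∀ l < E.natDegree, c (k * E.natDegree + l) < r := fun k hk l hl => by
    rw [hc k hk l hl]; exact digit_lt hE hr _ _
  have hpr : ∀ u < N * m, ∀ l < E.natDegree, p (u * E.natDegree + l) < r := fun u hu l hl => by
    have hm : 0 < m := Nat.pos_of_ne_zero fun h => by simp [h] at hu
    have := hp ⟨u / m, Nat.div_lt_of_lt_mul (by rwa [mul_comm])⟩ ⟨u % m, Nat.mod_lt _ hm⟩ l hl
    simp only [Nat.div_add_mod'] at this
    rw [this]; exact digit_lt hE hr _ _
  rw [← aeval_ringPoly (c := c) (p := p) (i := i) f hf (a i)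
    (fun k hk => (hcongr (hc k hk)).trans (ringElem_digit hE hr _))
    (fun j => (hcongr (hp i j)).trans (ringElem_digit hE hr _))]
  rw [← digit_ringElem hE hr (g := horner E.natDegree r c₀ _ _ _ _)
    (fun k _ => horner_lt (by omega)) hk, ringElem_horner hE hr he hc₀ _ _ _ _ le_rfl]
  congr 1
  rw [aeval_eq_sum_range' (natDegree_ringPoly_lt he hd c p i)]
  refine sum_congr rfl fun l _ => ?_
  rw [← eval_ringPoly, Nat.sub_self, zero_add,
    eval_div_pow_mod _ (coeff_ringPoly_lt hd hr i.2 hcr hpr), nsmul_eq_mul]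

theorem natCard_adjoinRoot (hE : E.Monic) : Nat.card (AdjoinRoot E) = r ^ E.natDegree := by
  rw [Nat.card_congr (AdjoinRoot.powerBasis' hE).basis.equivFun.toEquiv, Nat.card_fun]
  simp [AdjoinRoot.powerBasis'_dim]

end Algebra

end MME

namespace MME

open Finset Polynomial

/-! ### The program on the given input -/

/-- The number of steps of `ringProg ℓ`, when the recursion takes `S` steps. -/
def ringCost (V m d N e S : ℕ) : ℕ :=
  3 * m + 3 * ringNum d e + 3 * (d * (m + 1)) + 3 * e + 18 +
      (3 * ringNum d e + N * m * (3 * e + 6) + 4 + (3 * N + 5 + e * (3 * d ^ m + 3 * N + 12 +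
      (ringNum d e + 1) *
        (2 ^ (2 * m + 1) * (S + 50 * (m + 1) * (N + d ^ m + 1) + 16 * V.size))) +
      (3 * (e * (d * (m + 1))) + 7 + N * (3 * e + 9 + e * (d * (m + 1)) * (4 * e + 7)))))

variable {r : ℕ} {E : (ZMod r)[X]} {m d N : ℕ}

theorem inputState_mem_lt (hE : E.Monic) (hr : 2 ≤ r) (f : MvPolynomial (Fin m) (AdjoinRoot E))
    (a : Fin N → Fin m → AdjoinRoot E) (A n : ℕ) : (inputState hE m d N f a).mem A n < r := by
  have : NeZero r := ⟨by omega⟩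
  match A with
  | 0 => simp only [inputState]; split; exacts [ZMod.val_lt _, by omega]
  | 1 => simp only [inputState]; split; exacts [digit_lt hE hr _ _, by omega]
  | 2 => simp only [inputState]; split; exacts [digit_lt hE hr _ _, by omega]
  | A + 3 => simp only [inputState]; omega

theorem inputState_bdd {V : ℕ} (hE : E.Monic) (f : MvPolynomial (Fin m) (AdjoinRoot E))
    (a : Fin N → Fin m → AdjoinRoot E) (hB : RingBounds V m d N r E.natDegree) :
    (inputState hE m d N f a).Bdd V := by
  have hM := hB.base_le
  obtain ⟨h1, h2, h3⟩ := lt_ringBase (m := m) (e := E.natDegree) hB.hd hB.hr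
  have hm : m ≤ V := by
    have h4 := (le_ringRes (e := E.natDegree) hB.hd hB.hr).2
    have h5 : 2 ^ (2 * m + 1) ≤ V := (Nat.pow_le_pow_left h4 _).trans hB.hy
    have := (Nat.lt_two_pow_self (n := 2 * m + 1)).le.trans h5
    omega
  have hN := hB.hN
  refine ⟨fun x => ?_, fun A n => (inputState_mem_lt hE hB.hr f a A n).le.trans (by omega)⟩
  match x with
  | 0 => exact hm
  | 1 => simp only [inputState]; omega
  | 2 => exact hN
  | 3 => simp only [inputState]; omega
  | 4 => simp only [inputState]; omega
  | x + 5 => exact Nat.zero_le _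

theorem inputState_coeff (hE : E.Monic) (f : MvPolynomial (Fin m) (AdjoinRoot E))
    (a : Fin N → Fin m → AdjoinRoot E) {k l : ℕ} (hk : k < d ^ m) (hl : l < E.natDegree) :
    (inputState hE m d N f a).mem 1 (k * E.natDegree + l) =
      digit hE (f.coeff (expVec m d k)) l := by
  have h1 : (k * E.natDegree + l) / E.natDegree = k := by
    rw [mul_comm, Nat.mul_add_div (by omega), Nat.div_eq_of_lt hl, add_zero]
  have h2 : (k * E.natDegree + l) % E.natDegree = l := by
    rw [Nat.mul_add_mod', Nat.mod_eq_of_lt hl]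
  simp only [inputState, h1, h2, if_pos hk, expVec]

theorem inputState_point (hE : E.Monic) (f : MvPolynomial (Fin m) (AdjoinRoot E))
    (a : Fin N → Fin m → AdjoinRoot E) (i : Fin N) (j : Fin m) {l : ℕ} (hl : l < E.natDegree) :
    (inputState hE m d N f a).mem 2 ((i * m + j) * E.natDegree + l) = digit hE (a i j) l := by
  have h1 : ((i * m + j) * E.natDegree + l) / E.natDegree = i * m + j := by
    rw [mul_comm, Nat.mul_add_div (by omega), Nat.div_eq_of_lt hl, add_zero]
  have h2 : ((i * m + j) * E.natDegree + l) % E.natDegree = l := by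
    rw [Nat.mul_add_mod', Nat.mod_eq_of_lt hl]
  have h3 : ((i : ℕ) * m + j) / m = i := by
    rw [mul_comm, Nat.mul_add_div (by omega), Nat.div_eq_of_lt j.2, add_zero]
  have h4 : ((i : ℕ) * m + j) % m = j := by
    rw [Nat.mul_add_mod', Nat.mod_eq_of_lt j.2]
  simp only [inputState, h1, h2, h3, h4]
  rw [dif_pos ⟨i.2, j.2⟩]

/-- The program computes the values of the polynomial, and its running time is at most the number of
steps, times the square of the bit length of the numbers that occur, up to a constant. -/
theorem ringProg_exec {V S ℓ : ℕ} (hE : E.Monic) (hB : RingBounds V m d N r E.natDegree)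
    (hsub : EvalSpec V (levelProg ℓ) m d N (ringRes d r E.natDegree) S)
    (f : MvPolynomial (Fin m) (AdjoinRoot E)) (a : Fin N → Fin m → AdjoinRoot E)
    (hf : ∀ j, f.degreeOf j < d) {T : ℝ}
    (hT : ((ringCost V m d N E.natDegree S * ((ringProg ℓ).costFactor * V.size ^ 2) : ℕ) : ℝ) ≤ T) :
    EvaluatesWithin (ringProg ℓ) hE m d N f a T := by
  have hV : 1 ≤ V :=
    (one_le_two.trans (two_le_ringBase hB.hd hB.hr)).trans hB.base_le
  obtain ⟨τ, k, hr, hk, hτ⟩ := HT.ringProg (σ := inputState hE m d N f a) hB rfl rfl rfl rfl rfl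
    (fun k _ l _ => inputState_mem_lt hE hB.hr f a _ _)
    (fun k _ l _ => inputState_mem_lt hE hB.hr f a _ _) hsub
  obtain ⟨-, t, ht, htk⟩ := hr.exec hV (inputState_bdd hE f a hB)
  refine ⟨τ, t, ht, le_trans ?_ hT, fun i k hk => ?_⟩
  · exact_mod_cast htk.trans (Nat.mul_le_mul_right _ hk)
  · rw [hτ i i.2 k hk]
    exact horner_ringValue hE hB.hr hB.he hB.hd
      (fun k hk => by simp only [inputState]; rw [if_pos hk]) f hf a
      (fun k hk l hl => inputState_coeff hE f a hk hl)
      (fun i j l hl => inputState_point hE f a i j hl) i hk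

end MME

namespace MME

open Finset

/-! ### Sizes of the moduli -/

/-- Chebyshev's lower bound, with a constant factor that makes it hold from the start. -/
theorem exists_two_pow_le_primorial : ∃ K : ℕ, 2 ≤ K ∧ ∀ n, 1 ≤ n → 2 ^ n ≤ primorial (K * n) := by
  have h1 : Filter.Tendsto (fun n : ℕ => Real.log ((n : ℝ) + 1) / ((n : ℝ) + 1)) Filter.atTop
      (nhds 0) :=
    Real.isLittleO_log_id_atTop.tendsto_div_nhds_zero.comp
      (Filter.tendsto_atTop_add_const_right _ 1 tendsto_natCast_atTop_atTop)
  have h2 : Filter.Tendsto (fun n : ℕ => Real.log n / (n : ℝ) ^ (1 / 2 : ℝ)) Filter.atTop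
      (nhds 0) :=
    (isLittleO_log_rpow_atTop (by norm_num)).tendsto_div_nhds_zero.comp tendsto_natCast_atTop_atTop
  have hl := Real.log_pos one_lt_two
  obtain ⟨n₀, hn₀⟩ := Filter.eventually_atTop.1
    (((h1.eventually (gt_mem_nhds (show 0 < Real.log 2 / 8 by positivity))).and
      (h2.eventually (gt_mem_nhds (show 0 < Real.log 2 / 8 by positivity)))).and
      (Filter.eventually_ge_atTop 1))
  refine ⟨n₀ + 2, by omega, fun n hn => ?_⟩
  have hx : n₀ ≤ (n₀ + 2) * n := by nlinarith
  obtain ⟨⟨a1, a2⟩, a3⟩ := hn₀ _ hx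
  have h3 := Chebyshev.theta_ge ((n₀ + 2) * n)
  rw [Chebyshev.theta_eq_log_primorial, Nat.floor_natCast] at h3
  set x := (n₀ + 2) * n with hxdef
  have hx0 : (0 : ℝ) < x := by exact_mod_cast a3
  have hx1 : (1 : ℝ) ≤ x := by exact_mod_cast a3
  rw [← Real.sqrt_eq_rpow, div_lt_iff₀ (Real.sqrt_pos.2 hx0)] at a2
  rw [div_lt_iff₀ (by positivity)] at a1
  have hs := Real.mul_self_sqrt hx0.le
  have h6 : 2 * √(x : ℝ) * Real.log x ≤ Real.log 2 / 4 * x := by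
    have := mul_le_mul_of_nonneg_left a2.le (Real.sqrt_nonneg (x : ℝ))
    nlinarith
  have h4 : (2 : ℝ) * n ≤ x := by
    have : 2 * n ≤ x := Nat.mul_le_mul_right _ (by omega)
    exact_mod_cast this
  have h5 : Real.log ((2 : ℝ) ^ n) ≤ Real.log (primorial x) := by
    rw [Real.log_pow]; nlinarith
  exact_mod_cast (Real.log_le_log_iff (by positivity) (by exact_mod_cast primorial_pos x)).1 h5

/-- The bounds on the coordinates at the successive levels of the recursion, in the order in which
they occur: the primes up to the next bound suffice for the present one. -/
def resBound (K d y : ℕ) : ℕ → ℕ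
  | 0 => y
  | j + 1 => K * (d.size + d * (resBound K d y j).size)

/-- The product of the primes up to `resBound K d y (j + 1)` suffices for the values of polynomials
at coordinates up to `resBound K d y j`. -/
theorem resBound_primorial {K d y : ℕ} (hK : ∀ n, 1 ≤ n → 2 ^ n ≤ primorial (K * n)) (hd : 1 ≤ d)
    (j : ℕ) : d * resBound K d y j ^ d ≤ primorial (resBound K d y (j + 1)) := by
  have h1 : 1 ≤ d.size := Nat.size_pos.2 hd
  refine le_trans ?_ (hK _ (by omega))
  rw [pow_add, mul_comm d (Nat.size _), pow_mul]
  exact Nat.mul_le_mul (Nat.lt_size_self d).le (Nat.pow_le_pow_left (Nat.lt_size_self _).le _)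

theorem le_resBound {K d y : ℕ} (hK : 1 ≤ K) (hd : 1 ≤ d) (hy : 1 ≤ y) (j : ℕ) :
    1 ≤ resBound K d y j ∧ d ≤ resBound K d y (j + 1) := by
  have key : ∀ j, 1 ≤ resBound K d y j → d ≤ resBound K d y (j + 1) := by
    intro j hj
    have h1 : 1 ≤ (resBound K d y j).size := Nat.size_pos.2 hj
    calc d ≤ d * (resBound K d y j).size := Nat.le_mul_of_pos_right _ h1
      _ ≤ d.size + d * (resBound K d y j).size := Nat.le_add_left _ _
      _ ≤ _ := Nat.le_mul_of_pos_left _ hK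
  have h : 1 ≤ resBound K d y j := by
    induction j with
    | zero => exact hy
    | succ j ih => exact hd.trans (key j ih)
  exact ⟨h, key j h⟩

theorem size_le_self (n : ℕ) : n.size ≤ n := Nat.size_le.2 Nat.lt_two_pow_self

theorem resBound_le {K d y : ℕ} (hK : 1 ≤ K) (hd : 1 ≤ d) (hy : 1 ≤ y) (j : ℕ) :
    resBound K d y (j + 1) ≤ (2 * K * d) ^ j * (K * (d.size + d * y.size)) := by
  induction j with
  | zero => simp [resBound]
  | succ j ih =>
    have h1 := (le_resBound hK hd hy (j + 1)).1
    have h2 : d.size + d * (resBound K d y (j + 1)).size ≤ 2 * (d * resBound K d y (j + 1)) := by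
      have a1 := size_le_self d
      have a2 := Nat.mul_le_mul_left d (size_le_self (resBound K d y (j + 1)))
      have a3 : d * 1 ≤ d * resBound K d y (j + 1) := Nat.mul_le_mul_left _ h1
      omega
    calc resBound K d y (j + 1 + 1) ≤ K * (2 * (d * resBound K d y (j + 1))) :=
          Nat.mul_le_mul_left _ h2
      _ = (2 * K * d) * resBound K d y (j + 1) := by ring
      _ ≤ (2 * K * d) * ((2 * K * d) ^ j * (K * (d.size + d * y.size))) := Nat.mul_le_mul_left _ ih
      _ = _ := by rw [pow_succ]; ring

/-- `EvalSpec` for the recursion, with the bounds `resBound`. -/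
theorem evalSpec_resBound {K V m d N y ℓ : ℕ} (hK : 1 ≤ K)
    (hK' : ∀ n, 1 ≤ n → 2 ^ n ≤ primorial (K * n)) (hd : 2 ≤ d) (hy : 2 ≤ y) (hN : N ≤ V)
    (hNm : N * m ≤ V) (hℓ : 1 ≤ ℓ)
    (hV : (d ^ 2 * (y + (2 * K * d) ^ ℓ * (K * (d.size + d * y.size))) ^ (d + 2)) ^ (m + 2) ≤ V) :
    EvalSpec V (levelProg ℓ) m d N y (levelCost V m d N
      ((2 * K * d) ^ ℓ * (K * (d.size + d * y.size))) (resBound K d y ℓ) ℓ) := by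
  have hZ : ∀ j < ℓ, resBound K d y (j + 1) ≤ (2 * K * d) ^ ℓ * (K * (d.size + d * y.size)) := by
    intro j hj
    refine (resBound_le hK (by omega) (by omega) j).trans (Nat.mul_le_mul_right _ ?_)
    exact Nat.pow_le_pow_right (by nlinarith) hj.le
  have h0 : d ≤ resBound K d y ℓ := by
    obtain ⟨j, rfl⟩ : ∃ j, ℓ = j + 1 := ⟨ℓ - 1, by omega⟩
    exact (le_resBound hK (by omega) (by omega) j).2
  refine HT.level (ys := fun i => resBound K d y (ℓ - i)) hd hN hNm hV h0 ℓ ?_ ?_ ?_ ?_ y hy ?_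
  · intro i hi
    have := resBound_primorial (y := y) hK' (by omega : 1 ≤ d) (ℓ - (i + 1))
    rwa [show ℓ - (i + 1) + 1 = ℓ - i by omega] at this
  · intro i hi
    rcases Nat.eq_zero_or_pos (ℓ - i) with h | h
    · simp only [h]; exact Nat.le_add_right _ _
    · have := hZ (ℓ - i - 1) (by omega)
      rw [show ℓ - i - 1 + 1 = ℓ - i by omega] at this
      exact this.trans (Nat.le_add_left _ _)
  · intro i hi
    have := hZ (ℓ - i - 1) (by omega)
    rwa [show ℓ - i - 1 + 1 = ℓ - i by omega] at this
  · intro i hi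
    rcases Nat.eq_zero_or_pos (ℓ - i) with h | h
    · simp only [h]; exact hy
    · have := (le_resBound hK (by omega : 1 ≤ d) (by omega : 1 ≤ y) (ℓ - i - 1)).2
      rw [show ℓ - i - 1 + 1 = ℓ - i by omega] at this
      omega
  · simp [resBound]

end MME

namespace MME

open Finset

/-! ### The running time in terms of the input size

The number `u` stands for `m + d + e * r.size + 2`, a bound for the parameters other than `N`. -/

section

variable {u m d N r e K ℓ : ℕ}

/-- A constant factor is absorbed by one more factor `u`. -/
theorem const_mul_pow_le {c : ℕ} (hu : 256 ≤ u) (hc : c ≤ 256) {i j : ℕ} (h : i < j) :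
    c * u ^ i ≤ u ^ j :=
  calc c * u ^ i ≤ u * u ^ i := Nat.mul_le_mul_right _ (hc.trans hu)
    _ = u ^ (i + 1) := (pow_succ' u i).symm
    _ ≤ u ^ j := Nat.pow_le_pow_right (by omega) h

theorem ringNum_le (hu : 256 ≤ u) (hdu : d ≤ u) (he : e ≤ u) : ringNum d e ≤ u ^ 3 := by
  have h1 : 2 * e * d ≤ 2 * u ^ 2 := by
    calc 2 * e * d ≤ 2 * u * u := by gcongr
      _ = 2 * u ^ 2 := by ring
  have h2 : 1 ≤ u ^ 2 := Nat.pow_pos (by omega)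
  have h3 := const_mul_pow_le (c := 4) hu (by norm_num) (show 2 < 3 by norm_num)
  rw [ringNum]; omega

theorem factorial_ringNum_le (hu : 256 ≤ u) (hdu : d ≤ u) (he : e ≤ u) :
    ringNum d e * (ringNum d e).factorial ≤ 2 ^ (u ^ 3 + u ^ 6) := by
  have h1 := ringNum_le hu hdu he
  have h2 : ringNum d e ≤ 2 ^ u ^ 3 :=
    Nat.lt_two_pow_self.le.trans (Nat.pow_le_pow_right (by norm_num) h1)
  rw [pow_add]
  refine Nat.mul_le_mul h2 ((Nat.factorial_le_pow _).trans ?_)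
  calc ringNum d e ^ ringNum d e ≤ (2 ^ u ^ 3) ^ ringNum d e := Nat.pow_le_pow_left h2 _
    _ ≤ (2 ^ u ^ 3) ^ u ^ 3 := Nat.pow_le_pow_right (by positivity) h1
    _ = 2 ^ u ^ 6 := by rw [← pow_mul, ← pow_add]

theorem base_le (hdu : d ≤ u) (he : e < u) (hr : r.size ≤ u) :
    d * (e + 1) * r ≤ 2 ^ (3 * u) := by
  have h1 : d ≤ 2 ^ u := hdu.trans Nat.lt_two_pow_self.le
  have h2 : e + 1 ≤ 2 ^ u := (Nat.succ_le_of_lt he).trans Nat.lt_two_pow_self.le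
  have h3 : r ≤ 2 ^ u := (Nat.size_le.1 hr).le
  calc d * (e + 1) * r ≤ 2 ^ u * 2 ^ u * 2 ^ u := by gcongr
    _ = 2 ^ (3 * u) := by rw [← pow_add, ← pow_add]; congr 1; ring

theorem ringBase_le (hu : 256 ≤ u) (hdu : d ≤ u) (hm : m < u) (he : e < u) (hr : r.size ≤ u) :
    ringBase m d r e ≤ 2 ^ u ^ 7 := by
  have h1 := factorial_ringNum_le hu hdu he.le
  have h2 : ringBound m d r e ≤ 2 ^ u ^ 4 := by
    rw [ringBound]
    calc (d * (e + 1) * r) ^ (d * (m + 1)) ≤ (2 ^ (3 * u)) ^ (d * (m + 1)) :=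
          Nat.pow_le_pow_left (base_le hdu he hr) _
      _ = 2 ^ (3 * u * (d * (m + 1))) := by rw [← pow_mul]
      _ ≤ 2 ^ (3 * u * (u * u)) := by gcongr <;> omega
      _ ≤ 2 ^ u ^ 4 := by
          refine Nat.pow_le_pow_right (by norm_num) ?_
          calc 3 * u * (u * u) = 3 * u ^ 3 := by ring
            _ ≤ u ^ 4 := const_mul_pow_le hu (by norm_num) (by norm_num)
  calc ringBase m d r e = 1 + 2 * (ringNum d e * (ringNum d e).factorial) * ringBound m d r e := by
        rw [ringBase]; ring
    _ ≤ 2 ^ (u ^ 3 + u ^ 6 + u ^ 4 + 1) + 2 * 2 ^ (u ^ 3 + u ^ 6) * 2 ^ u ^ 4 :=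
        Nat.add_le_add Nat.one_le_two_pow (by gcongr)
    _ = 2 ^ (u ^ 3 + u ^ 6 + u ^ 4 + 2) := by ring
    _ ≤ 2 ^ u ^ 7 := by
        refine Nat.pow_le_pow_right (by norm_num) ?_
        have a1 := const_mul_pow_le (c := 1) hu (by norm_num) (show 3 < 6 by norm_num)
        have a2 := const_mul_pow_le (c := 1) hu (by norm_num) (show 4 < 6 by norm_num)
        have a3 := const_mul_pow_le (c := 2) hu (by norm_num) (show 0 < 6 by norm_num)
        have a4 := const_mul_pow_le (c := 4) hu (by norm_num) (show 6 < 7 by norm_num)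
        rw [pow_zero] at a3
        omega

theorem ringRes_le (hu : 256 ≤ u) (hdu : d ≤ u) (he : e < u) (hr : r.size ≤ u) :
    ringRes d r e ≤ 2 ^ u ^ 8 := by
  have h1 := factorial_ringNum_le hu hdu he.le
  have h2 := base_le hdu he hr
  have h3 : d ≤ 2 ^ u := hdu.trans Nat.lt_two_pow_self.le
  calc ringRes d r e = d * (e + 1) * r * d * (ringNum d e * (ringNum d e).factorial) ^ e := by
        rw [ringRes]; ring
    _ ≤ 2 ^ (3 * u) * 2 ^ u * (2 ^ (u ^ 3 + u ^ 6)) ^ u := by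
        have : 0 < 2 ^ (u ^ 3 + u ^ 6) := by positivity
        gcongr
    _ = 2 ^ (4 * u ^ 1 + u ^ 4 + u ^ 7) := by
        rw [← pow_mul, ← pow_add, ← pow_add]; congr 1; ring
    _ ≤ 2 ^ u ^ 8 := by
        refine Nat.pow_le_pow_right (by norm_num) ?_
        have a1 := const_mul_pow_le (c := 4) hu (by norm_num) (show 1 < 7 by norm_num)
        have a2 := const_mul_pow_le (c := 1) hu (by norm_num) (show 4 < 7 by norm_num)
        have a4 := const_mul_pow_le (c := 3) hu (by norm_num) (show 7 < 8 by norm_num)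
        omega

theorem modBound_le (hu : 256 ≤ u) (hdu : d ≤ u) (he : e < u) (hr : r.size ≤ u) (hK : K ≤ u) :
    (2 * K * d) ^ ℓ * (K * (d.size + d * (ringRes d r e).size)) ≤ u ^ (3 * ℓ + 12) := by
  have h1 : (ringRes d r e).size ≤ u ^ 9 := by
    refine Nat.size_le.2 ((ringRes_le hu hdu he hr).trans_lt ?_)
    refine Nat.pow_lt_pow_right (by norm_num) (Nat.pow_lt_pow_right (by omega) (by norm_num))
  have h2 : d.size ≤ u := (size_le_self d).trans hdu
  have h3 : 2 ≤ u := by omega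
  have h4 : u + u * u ^ 9 ≤ u ^ 10 * u := by
    have := const_mul_pow_le (c := 2) hu (by norm_num) (show 10 < 11 by norm_num)
    have := const_mul_pow_le (c := 1) hu (by norm_num) (show 1 < 10 by norm_num)
    calc u + u * u ^ 9 = u ^ 1 + u ^ 10 := by ring
      _ ≤ u ^ 11 := by omega
      _ = _ := by ring
  have h5 : 2 * K * d ≤ u ^ 3 := by
    calc 2 * K * d ≤ u * u * u := by gcongr
      _ = u ^ 3 := by ring
  have h6 : K * (d.size + d * (ringRes d r e).size) ≤ u ^ 12 := by
    calc K * (d.size + d * (ringRes d r e).size) ≤ u * (u + u * u ^ 9) := by gcongr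
      _ ≤ u * (u ^ 10 * u) := Nat.mul_le_mul_left _ h4
      _ = u ^ 12 := by ring
  calc (2 * K * d) ^ ℓ * (K * (d.size + d * (ringRes d r e).size)) ≤ (u ^ 3) ^ ℓ * u ^ 12 :=
        Nat.mul_le_mul (Nat.pow_le_pow_left h5 _) h6
    _ = u ^ (3 * ℓ + 12) := by rw [← pow_mul, ← pow_add]

/-- The bit length of a bound for all numbers is polynomial in `u`, up to the bit length of `N`. -/
theorem ringBounds_of_le (hu : 256 ≤ u) (hd : 2 ≤ d) (hr2 : 2 ≤ r) (he1 : 1 ≤ e) (hdu : d ≤ u)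
    (hm : m + 2 ≤ u) (he : e < u) (hr : r.size ≤ u) :
    RingBounds (2 ^ u ^ 13 * (N + 1)) m d N r e := by
  have hle : ∀ {x : ℕ}, x ≤ 2 ^ u ^ 13 → x ≤ 2 ^ u ^ 13 * (N + 1) := fun h =>
    h.trans (Nat.le_mul_of_pos_right _ (by omega))
  have h1 : 1 ≤ u ^ 13 := Nat.pow_pos (by omega)
  have h2 : u ≤ u ^ 13 := Nat.le_self_pow (by norm_num) _
  refine ⟨hd, hr2, he1, hle ?_, hle ?_, ?_, ?_⟩
  · calc ringBase m d r e ^ (ringNum d e * (m + 2) + e)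
        ≤ (2 ^ u ^ 7) ^ (ringNum d e * (m + 2) + e) :=
          Nat.pow_le_pow_left (ringBase_le hu hdu (by omega) he hr) _
      _ ≤ (2 ^ u ^ 7) ^ (u ^ 3 * u + u) := by
          have := ringNum_le hu hdu he.le
          have h0 : 0 < 2 ^ u ^ 7 := by positivity
          gcongr
      _ = 2 ^ (u ^ 11 + u ^ 8) := by rw [← pow_mul]; congr 1; ring
      _ ≤ 2 ^ u ^ 13 := by
          refine Nat.pow_le_pow_right (by norm_num) ?_
          have a1 := const_mul_pow_le (c := 2) hu (by norm_num) (show 11 < 13 by norm_num)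
          have a2 := const_mul_pow_le (c := 1) hu (by norm_num) (show 8 < 11 by norm_num)
          omega
  · calc ringRes d r e ^ (2 * m + 1) ≤ (2 ^ u ^ 8) ^ (2 * m + 1) :=
          Nat.pow_le_pow_left (ringRes_le hu hdu he hr) _
      _ ≤ (2 ^ u ^ 8) ^ (2 * u) := Nat.pow_le_pow_right (by positivity) (by omega)
      _ = 2 ^ (2 * u ^ 9) := by rw [← pow_mul]; congr 1; ring
      _ ≤ 2 ^ u ^ 13 := Nat.pow_le_pow_right (by norm_num)
          (const_mul_pow_le hu (by norm_num) (by norm_num))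
  · exact (Nat.le_succ N).trans (Nat.le_mul_of_pos_left _ (by positivity))
  · rw [mul_comm]
    refine Nat.mul_le_mul (le_trans ?_ (Nat.pow_le_pow_right (by norm_num) h2)) (Nat.le_succ N)
    exact (by omega : m ≤ u).trans Nat.lt_two_pow_self.le

theorem level_bound_le (hu : 256 ≤ u) (hdu : d ≤ u) (hm : m + 2 ≤ u)
    (he : e < u) (hr : r.size ≤ u) (hK : K ≤ u) (hℓ : 3 * ℓ + 12 ≤ u) :
    (d ^ 2 * (ringRes d r e + (2 * K * d) ^ ℓ * (K * (d.size + d * (ringRes d r e).size))) ^ (d + 2))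
      ^ (m + 2) ≤ 2 ^ u ^ 13 * (N + 1) := by
  have h1 : (2 * K * d) ^ ℓ * (K * (d.size + d * (ringRes d r e).size)) ≤ 2 ^ u ^ 8 := by
    refine (modBound_le hu hdu he hr hK).trans ?_
    calc u ^ (3 * ℓ + 12) ≤ (2 ^ u) ^ (3 * ℓ + 12) := Nat.pow_le_pow_left Nat.lt_two_pow_self.le _
      _ = 2 ^ (u * (3 * ℓ + 12)) := by rw [← pow_mul]
      _ ≤ 2 ^ u ^ 8 := by
          refine Nat.pow_le_pow_right (by norm_num) ((Nat.mul_le_mul_left _ hℓ).trans ?_)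
          calc u * u = 1 * u ^ 2 := by ring
            _ ≤ u ^ 8 := const_mul_pow_le hu (by norm_num) (by norm_num)
  have h2 := ringRes_le hu hdu he hr
  have h3 : d ≤ 2 ^ u := hdu.trans Nat.lt_two_pow_self.le
  have h4 : ringRes d r e + (2 * K * d) ^ ℓ * (K * (d.size + d * (ringRes d r e).size)) ≤
      2 ^ (u ^ 8 + 1) := by rw [pow_succ]; omega
  refine le_trans ?_ (Nat.le_mul_of_pos_right _ (by omega))
  calc _ ≤ ((2 ^ u) ^ 2 * (2 ^ (u ^ 8 + 1)) ^ (2 * u)) ^ u := by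
        refine (Nat.pow_le_pow_left (Nat.mul_le_mul (Nat.pow_le_pow_left h3 _)
          ((Nat.pow_le_pow_left h4 _).trans (Nat.pow_le_pow_right (by positivity) (by omega)))) _).trans
          (Nat.pow_le_pow_right (by positivity) hm)
    _ = 2 ^ (4 * u ^ 2 + 2 * u ^ 10) := by
        rw [← pow_mul, ← pow_mul, ← pow_add, ← pow_mul]; congr 1; ring
    _ ≤ 2 ^ u ^ 13 := by
        refine Nat.pow_le_pow_right (by norm_num) ?_
        have a1 := const_mul_pow_le (c := 4) hu (by norm_num) (show 2 < 10 by norm_num)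
        have a2 := const_mul_pow_le (c := 3) hu (by norm_num) (show 10 < 13 by norm_num)
        omega

theorem size_bound_le (hu : 256 ≤ u) : (2 ^ u ^ 13 * (N + 1)).size ≤ u ^ 14 * (N + 1).size := by
  have h1 : 1 ≤ (N + 1).size := Nat.size_pos.2 (by omega)
  have h2 : (2 ^ u ^ 13 * (N + 1)).size ≤ u ^ 13 + (N + 1).size := by
    rw [Nat.size_le, pow_add]
    exact Nat.mul_lt_mul_of_pos_left (Nat.lt_size_self _) (by positivity)
  have h3 : 1 ≤ u ^ 13 := Nat.pow_pos (by omega)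
  have h4 := const_mul_pow_le (c := 2) hu (by norm_num) (show 13 < 14 by norm_num)
  calc _ ≤ u ^ 13 * (N + 1).size + u ^ 13 * (N + 1).size :=
        h2.trans (Nat.add_le_add (Nat.le_mul_of_pos_right _ h1) (Nat.le_mul_of_pos_left _ h3))
    _ = 2 * u ^ 13 * (N + 1).size := by ring
    _ ≤ _ := Nat.mul_le_mul_right _ h4

theorem levelCost_le {V Z D s : ℕ} (hu : 256 ≤ u) (hdu : d ≤ u) (hm : m + 2 ≤ u) (hd : 1 ≤ d)
    (hD : d ≤ D) (hs : 1 ≤ s) (hZ : Z ≤ u ^ (3 * ℓ + 12)) (hV : V.size ≤ u ^ 14 * s) :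
    levelCost V m d N Z D ℓ ≤
      u ^ (ℓ * (3 * ℓ + 13) + 15) * ((2 ^ (2 * m + 1)) ^ ℓ * (D ^ m + N) * s) := by
  set G := (D ^ m + N) * s with hG
  have hdm : d ^ m ≤ D ^ m := Nat.pow_le_pow_left hD _
  have hdm1 : 1 ≤ d ^ m := Nat.pow_pos (by omega)
  have hGs : D ^ m + N ≤ G := Nat.le_mul_of_pos_right _ hs
  have hG1 : 1 ≤ G := by omega
  have hsG : s ≤ G := Nat.le_mul_of_pos_left _ (by omega)
  have h1 : 30 * (m + 1) * (d + 1) * (D ^ m + N) ≤ 60 * u ^ 2 * G := by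
    calc _ ≤ 30 * u * (2 * u) * G := by gcongr <;> omega
      _ = _ := by ring
  have h2 : 50 * (m + 1) * (N + d ^ m + 1) ≤ 100 * u ^ 1 * G := by
    calc _ ≤ 50 * u * (2 * G) := by gcongr <;> omega
      _ = _ := by ring
  have h3 : 32 * V.size ≤ 32 * u ^ 14 * G := by
    calc _ ≤ 32 * (u ^ 14 * G) := Nat.mul_le_mul_left _ (hV.trans (Nat.mul_le_mul_left _ hsG))
      _ = _ := by ring
  have h4 : 3 * d + 30 ≤ 33 * u ^ 1 * G := by
    calc _ ≤ 33 * u * 1 := by omega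
      _ ≤ 33 * u * G := Nat.mul_le_mul_left _ hG1
      _ = _ := by ring
  have h5 : 60 * u ^ 2 + 100 * u ^ 1 + 32 * u ^ 14 + 33 * u ^ 1 ≤ u ^ 15 := by
    have a1 := const_mul_pow_le (c := 60) hu (by norm_num) (show 2 < 14 by norm_num)
    have a2 := const_mul_pow_le (c := 133) hu (by norm_num) (show 1 < 14 by norm_num)
    have a3 := const_mul_pow_le (c := 34) hu (by norm_num) (show 14 < 15 by norm_num)
    omega
  have h6 : (2 * (Z * 2 ^ (2 * m + 1))) ^ ℓ ≤ u ^ (ℓ * (3 * ℓ + 13)) * (2 ^ (2 * m + 1)) ^ ℓ := by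
    calc _ ≤ (u * (u ^ (3 * ℓ + 12) * 2 ^ (2 * m + 1))) ^ ℓ := by gcongr; omega
      _ = _ := by rw [← mul_assoc, mul_pow, ← pow_succ', ← pow_mul, mul_comm ℓ]
  calc levelCost V m d N Z D ℓ ≤ u ^ (ℓ * (3 * ℓ + 13)) * (2 ^ (2 * m + 1)) ^ ℓ *
        ((60 * u ^ 2 + 100 * u ^ 1 + 32 * u ^ 14 + 33 * u ^ 1) * G) := by
        rw [levelCost]
        refine Nat.mul_le_mul h6 ?_
        rw [add_mul, add_mul, add_mul]
        omega
    _ ≤ u ^ (ℓ * (3 * ℓ + 13)) * (2 ^ (2 * m + 1)) ^ ℓ * (u ^ 15 * G) := by gcongr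
    _ = _ := by rw [hG, pow_add]; ring

theorem ringCost_le {V S s D b : ℕ} (hu : 256 ≤ u) (hdu : d ≤ u) (hm : m + 2 ≤ u) (hd : 1 ≤ d)
    (he : e < u) (hD : d ≤ D) (hs : 1 ≤ s) (hV : V.size ≤ u ^ 14 * s)
    (hS : S ≤ u ^ (b + 15) * ((2 ^ (2 * m + 1)) ^ ℓ * (D ^ m + N) * s)) :
    ringCost V m d N e S ≤ u ^ (b + 22) * ((2 ^ (2 * m + 1)) ^ (ℓ + 1) * (D ^ m + N) * s) := by
  set P := 2 ^ (2 * m + 1) with hP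
  have hP1 : 1 ≤ P := Nat.one_le_two_pow
  have hPl : 1 ≤ P ^ ℓ := Nat.pow_pos hP1
  set G := P ^ ℓ * (D ^ m + N) * s with hG
  set H := P ^ (ℓ + 1) * (D ^ m + N) * s with hH
  have hHG : H = P * G := by rw [hH, hG, pow_succ]; ring
  have hGH : G ≤ H := hHG ▸ Nat.le_mul_of_pos_left _ hP1
  have hdm : d ^ m ≤ D ^ m := Nat.pow_le_pow_left hD _
  have hdm1 : 1 ≤ d ^ m := Nat.pow_pos (by omega)
  have hDG : D ^ m + N ≤ G := by
    rw [hG]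
    exact (Nat.le_mul_of_pos_left _ hPl).trans (Nat.le_mul_of_pos_right _ hs)
  have hsG : s ≤ G := Nat.le_mul_of_pos_left _ (Nat.mul_pos hPl (by omega))
  have hNH : N ≤ H := by omega
  have hdH : d ^ m ≤ H := by omega
  have hH1 : 1 ≤ H := by omega
  have hnum := ringNum_le hu hdu he.le
  have hdm' : d * (m + 1) ≤ u ^ 2 := by
    calc d * (m + 1) ≤ u * u := by gcongr; omega
      _ = _ := by ring
  -- one evaluation over the integers
  have h1 : S + 50 * (m + 1) * (N + d ^ m + 1) + 16 * V.size ≤ 3 * u ^ (b + 15) * G := by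
    have a1 : 50 * (m + 1) * (N + d ^ m + 1) ≤ 100 * u ^ 1 * G := by
      calc _ ≤ 50 * u * (2 * G) := by gcongr <;> omega
        _ = _ := by ring
    have a2 : 16 * V.size ≤ 16 * u ^ 14 * G := by
      calc _ ≤ 16 * (u ^ 14 * G) := Nat.mul_le_mul_left _ (hV.trans (Nat.mul_le_mul_left _ hsG))
        _ = _ := by ring
    have a3 := Nat.mul_le_mul_right G
      (const_mul_pow_le (c := 100) hu (by norm_num) (show 1 < b + 15 by omega))
    have a4 := Nat.mul_le_mul_right G
      (const_mul_pow_le (c := 16) hu (by norm_num) (show 14 < b + 15 by omega))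
    rw [mul_assoc 3]; omega
  have h2 : e * (3 * d ^ m + 3 * N + 12 + (ringNum d e + 1) *
      (P * (S + 50 * (m + 1) * (N + d ^ m + 1) + 16 * V.size))) ≤ 24 * u ^ (b + 19) * H := by
    have a1 : (ringNum d e + 1) * (P * (S + 50 * (m + 1) * (N + d ^ m + 1) + 16 * V.size)) ≤
        6 * u ^ (b + 18) * H := by
      calc _ ≤ (2 * u ^ 3) * (P * (3 * u ^ (b + 15) * G)) := by
            have : 1 ≤ u ^ 3 := Nat.pow_pos (by omega)
            gcongr; omega
        _ = 6 * u ^ (b + 18) * (P * G) := by ring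
        _ = _ := by rw [hHG]
    have a2 : H ≤ u ^ (b + 18) * H := Nat.le_mul_of_pos_left _ (Nat.pow_pos (by omega))
    calc _ ≤ u * (24 * u ^ (b + 18) * H) := by
          refine Nat.mul_le_mul he.le ?_
          rw [mul_assoc 6] at a1
          rw [mul_assoc 24]; omega
      _ = _ := by ring
  have hk : ∀ {x c i : ℕ}, x ≤ c * u ^ i → i ≤ b + 19 → x ≤ c * (u ^ (b + 19) * H) := by
    intro x c i h hi
    refine h.trans (Nat.mul_le_mul_left _ ((Nat.pow_le_pow_right (by omega) hi).trans ?_))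
    exact Nat.le_mul_of_pos_right _ hH1
  have hk' : ∀ {x c i : ℕ}, x ≤ N * (c * u ^ i) → i ≤ b + 19 → x ≤ c * (u ^ (b + 19) * H) := by
    intro x c i h hi
    calc x ≤ N * (c * u ^ i) := h
      _ ≤ H * (c * u ^ (b + 19)) := by gcongr; omega
      _ = _ := by ring
  have b1 : 3 * m + 3 * e + 34 ≤ 7 * (u ^ (b + 19) * H) :=
    hk (i := 1) (by rw [pow_one]; omega) (by omega)
  have b2 : ringNum d e ≤ 1 * (u ^ (b + 19) * H) := hk (i := 3) (by omega) (by omega)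
  have b3 : d * (m + 1) ≤ 1 * (u ^ (b + 19) * H) := hk (i := 2) (by omega) (by omega)
  have b4 : N * m * (3 * e + 6) ≤ 9 * (u ^ (b + 19) * H) := hk' (i := 2) (by
    calc N * m * (3 * e + 6) ≤ N * u * (9 * u) := by gcongr <;> omega
      _ = _ := by ring) (by omega)
  have b5 : 3 * N ≤ 3 * (u ^ (b + 19) * H) := hk' (i := 0) (by rw [pow_zero]; omega) (by omega)
  have b6 : e * (d * (m + 1)) ≤ 1 * (u ^ (b + 19) * H) := hk (i := 3) (by
    calc e * (d * (m + 1)) ≤ u * u ^ 2 := Nat.mul_le_mul he.le hdm'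
      _ = _ := by ring) (by omega)
  have b7 : N * (3 * e + 9 + e * (d * (m + 1)) * (4 * e + 7)) ≤ 23 * (u ^ (b + 19) * H) :=
    hk' (i := 4) (by
      refine Nat.mul_le_mul_left _ ?_
      have c1 : e * (d * (m + 1)) * (4 * e + 7) ≤ u * u ^ 2 * (11 * u) := by gcongr; omega
      have c2 : u * u ^ 2 * (11 * u) = 11 * u ^ 4 := by ring
      have c3 := const_mul_pow_le (c := 12) hu (by norm_num) (show 1 < 4 by norm_num)
      rw [pow_one] at c3
      omega) (by omega)
  have b8 := Nat.mul_le_mul_right H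
    (const_mul_pow_le (c := 256) hu (by norm_num) (show b + 19 < b + 22 by omega))
  rw [ringCost, ← hP]
  rw [mul_assoc 256] at b8
  rw [mul_assoc 24] at h2
  omega

end

end MME

namespace MME

open Finset Polynomial

/-- The running time of `ringProg ℓ`, in terms of the side `resBound` of the final grid. -/
theorem ringProg_evaluatesWithin {K ℓ : ℕ} (hK : 1 ≤ K)
    (hK' : ∀ n, 1 ≤ n → 2 ^ n ≤ primorial (K * n)) (hℓ : 1 ≤ ℓ) {m d N r u : ℕ} {E : (ZMod r)[X]}
    (hE : E.Monic) (hd : 256 + K + (3 * ℓ + 12) ≤ d) (hr : 2 ≤ r) (he : 1 ≤ E.natDegree)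
    (f : MvPolynomial (Fin m) (AdjoinRoot E)) (hf : ∀ j, f.degreeOf j < d)
    (a : Fin N → Fin m → AdjoinRoot E) (hu : u = m + d + E.natDegree * r.size + 2) {T : ℝ}
    (hT : (((ringProg ℓ).costFactor * (u ^ (ℓ * (3 * ℓ + 13) + 50) * ((2 ^ (2 * m + 1)) ^ (ℓ + 1) *
      (resBound K d (ringRes d r E.natDegree) ℓ ^ m + N) * (N + 1).size ^ 3)) : ℕ) : ℝ) ≤ T) :
    EvaluatesWithin (ringProg ℓ) hE m d N f a T := by
  have hsr : 2 ≤ r.size := Nat.lt_size.2 (by simpa using hr)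
  have h1 : E.natDegree * 2 ≤ E.natDegree * r.size := Nat.mul_le_mul_left _ hsr
  have h2 : 1 * r.size ≤ E.natDegree * r.size := Nat.mul_le_mul_right _ he
  have hu256 : 256 ≤ u := by omega
  have hdu : d ≤ u := by omega
  have hm : m + 2 ≤ u := by omega
  have heu : E.natDegree < u := by omega
  have hru : r.size ≤ u := by omega
  have hKu : K ≤ u := by omega
  have hB := ringBounds_of_le (N := N) hu256 (by omega : 2 ≤ d) hr he hdu hm heu hru
  have hy := (le_ringRes (e := E.natDegree) (by omega : 2 ≤ d) hr).2
  have hsub := evalSpec_resBound hK hK' (by omega) hy hB.hN hB.hNm hℓ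
    (level_bound_le hu256 hdu hm heu hru hKu (by omega))
  have hD : d ≤ resBound K d (ringRes d r E.natDegree) ℓ := by
    obtain ⟨j, rfl⟩ : ∃ j, ℓ = j + 1 := ⟨ℓ - 1, by omega⟩
    exact (le_resBound hK (by omega) (by omega) j).2
  have hs : 1 ≤ (N + 1).size := Nat.size_pos.2 (by omega)
  have hV := size_bound_le (N := N) hu256
  have hcost := ringCost_le hu256 hdu hm (by omega) heu hD hs hV
    (levelCost_le (ℓ := ℓ) (N := N) hu256 hdu hm (by omega) hD hs
      (modBound_le hu256 hdu heu hru hKu) hV)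
  refine ringProg_exec hE hB hsub f a hf (le_trans ?_ hT)
  norm_cast
  calc _ ≤ _ := Nat.mul_le_mul hcost (Nat.mul_le_mul_left _ (Nat.pow_le_pow_left hV 2))
    _ = _ := by ring

/-! ### Iterated logarithms -/

theorem size_le_logb {n : ℕ} (hn : 1 ≤ n) : (n.size : ℝ) ≤ 1 + Real.logb 2 n := by
  have h1 : 1 ≤ n.size := Nat.size_pos.2 hn
  have h2 : 2 ^ (n.size - 1) ≤ n := Nat.lt_size.1 (by omega)
  have h3 : ((n.size - 1 : ℕ) : ℝ) ≤ Real.logb 2 n := by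
    rw [Real.le_logb_iff_rpow_le one_lt_two (by exact_mod_cast hn), Real.rpow_natCast]
    exact_mod_cast h2
  rw [Nat.cast_sub h1, Nat.cast_one] at h3
  linarith

theorem logb_two_le {x : ℝ} (hx : 0 ≤ x) : Real.logb 2 x ≤ 2 * x := by
  rcases hx.eq_or_lt with rfl | hx
  · simp
  have h1 := Real.log_le_sub_one_of_pos hx
  have h2 := Real.log_two_gt_d9
  rw [Real.logb, div_le_iff₀ (by linarith)]
  nlinarith

theorem iterLog_succ (c : ℕ) (x : ℝ) : iterLog (c + 1) x = max 0 (Real.logb 2 (iterLog c x)) :=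
  Function.iterate_succ_apply' _ _ _

theorem iterLog_nonneg (c : ℕ) {x : ℝ} (hx : 0 ≤ x) : 0 ≤ iterLog c x := by
  cases c with
  | zero => exact hx
  | succ c => rw [iterLog_succ]; exact le_max_left _ _

theorem logb_max_one {x : ℝ} (hx : 0 ≤ x) : Real.logb 2 (max x 1) = max 0 (Real.logb 2 x) := by
  rcases le_total 1 x with h | h
  · rw [max_eq_left h, max_eq_right (Real.logb_nonneg one_lt_two h)]
  · rw [max_eq_right h, Real.logb_one, max_eq_left (Real.logb_nonpos one_lt_two hx h)]

/-- One level of the recursion takes the bound for the coordinates essentially to `d` times its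
logarithm. -/
theorem logb_resBound_succ {K d y : ℕ} (hK : 1 ≤ K) (hd : 1 ≤ d) (hy : 1 ≤ y) (j : ℕ) :
    Real.logb 2 (resBound K d y (j + 1)) ≤
      Real.logb 2 (2 * K) + Real.logb 2 d + Real.logb 2 (1 + Real.logb 2 (resBound K d y j)) := by
  have h1 := (le_resBound hK hd hy j).1
  have h2 := (le_resBound hK hd hy (j + 1)).1
  have hd' : (1 : ℝ) ≤ d := by exact_mod_cast hd
  have hK1 : (1 : ℝ) ≤ K := by exact_mod_cast hK
  have h3 : 0 ≤ Real.logb 2 (resBound K d y j) :=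
    Real.logb_nonneg one_lt_two (by exact_mod_cast h1)
  have h4 : (resBound K d y (j + 1) : ℝ) ≤ 2 * K * d * (1 + Real.logb 2 (resBound K d y j)) := by
    have a1 : (d.size : ℝ) ≤ d := by exact_mod_cast size_le_self d
    have a2 := size_le_logb h1
    rw [resBound]
    push_cast
    calc (K : ℝ) * (d.size + d * (resBound K d y j).size)
        ≤ K * (d + d * (1 + Real.logb 2 (resBound K d y j))) := by gcongr
      _ ≤ K * (2 * (d * (1 + Real.logb 2 (resBound K d y j)))) := by
          have : (d : ℝ) ≤ d * (1 + Real.logb 2 (resBound K d y j)) :=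
            le_mul_of_one_le_right (by linarith) (by linarith)
          gcongr; linarith
      _ = _ := by ring
  refine (Real.logb_le_logb_of_le one_lt_two (by exact_mod_cast h2) h4).trans (le_of_eq ?_)
  rw [Real.logb_mul (by positivity) (by positivity), Real.logb_mul (by positivity) (by positivity)]

/-- The residues modulo the first moduli have bit length polynomial in `d` and `log |R|`, so after one
level modulo primes the logarithm of the bound is of order `log d + log log |R|`. -/
theorem logb_resBound_one {K d r e : ℕ} (hK : 1 ≤ K) (hd : 256 ≤ d) (hr : 2 ≤ r) (he : 1 ≤ e) :
    Real.logb 2 (resBound K d (ringRes d r e) 1) ≤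
      (Real.logb 2 (2 * K) + 30) * (Real.logb 2 d + iterLog 2 ((r ^ e : ℕ) : ℝ)) := by
  set v := d + e * r.size with hv
  have hsr : 2 ≤ r.size := Nat.lt_size.2 (by simpa using hr)
  have h1 : e * 2 ≤ e * r.size := Nat.mul_le_mul_left _ hsr
  have h2 : 1 * r.size ≤ e * r.size := Nat.mul_le_mul_right _ he
  have hd' : (256 : ℝ) ≤ d := by exact_mod_cast hd
  have hK1 : (1 : ℝ) ≤ K := by exact_mod_cast hK
  have he' : (1 : ℝ) ≤ e := by exact_mod_cast he
  have hr' : (2 : ℝ) ≤ r := by exact_mod_cast hr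
  set X := Real.logb 2 ((r ^ e : ℕ) : ℝ) with hX
  have hXe : X = e * Real.logb 2 r := by rw [hX, Nat.cast_pow, Real.logb_pow]
  have hlr : 1 ≤ Real.logb 2 r := by
    rw [Real.le_logb_iff_rpow_le one_lt_two (by linarith), Real.rpow_one]; exact hr'
  have hX1 : 1 ≤ X := by rw [hXe]; nlinarith
  have hiter : iterLog 2 ((r ^ e : ℕ) : ℝ) = Real.logb 2 X := by
    have a1 : iterLog 1 ((r ^ e : ℕ) : ℝ) = X := by
      rw [show (1 : ℕ) = 0 + 1 from rfl, iterLog_succ, show iterLog 0 ((r ^ e : ℕ) : ℝ) =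
        ((r ^ e : ℕ) : ℝ) from rfl, ← hX]
      exact max_eq_right (by linarith)
    rw [show (2 : ℕ) = 1 + 1 from rfl, iterLog_succ, a1]
    exact max_eq_right (Real.logb_nonneg one_lt_two hX1)
  have hLX : 0 ≤ Real.logb 2 X := Real.logb_nonneg one_lt_two hX1
  have hLd : 1 ≤ Real.logb 2 d := by
    rw [Real.le_logb_iff_rpow_le one_lt_two (by linarith), Real.rpow_one]; linarith
  have hLK : 0 ≤ Real.logb 2 (2 * K) := Real.logb_nonneg one_lt_two (by linarith)
  have hvX : (v : ℝ) ≤ 4 * d * X := by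
    have a1 := size_le_logb (by omega : 1 ≤ r)
    have a2 : (e : ℝ) * r.size ≤ 2 * X := by rw [hXe]; nlinarith
    rw [hv]; push_cast; nlinarith
  have hw : resBound K d (ringRes d r e) 1 ≤ 2 * K * v ^ 10 := by
    have hv256 : 256 ≤ v := by omega
    have a1 : (ringRes d r e).size ≤ v ^ 9 := by
      refine Nat.size_le.2 ((ringRes_le (u := v) hv256 (by omega) (by omega) (by omega)).trans_lt ?_)
      exact Nat.pow_lt_pow_right (by norm_num) (Nat.pow_lt_pow_right (by omega) (by norm_num))
    have a2 : d.size ≤ v := (size_le_self d).trans (by omega)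
    have a3 := const_mul_pow_le (c := 1) hv256 (by norm_num) (show 1 < 10 by norm_num)
    calc resBound K d (ringRes d r e) 1 = K * (d.size + d * (ringRes d r e).size) := rfl
      _ ≤ K * (v + v * v ^ 9) := by gcongr; omega
      _ = K * (1 * v ^ 1 + v ^ 10) := by ring
      _ ≤ K * (v ^ 10 + v ^ 10) := by gcongr
      _ = _ := by ring
  have hw0 := (le_resBound hK (by omega : 1 ≤ d) (one_le_two.trans (le_ringRes (e := e)
    (by omega : 2 ≤ d) hr).2) 1).1
  have hw' : (resBound K d (ringRes d r e) 1 : ℝ) ≤ 2 * K * (4 * d * X) ^ 10 := by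
    calc (resBound K d (ringRes d r e) 1 : ℝ) ≤ ((2 * K * v ^ 10 : ℕ) : ℝ) := by exact_mod_cast hw
      _ = 2 * K * (v : ℝ) ^ 10 := by push_cast; ring
      _ ≤ _ := by gcongr
  have h5 := Real.logb_le_logb_of_le one_lt_two (by exact_mod_cast hw0) hw'
  have h6 : Real.logb 2 (2 * K * (4 * d * X) ^ 10) =
      Real.logb 2 (2 * K) + 10 * (2 + Real.logb 2 d + Real.logb 2 X) := by
    have a1 : Real.logb 2 4 = 2 := by
      rw [show (4 : ℝ) = 2 ^ (2 : ℕ) by norm_num, Real.logb_pow,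
        Real.logb_self_eq_one one_lt_two]; norm_num
    have a2 : (d : ℝ) ≠ 0 := by linarith
    have a3 : Real.logb 2 (4 * d * X) = 2 + Real.logb 2 d + Real.logb 2 X := by
      rw [Real.logb_mul (by positivity) (by positivity), Real.logb_mul (by norm_num) a2, a1]
    rw [Real.logb_mul (by positivity) (by positivity), Real.logb_pow, a3]
    norm_num
  rw [h6] at h5
  rw [hiter]
  have h7 : Real.logb 2 (2 * K) ≤ Real.logb 2 (2 * K) * (Real.logb 2 d + Real.logb 2 X) :=
    le_mul_of_one_le_right hLK (by linarith)
  rw [add_mul]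
  linarith

/-- Each further level of the recursion takes one more iterated logarithm of the size of the ring. -/
theorem exists_logb_resBound_le {K : ℕ} (hK : 1 ≤ K) (j : ℕ) : ∃ B : ℝ, 1 ≤ B ∧
    ∀ d r e : ℕ, 256 ≤ d → 2 ≤ r → 1 ≤ e → Real.logb 2 (resBound K d (ringRes d r e) (j + 1)) ≤
      B * (Real.logb 2 d + iterLog (j + 2) ((r ^ e : ℕ) : ℝ)) := by
  have hK1 : (1 : ℝ) ≤ K := by exact_mod_cast hK
  have hLK : 0 ≤ Real.logb 2 (2 * K) := Real.logb_nonneg one_lt_two (by linarith)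
  induction j with
  | zero =>
    exact ⟨Real.logb 2 (2 * K) + 30, by linarith, fun d r e hd hr he => logb_resBound_one hK hd hr he⟩
  | succ j ih =>
    obtain ⟨B, hB, h⟩ := ih
    have hLB : 0 ≤ Real.logb 2 (4 * B) := Real.logb_nonneg one_lt_two (by linarith)
    refine ⟨3 + Real.logb 2 (2 * K) + Real.logb 2 (4 * B), by linarith, fun d r e hd hr he => ?_⟩
    have hd' : (256 : ℝ) ≤ d := by exact_mod_cast hd
    have hLd : 1 ≤ Real.logb 2 d := by
      rw [Real.le_logb_iff_rpow_le one_lt_two (by linarith), Real.rpow_one]; linarith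
    have hy := one_le_two.trans (le_ringRes (e := e) (by omega : 2 ≤ d) hr).2
    have h1 := logb_resBound_succ hK (by omega : 1 ≤ d) hy (j + 1)
    have h2 := h d r e hd hr he
    have h3 := (le_resBound hK (by omega : 1 ≤ d) hy (j + 1)).1
    have h4 : 0 ≤ Real.logb 2 (resBound K d (ringRes d r e) (j + 1)) :=
      Real.logb_nonneg one_lt_two (by exact_mod_cast h3)
    have hT : 0 ≤ iterLog (j + 2) ((r ^ e : ℕ) : ℝ) := iterLog_nonneg _ (by positivity)
    have hT' : 0 ≤ iterLog (j + 1 + 2) ((r ^ e : ℕ) : ℝ) := iterLog_nonneg _ (by positivity)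
    have hstep : Real.logb 2 (max (iterLog (j + 2) ((r ^ e : ℕ) : ℝ)) 1) =
        iterLog (j + 1 + 2) ((r ^ e : ℕ) : ℝ) := by
      rw [logb_max_one hT, ← iterLog_succ]
    -- the sum `log d + t` is bounded by a product; `max t 1` has the next iterate as its logarithm
    set t := iterLog (j + 2) ((r ^ e : ℕ) : ℝ) with ht
    set t' := iterLog (j + 1 + 2) ((r ^ e : ℕ) : ℝ) with ht'
    have h5 : 1 + Real.logb 2 (resBound K d (ringRes d r e) (j + 1)) ≤
        4 * B * Real.logb 2 d * max t 1 := by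
      have a1 : t ≤ max t 1 := le_max_left _ _
      have a2 : 1 ≤ max t 1 := le_max_right _ _
      have a3 : Real.logb 2 d + t ≤ 2 * (Real.logb 2 d * max t 1) := by nlinarith
      have a4 : 1 ≤ Real.logb 2 d * max t 1 := by nlinarith
      have a5 : 1 ≤ B * (Real.logb 2 d * max t 1) := by nlinarith
      have a6 := mul_le_mul_of_nonneg_left a3 (by linarith : 0 ≤ B)
      nlinarith
    have h6 := Real.logb_le_logb_of_le one_lt_two (by linarith) h5
    have hm1 : (0 : ℝ) < max t 1 := lt_max_of_lt_right one_pos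
    rw [Real.logb_mul (by positivity) hm1.ne', Real.logb_mul (by positivity) (by positivity),
      hstep] at h6
    have h7 := logb_two_le (x := Real.logb 2 d) (by linarith)
    have h8 : Real.logb 2 (2 * K) ≤ Real.logb 2 (2 * K) * (Real.logb 2 d + t') :=
      le_mul_of_one_le_right hLK (by linarith)
    have h9 : Real.logb 2 (4 * B) ≤ Real.logb 2 (4 * B) * (Real.logb 2 d + t') :=
      le_mul_of_one_le_right hLB (by linarith)
    rw [add_mul, add_mul]
    linarith

/-- If the `c`-fold iterated logarithm of the size of the ring is at most `d`, then `c + 2` levels of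
the recursion make the coordinates almost as small as `d`. -/
theorem exists_resBound_le {K : ℕ} (hK : 1 ≤ K) (c : ℕ) : ∃ B : ℝ, 1 ≤ B ∧
    ∀ d r e : ℕ, 256 ≤ d → 2 ≤ r → 1 ≤ e → iterLog c ((r ^ e : ℕ) : ℝ) ≤ d →
      (resBound K d (ringRes d r e) (c + 2) : ℝ) ≤
        (d : ℝ) ^ (1 + (Real.logb 2 (2 * K) + Real.logb 2 (B * Real.logb 2 d)) / Real.logb 2 d) := by
  obtain ⟨B, hB, h⟩ := exists_logb_resBound_le hK c
  refine ⟨6 * B, by linarith, fun d r e hd hr he hc => ?_⟩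
  have hd' : (256 : ℝ) ≤ d := by exact_mod_cast hd
  have hLd : 1 ≤ Real.logb 2 d := by
    rw [Real.le_logb_iff_rpow_le one_lt_two (by linarith), Real.rpow_one]; linarith
  have hy := one_le_two.trans (le_ringRes (e := e) (by omega : 2 ≤ d) hr).2
  have h0 : 0 ≤ iterLog c ((r ^ e : ℕ) : ℝ) := iterLog_nonneg _ (by positivity)
  have h1 : iterLog (c + 1) ((r ^ e : ℕ) : ℝ) ≤ Real.logb 2 d := by
    rw [iterLog_succ]
    refine max_le (by linarith) ?_
    rcases h0.eq_or_lt with h | h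
    · rw [← h, Real.logb_zero]; linarith
    · exact Real.logb_le_logb_of_le one_lt_two h hc
  have h2 : iterLog (c + 2) ((r ^ e : ℕ) : ℝ) ≤ 2 * Real.logb 2 d := by
    rw [iterLog_succ]
    exact max_le (by linarith)
      ((logb_two_le (iterLog_nonneg _ (by positivity))).trans (by linarith))
  have h3 := h d r e hd hr he
  have h4 := logb_resBound_succ hK (by omega : 1 ≤ d) hy (c + 1)
  have h5 := (le_resBound hK (by omega : 1 ≤ d) hy (c + 1)).1
  have h6 := (le_resBound hK (by omega : 1 ≤ d) hy (c + 2)).1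
  have h7 : 0 ≤ Real.logb 2 (resBound K d (ringRes d r e) (c + 1)) :=
    Real.logb_nonneg one_lt_two (by exact_mod_cast h5)
  have h8 : 1 + Real.logb 2 (resBound K d (ringRes d r e) (c + 1)) ≤ 6 * B * Real.logb 2 d := by
    have := mul_le_mul_of_nonneg_left h2 (by linarith : 0 ≤ B)
    nlinarith
  have h9 := Real.logb_le_logb_of_le one_lt_two (by linarith) h8
  have hpos : (0 : ℝ) < resBound K d (ringRes d r e) (c + 2) := by exact_mod_cast h6
  rw [← Real.logb_le_logb one_lt_two hpos (by positivity), Real.logb_rpow_eq_mul_logb_of_pos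
    (by linarith), add_mul, one_mul, div_mul_cancel₀ _ (by linarith)]
  linarith

end MME

namespace MME

/-! ### Asymptotics -/

theorem size_le_rpow {N d : ℕ} (hd : 1 ≤ d) {B : ℝ} (hB : ((N + 1 : ℕ) : ℝ) ≤ B) :
    ((N + 1).size : ℝ) ≤ 3 * d * B ^ (1 / d : ℝ) := by
  have hd' : (1 : ℝ) ≤ d := by exact_mod_cast hd
  have hN : (1 : ℝ) ≤ (N + 1 : ℕ) := by exact_mod_cast Nat.succ_pos N
  have hB1 : 1 ≤ B := hN.trans hB
  have h1 := size_le_logb (Nat.succ_pos N)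
  have h2 : Real.logb 2 ((N + 1 : ℕ) : ℝ) ≤ Real.logb 2 B :=
    Real.logb_le_logb_of_le one_lt_two (by linarith) hB
  have h3 : Real.log B ≤ d * B ^ (1 / d : ℝ) := by
    have := Real.log_le_rpow_div (x := B) (by linarith) (show (0 : ℝ) < 1 / d by positivity)
    rwa [div_div_eq_mul_div, div_one, mul_comm] at this
  have h4 : 1 ≤ (d : ℝ) * B ^ (1 / d : ℝ) := by
    have := Real.one_le_rpow hB1 (show (0 : ℝ) ≤ 1 / d by positivity)
    nlinarith
  have h5 : Real.logb 2 B ≤ 2 * (d * B ^ (1 / d : ℝ)) := by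
    have := Real.log_two_gt_d9
    have := Real.log_nonneg hB1
    rw [Real.logb, div_le_iff₀ (by linarith)]
    nlinarith
  linarith

/-- The powers of `2 ^ m`, the ratio of the grid to `d ^ m`, and the bit length of `N` are all
absorbed in the exponent. -/
theorem le_timeBound {κ C₁ ℓ m d N q u D : ℕ} {η : ℝ} (hd : 2 ≤ d) (hη : 0 ≤ η)
    (hq : 1 ≤ Real.logb 2 q) (hD : (D : ℝ) ≤ (d : ℝ) ^ (1 + η))
    (hu : (u : ℝ) ≤ 2 * (m + d + Real.logb 2 q)) :
    ((κ * (u ^ C₁ * ((2 ^ (2 * m + 1)) ^ (ℓ + 1) * (D ^ m + N) * (N + 1).size ^ 3)) : ℕ) : ℝ) ≤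
      timeBound (κ * 2 ^ C₁ * 2 ^ (ℓ + 1) * 54 + C₁ + 3)
        (2 * (ℓ + 1) / Real.logb 2 d + η + 3 / d) m d N q := by
  have hd' : (2 : ℝ) ≤ d := by exact_mod_cast hd
  have hd0 : (0 : ℝ) < d := by linarith
  have hLd : 1 ≤ Real.logb 2 d := by
    rw [Real.le_logb_iff_rpow_le one_lt_two (by linarith), Real.rpow_one]; exact hd'
  set X := Real.logb 2 q with hX
  set U : ℝ := m + d + X with hU
  set B : ℝ := (d : ℝ) ^ m + N with hB
  have hdm : (1 : ℝ) ≤ (d : ℝ) ^ m := one_le_pow₀ (by linarith)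
  have hN0 : (0 : ℝ) ≤ N := Nat.cast_nonneg N
  have hB1 : 1 ≤ B := by linarith
  have hB0 : 0 < B := by linarith
  have hU1 : 1 ≤ U := by
    have : (0 : ℝ) ≤ m := Nat.cast_nonneg m
    linarith
  have hdU : (d : ℝ) ≤ U := by
    have : (0 : ℝ) ≤ m := Nat.cast_nonneg m
    linarith
  have h1 : (u : ℝ) ^ C₁ ≤ 2 ^ C₁ * U ^ C₁ := by rw [← mul_pow]; gcongr
  have h2 : ((2 : ℝ) ^ (2 * m + 1)) ^ (ℓ + 1) ≤
      2 ^ (ℓ + 1) * B ^ (2 * (ℓ + 1) / Real.logb 2 d : ℝ) := by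
    have e1 : ((2 : ℝ) ^ (2 * m + 1)) ^ (ℓ + 1) = 2 ^ (ℓ + 1) * 2 ^ (m * (2 * (ℓ + 1))) := by
      rw [← pow_mul, ← pow_add]; congr 1; ring
    have e2 : (2 : ℝ) ^ (m * (2 * (ℓ + 1))) =
        ((d : ℝ) ^ m) ^ (2 * (ℓ + 1) / Real.logb 2 d : ℝ) := by
      have hdpow : ∀ y : ℝ, (d : ℝ) ^ y = 2 ^ (Real.logb 2 d * y) := fun y => by
        rw [Real.rpow_mul two_pos.le, Real.rpow_logb two_pos (by norm_num) hd0]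
      rw [← Real.rpow_natCast (d : ℝ), ← Real.rpow_mul hd0.le, hdpow, ← Real.rpow_natCast]
      congr 1
      push_cast
      field_simp
    rw [e1, e2]
    gcongr
    linarith
  have h3 : ((D : ℝ) ^ m + N) ≤ 2 * B ^ (1 + η) := by
    have e1 : (D : ℝ) ^ m ≤ B ^ (1 + η) := by
      calc (D : ℝ) ^ m ≤ ((d : ℝ) ^ (1 + η)) ^ m := by gcongr
        _ = ((d : ℝ) ^ m) ^ (1 + η) := by
            rw [← Real.rpow_natCast, ← Real.rpow_natCast, ← Real.rpow_mul hd0.le,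
              ← Real.rpow_mul hd0.le, mul_comm]
        _ ≤ B ^ (1 + η) := by gcongr; linarith
    have e2 : B ^ (1 : ℝ) ≤ B ^ (1 + η) := Real.rpow_le_rpow_of_exponent_le hB1 (by linarith)
    rw [Real.rpow_one] at e2
    linarith
  have h4 : ((N + 1).size : ℝ) ^ 3 ≤ 27 * U ^ 3 * B ^ (3 / d : ℝ) := by
    have e1 := size_le_rpow (N := N) (d := d) (by omega) (B := B) (by push_cast; linarith)
    calc ((N + 1).size : ℝ) ^ 3 ≤ (3 * d * B ^ (1 / d : ℝ)) ^ 3 := by gcongr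
      _ = 27 * d ^ 3 * B ^ (3 / d : ℝ) := by
          rw [mul_pow, ← Real.rpow_natCast (B ^ (1 / d : ℝ)), ← Real.rpow_mul hB0.le, mul_pow]
          congr 2
          · norm_num
          · push_cast; ring
      _ ≤ _ := by gcongr
  set C : ℕ := κ * 2 ^ C₁ * 2 ^ (ℓ + 1) * 54 + C₁ + 3 with hC
  have hC1 : (κ : ℝ) * 2 ^ C₁ * 2 ^ (ℓ + 1) * 54 ≤ C := by
    rw [hC]; push_cast
    have : (0 : ℝ) ≤ C₁ := Nat.cast_nonneg _
    linarith
  rw [timeBound]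
  push_cast
  calc (κ : ℝ) * ((u : ℝ) ^ C₁ * (((2 : ℝ) ^ (2 * m + 1)) ^ (ℓ + 1) * ((D : ℝ) ^ m + N) *
        ((N + 1).size : ℝ) ^ 3))
      ≤ κ * ((2 ^ C₁ * U ^ C₁) * ((2 ^ (ℓ + 1) * B ^ (2 * (ℓ + 1) / Real.logb 2 d : ℝ)) *
        (2 * B ^ (1 + η)) * (27 * U ^ 3 * B ^ (3 / d : ℝ)))) := by gcongr
    _ = (B ^ (2 * (ℓ + 1) / Real.logb 2 d : ℝ) * B ^ (1 + η) * B ^ (3 / d : ℝ)) *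
        ((κ * 2 ^ C₁ * 2 ^ (ℓ + 1) * 54) * U ^ (C₁ + 3)) := by ring
    _ = B ^ (1 + (2 * (ℓ + 1) / Real.logb 2 d + η + 3 / d)) *
        ((κ * 2 ^ C₁ * 2 ^ (ℓ + 1) * 54) * U ^ (C₁ + 3)) := by
        rw [← Real.rpow_add hB0, ← Real.rpow_add hB0]
        congr 2
        ring
    _ ≤ B ^ (1 + (2 * (ℓ + 1) / Real.logb 2 d + η + 3 / d)) * (C * U ^ C) := by
        have : U ^ (C₁ + 3) ≤ U ^ C := pow_le_pow_right₀ hU1 (by omega)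
        gcongr

open Filter Topology Polynomial

theorem tendsto_logb_natCast : Tendsto (fun d : ℕ => Real.logb 2 d) atTop atTop :=
  (Real.tendsto_logb_atTop one_lt_two).comp tendsto_natCast_atTop_atTop

theorem tendsto_exponent (A B : ℝ) (hB : 1 ≤ B) (ℓ : ℕ) :
    Tendsto (fun d : ℕ => 2 * (ℓ + 1) / Real.logb 2 d +
      (A + Real.logb 2 (B * Real.logb 2 d)) / Real.logb 2 d + 3 / (d : ℝ)) atTop (𝓝 0) := by
  have h1 : Tendsto (fun x : ℝ => Real.logb 2 (B * x) / x) atTop (𝓝 0) := by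
    have e1 : Tendsto (fun x : ℝ => Real.logb 2 B / x + Real.log x / x / Real.log 2) atTop (𝓝 0) := by
      have := (tendsto_const_nhds (x := Real.logb 2 B)).div_atTop tendsto_id
      simpa using this.add
        ((Real.isLittleO_log_id_atTop.tendsto_div_nhds_zero).div_const (Real.log 2))
    refine e1.congr' ?_
    filter_upwards [eventually_gt_atTop 0] with x hx
    rw [Real.logb_mul (by positivity) hx.ne', add_div, div_right_comm]
    rfl
  have h2 : Tendsto (fun x : ℝ => 2 * ((ℓ : ℝ) + 1) / x + (A + Real.logb 2 (B * x)) / x) atTop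
      (𝓝 0) := by
    have e1 := (tendsto_const_nhds (x := 2 * ((ℓ : ℝ) + 1))).div_atTop (tendsto_id (α := ℝ))
    have e2 := (tendsto_const_nhds (x := A)).div_atTop (tendsto_id (α := ℝ))
    have := e1.add (e2.add h1)
    simpa [add_div] using this
  have h3 : Tendsto (fun d : ℕ => 3 / (d : ℝ)) atTop (𝓝 0) :=
    tendsto_const_nhds.div_atTop tendsto_natCast_atTop_atTop
  simpa using (h2.comp tendsto_logb_natCast).add h3

/-- The evaluation algorithm for extension rings such that the `c`-fold iterated logarithm of their
size is at most `d`. -/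
theorem exists_prog (c : ℕ) : ∃ (P : Prog) (C : ℕ) (δ : ℕ → ℝ) (d₀ : ℕ),
    Tendsto δ atTop (𝓝 0) ∧ ∀ (m d N r : ℕ) (E : (ZMod r)[X]) (hE : E.Monic),
      2 ≤ r → 1 ≤ E.natDegree → d₀ ≤ d → iterLog c (Nat.card (AdjoinRoot E)) ≤ d →
      ∀ (f : MvPolynomial (Fin m) (AdjoinRoot E)) (a : Fin N → Fin m → AdjoinRoot E),
        (∀ j, f.degreeOf j < d) →
        EvaluatesWithin P hE m d N f a (timeBound C (δ d) m d N (Nat.card (AdjoinRoot E))) := by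
  obtain ⟨K, hK2, hK⟩ := exists_two_pow_le_primorial
  have hK1 : 1 ≤ K := by omega
  obtain ⟨B, hB, hD⟩ := exists_resBound_le hK1 c
  obtain ⟨κ, hκ⟩ : ∃ κ, κ = (ringProg (c + 2)).costFactor := ⟨_, rfl⟩
  obtain ⟨C₁, hC₁⟩ : ∃ C₁, C₁ = (c + 2) * (3 * (c + 2) + 13) + 50 := ⟨_, rfl⟩
  refine ⟨ringProg (c + 2), κ * 2 ^ C₁ * 2 ^ (c + 2 + 1) * 54 + C₁ + 3, _,
    256 + K + (3 * (c + 2) + 12), tendsto_exponent (Real.logb 2 (2 * K)) B hB (c + 2), ?_⟩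
  intro m d N r E hE hr he hd hc f a hf
  have hcard := natCard_adjoinRoot hE
  have hd' : (256 : ℝ) ≤ d := by exact_mod_cast (by omega : 256 ≤ d)
  have hLd : 1 ≤ Real.logb 2 d := by
    rw [Real.le_logb_iff_rpow_le one_lt_two (by linarith), Real.rpow_one]; linarith
  have hKr : (1 : ℝ) ≤ K := by exact_mod_cast hK1
  have he' : (1 : ℝ) ≤ E.natDegree := by exact_mod_cast he
  have hlr : 1 ≤ Real.logb 2 r := by
    have : (2 : ℝ) ≤ r := by exact_mod_cast hr
    rw [Real.le_logb_iff_rpow_le one_lt_two (by linarith), Real.rpow_one]; exact this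
  have hq : Real.logb 2 (Nat.card (AdjoinRoot E)) = E.natDegree * Real.logb 2 r := by
    rw [hcard, Nat.cast_pow, Real.logb_pow]
  have h256 : 256 ≤ d := by omega
  have hη : 0 ≤ (Real.logb 2 (2 * K) + Real.logb 2 (B * Real.logb 2 d)) / Real.logb 2 d := by
    have h1 := Real.logb_nonneg one_lt_two (show (1 : ℝ) ≤ 2 * K by linarith)
    have h2 := Real.logb_nonneg one_lt_two (show 1 ≤ B * Real.logb 2 d by nlinarith)
    positivity
  have hq1 : 1 ≤ Real.logb 2 (Nat.card (AdjoinRoot E)) := by rw [hq]; nlinarith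
  have hu : ((m + d + E.natDegree * r.size + 2 : ℕ) : ℝ) ≤
      2 * (m + d + Real.logb 2 (Nat.card (AdjoinRoot E))) := by
    have h1 := size_le_logb (by omega : 1 ≤ r)
    have h2 : (E.natDegree : ℝ) * r.size ≤ 2 * (E.natDegree * Real.logb 2 r) := by nlinarith
    have h3 : (0 : ℝ) ≤ m := Nat.cast_nonneg m
    rw [hq]; push_cast
    linarith
  have hT := le_timeBound (κ := κ) (C₁ := C₁) (ℓ := c + 2) (N := N)
    (show 2 ≤ d by omega) hη hq1 (hD d r E.natDegree h256 hr he (hcard ▸ hc)) hu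
  rw [hκ, hC₁] at hT
  rw [hκ, hC₁]
  refine ringProg_evaluatesWithin hK1 hK (by omega) hE hd hr he f hf a rfl ?_
  exact_mod_cast hT

theorem logb_le_sub_one {x : ℝ} (hx : 4 ≤ x) : Real.logb 2 x ≤ x - 1 := by
  have h1 := Real.log_le_sub_one_of_pos (show 0 < x / 4 by linarith)
  have h2 := Real.log_two_gt_d9
  rw [Real.log_div (by linarith) (by norm_num), show (4 : ℝ) = 2 ^ (2 : ℕ) by norm_num,
    Real.log_pow] at h1
  rw [Real.logb, div_le_iff₀ (by linarith)]
  push_cast at h1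
  nlinarith

theorem iterLog_mono (c : ℕ) {x y : ℝ} (hx : 0 ≤ x) (h : x ≤ y) : iterLog c x ≤ iterLog c y := by
  induction c with
  | zero => exact h
  | succ c ih =>
    rw [iterLog_succ, iterLog_succ]
    refine max_le (le_max_left _ _) ?_
    rcases (iterLog_nonneg c hx).eq_or_lt with h0 | h0
    · rw [← h0, Real.logb_zero]; exact le_max_left _ _
    · exact (Real.logb_le_logb_of_le one_lt_two h0 ih).trans (le_max_right _ _)

/-- Two binary logarithms undo one exponential. -/
theorem iterLog_two_exp_le {x : ℝ} (hx : 4 ≤ x) : iterLog 2 (Real.exp x) ≤ x := by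
  have h2 := Real.log_two_gt_d9
  have h1 : iterLog 1 (Real.exp x) ≤ 2 * x := by
    refine max_le (by linarith) ?_
    rw [Real.logb, Real.log_exp, div_le_iff₀ (by linarith)]
    nlinarith
  have h0 := iterLog_nonneg 1 (Real.exp_pos x).le
  rw [show (2 : ℕ) = 1 + 1 from rfl, iterLog_succ]
  refine max_le (by linarith) ?_
  rcases h0.eq_or_lt with h | h
  · rw [← h, Real.logb_zero]; linarith
  · refine (Real.logb_le_logb_of_le one_lt_two h h1).trans ?_
    rw [Real.logb_mul (by norm_num) (by linarith), Real.logb_self_eq_one one_lt_two]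
    linarith [logb_le_sub_one hx]

theorem le_iterate_exp (h : ℕ) (x : ℝ) : x ≤ Real.exp^[h] x := by
  induction h with
  | zero => exact le_rfl
  | succ h ih =>
    rw [Function.iterate_succ_apply']
    linarith [Real.add_one_le_exp (Real.exp^[h] x)]

theorem iterLog_iterate_exp_le (h : ℕ) {x : ℝ} (hx : 4 ≤ x) : iterLog (2 * h) (Real.exp^[h] x) ≤ x := by
  induction h with
  | zero => exact le_rfl
  | succ h ih =>
    have h1 : iterLog (2 * (h + 1)) (Real.exp^[h + 1] x) =
        iterLog (2 * h) (iterLog 2 (Real.exp (Real.exp^[h] x))) := by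
      rw [Function.iterate_succ_apply']
      exact Function.iterate_add_apply _ (2 * h) 2 _
    rw [h1]
    exact (iterLog_mono _ (iterLog_nonneg _ (Real.exp_pos _).le)
      (iterLog_two_exp_le (hx.trans (le_iterate_exp h x)))).trans ih

end MME

open Filter Topology Polynomial in
theorem mainTheorem2 :
    -- extension rings with bounded iterated logarithm
    (∀ c : ℕ, ∃ (P : MME.Prog) (C : ℕ),
      ∀ ε : ℕ → ℝ, Tendsto ε atTop (𝓝 0) →
      ∃ (δ : ℕ → ℝ) (d₀ : ℕ), Tendsto δ atTop (𝓝 0) ∧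
      ∀ (m d N r : ℕ) (E : (ZMod r)[X]) (hE : E.Monic),
        2 ≤ r → 1 ≤ E.natDegree → d₀ ≤ d →
        MME.iterLog c (Nat.card (AdjoinRoot E)) ≤ (d : ℝ) ^ ε d →
        ∀ (f : MvPolynomial (Fin m) (AdjoinRoot E)) (a : Fin N → Fin m → AdjoinRoot E),
          (∀ j, f.degreeOf j < d) →
          MME.EvaluatesWithin P hE m d N f a
            (MME.timeBound C (δ d) m d N (Nat.card (AdjoinRoot E)))) ∧
    -- finite fields of size at most a tower of exponentials of fixed height
    (∀ h : ℕ, ∃ (P : MME.Prog) (C : ℕ) (δ : ℕ → ℝ) (d₀ : ℕ), Tendsto δ atTop (𝓝 0) ∧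
      ∀ (m d N p : ℕ) (E : (ZMod p)[X]) (hE : E.Monic),
        p.Prime → Irreducible E → d₀ ≤ d →
        (Nat.card (AdjoinRoot E) : ℝ) ≤ Real.exp^[h] d →
        ∀ (f : MvPolynomial (Fin m) (AdjoinRoot E)) (a : Fin N → Fin m → AdjoinRoot E),
          (∀ j, f.degreeOf j < d) →
          MME.EvaluatesWithin P hE m d N f a
            (MME.timeBound C (δ d) m d N (Nat.card (AdjoinRoot E)))) := by
  refine ⟨fun c => ?_, fun h => ?_⟩
  · obtain ⟨P, C, δ, d₀, hδ, hP⟩ := MME.exists_prog c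
    refine ⟨P, C, fun ε hε => ?_⟩
    obtain ⟨d₁, hd₁⟩ := eventually_atTop.1 (hε.eventually (gt_mem_nhds one_pos))
    refine ⟨δ, d₀ + d₁ + 1, hδ, fun m d N r E hE hr he hd hc f a hf => ?_⟩
    refine hP m d N r E hE hr he (by omega) (hc.trans ?_) f a hf
    -- only `d ^ ε d ≤ d` matters
    have h1 : (1 : ℝ) ≤ d := by exact_mod_cast (by omega : 1 ≤ d)
    exact (Real.rpow_le_rpow_of_exponent_le h1 (hd₁ d (by omega)).le).trans_eq (Real.rpow_one _)
  · obtain ⟨P, C, δ, d₀, hδ, hP⟩ := MME.exists_prog (2 * h)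
    refine ⟨P, C, δ, d₀ + 4, hδ, fun m d N p E hE hp hi hd hc f a hf => ?_⟩
    have he : 1 ≤ E.natDegree := Nat.one_le_iff_ne_zero.2 fun h0 =>
      hi.not_isUnit ((hE.natDegree_eq_zero.1 h0) ▸ isUnit_one)
    refine hP m d N p E hE hp.two_le he (by omega) ?_ f a hf
    have h4 : (4 : ℝ) ≤ d := by exact_mod_cast (by omega : 4 ≤ d)
    exact (MME.iterLog_mono _ (Nat.cast_nonneg _) hc).trans (MME.iterLog_iterate_exp_le h h4)
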